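/- Let $\lambda$ be a uniform partition of $n$, that is, $\lambda=(k,k,\dots,k)$ with all parts equal, and suppose $\lambda\neq(1,1,\dots,1)$. Let $\Omega$ be a set of $n$ points and let $G\le\mathrm{Sym}(\Omega)$. An ordered partition of type $\lambda=(\lambda_1,\lambda_2,\dots)$ of $\Omega$ is a sequence $(A_1,A_2,\dots)$ of pairwise disjoint sets with union $\Omega$ and $|A_i|=\lambda_i$ for all $i$. The group $G$ is called $\lambda$-transitive if for any two ordered partitions $(A_1,A_2,\dots)$, $(B_1,B_2,\dots)$ of type $\lambda$ there is $g\in G$ with $A_ig=B_i$ for all $i$, and $\lambda$-homogeneous if for any two such ordered partitions there is $g\in G$ with $\{A_1g,A_2g,\dots\}=\{B_1,B_2,\dots\}$. Suppose that $G$ is $\lambda$-homogeneous. Then one of the following holds: 1. $G$ is $\lambda$-transitive; 2. $n=6$, $\lambda=(3,3)$, and either $G$ is $\mathrm{PSL}(2,5)$ in its action on the $6$ points of the projective line over $\mathbb F_5$, or $G$ fixes a point and acts on the remaining $5$ points as $\mathrm{AGL}(1,5)$, the group of maps $x\mapsto ax+b$ $(a\neq0)$ of $\mathbb F_5$; 3.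 $n=10$, $\lambda=(5,5)$, and $G$ fixes a point and acts on the remaining $9$ points as $\mathrm{PSL}(2,8)$ or $\mathrm{P\Gamma L}(2,8)$ acts on the projective line over $\mathbb F_8$, where $\mathrm{P\Gamma L}(2,8)$ consists of the permutations induced by bijective semilinear maps of $\mathbb F_8^2$; 4. $G$ fixes a point and acts as the alternating or the symmetric group on the remaining $n-1$ points. Here the identifications of groups in 2 and 3 are as permutation groups, that is, up to a relabelling of the points. -/

import Mathlib

open scoped LinearAlgebra.Projectivization MatrixGroups

namespace PartitionHomogeneous

/-- `lam` is a partition of `n`: a non-increasing sequence of positive integers with sum `n`. -/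
structure IsPartitionOf (n : ℕ) (lam : List ℕ) : Prop where
  pos : ∀ a ∈ lam, 0 < a
  noninc : lam.Pairwise (fun a b => b ≤ a)
  sum_eq : lam.sum = n

/-- A partition is uniform if all its parts are equal. -/
def IsUniform (lam : List ℕ) : Prop :=
  ∀ a ∈ lam, ∀ b ∈ lam, a = b

/-- `A = (A₁, A₂, …)` is an ordered partition of `Ω` of type `lam`: the `A i` are pairwise
disjoint, cover `Ω`, and `|A i| = lam i`. -/
structure IsOrderedPartition {Ω : Type*} (lam : List ℕ)
    (A : Fin lam.length → Finset Ω) : Prop where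
  disjoint : ∀ i j, i ≠ j → Disjoint (A i) (A j)
  cover : ∀ x : Ω, ∃ i, x ∈ A i
  card_eq : ∀ i, (A i).card = lam.get i

/-- `G` is `lam`-transitive: any ordered partition of type `lam` is carried part by part to any
other one by an element of `G`. -/
def IsPartitionTransitive {Ω : Type*} (G : Subgroup (Equiv.Perm Ω)) (lam : List ℕ) : Prop :=
  ∀ A B : Fin lam.length → Finset Ω, IsOrderedPartition lam A → IsOrderedPartition lam B →
    ∃ g ∈ G, ∀ i, (A i).map g.toEmbedding = B i

/-- `G` is `lam`-homogeneous: the underlying set of parts `{A₁, A₂, …}` of any ordered partition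
of type `lam` is carried to that of any other one by an element of `G`. -/
def IsPartitionHomogeneous {Ω : Type*} (G : Subgroup (Equiv.Perm Ω)) (lam : List ℕ) : Prop :=
  ∀ A B : Fin lam.length → Finset Ω, IsOrderedPartition lam A → IsOrderedPartition lam B →
    ∃ g ∈ G, Set.range (fun i => (A i).map g.toEmbedding) = Set.range B

/-- `G ≤ Sym(Ω)` and `H ≤ Sym(Δ)` are the same permutation group up to a relabelling of points. -/
def IsPermIsomorphic {Ω Δ : Type*} (G : Subgroup (Equiv.Perm Ω))
    (H : Subgroup (Equiv.Perm Δ)) : Prop :=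
  ∃ e : Δ ≃ Ω, ∀ h : Equiv.Perm Δ, h ∈ H ↔ ∃ g ∈ G, ∀ d : Δ, g (e d) = e (h d)

/-- `G` fixes the point `z`, and the group of permutations it induces on the remaining points is,
up to a relabelling of points, the permutation group `H ≤ Sym(Δ)`. -/
def FixesAndActsAs {Ω Δ : Type*} (G : Subgroup (Equiv.Perm Ω)) (z : Ω)
    (H : Subgroup (Equiv.Perm Δ)) : Prop :=
  (∀ g ∈ G, g z = z) ∧
    ∃ e : Δ ≃ {x : Ω // x ≠ z}, ∀ h : Equiv.Perm Δ,
      h ∈ H ↔ ∃ g ∈ G, ∀ d : Δ, g (e d : Ω) = (e (h d) : Ω)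

/-- The group `AGL(1, K)` of all maps `x ↦ a x + b` with `a ≠ 0`, acting on the points of `K`. -/
def AGL1 (K : Type*) [Field K] : Subgroup (Equiv.Perm K) where
  carrier := {g | ∃ a b : K, a ≠ 0 ∧ ∀ x, g x = a * x + b}
  one_mem' := ⟨1, 0, one_ne_zero, fun x => by simp⟩
  mul_mem' := by
    rintro g h ⟨a, b, ha, hg⟩ ⟨c, d, hc, hh⟩
    exact ⟨a * c, a * d + b, mul_ne_zero ha hc, fun x => by
      rw [Equiv.Perm.mul_apply, hh, hg]; ring⟩
  inv_mem' := by
    rintro g ⟨a, b, ha, hg⟩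
    refine ⟨a⁻¹, -(a⁻¹ * b), inv_ne_zero ha, fun x => ?_⟩
    rw [Equiv.Perm.inv_eq_iff_eq, hg]
    field_simp
    ring

/-- So that `ZMod 5` is a field. -/
instance fact_prime_five : Fact (Nat.Prime 5) := ⟨by norm_num⟩

/-- The group `PSL(2, K)` as a permutation group on the projective line over `K`. -/
def PSL2 (K : Type*) [Field K] : Subgroup (Equiv.Perm (ℙ K (Fin 2 → K))) :=
  (MulAction.toPermHom PSL(2, K) (ℙ K (Fin 2 → K))).range

/-- The group `PΓL(2, K)` of all permutations of the projective line over `K` that are induced by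
a bijective semilinear map of `K²`, that is, an additive bijection `f` with
`f (c v) = σ(c) f(v)` for a field automorphism `σ`. -/
def PGammaL2 (K : Type*) [Field K] : Subgroup (Equiv.Perm (ℙ K (Fin 2 → K))) where
  carrier := {g | ∃ (σ : K ≃+* K) (f : (Fin 2 → K) ≃+ (Fin 2 → K)),
    (∀ (c : K) (v : Fin 2 → K), f (c • v) = σ c • f v) ∧
    ∀ (v : Fin 2 → K) (hv : v ≠ 0), g (Projectivization.mk K v hv) =
      Projectivization.mk K (f v) (f.map_ne_zero_iff.mpr hv)}
  one_mem' := ⟨RingEquiv.refl K, AddEquiv.refl _, fun _ _ => rfl, fun _ _ => rfl⟩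
  mul_mem' := by
    rintro g h ⟨σ, f, hf, hg⟩ ⟨τ, k, hk, hh⟩
    refine ⟨τ.trans σ, k.trans f, fun c v => ?_, fun v hv => ?_⟩
    · simp [hf, hk]
    · rw [Equiv.Perm.mul_apply, hh, hg]
      rfl
  inv_mem' := by
    rintro g ⟨σ, f, hf, hg⟩
    refine ⟨σ.symm, f.symm, fun c v => ?_, fun v hv => ?_⟩
    · apply f.injective
      simp [hf]
    · rw [Equiv.Perm.inv_eq_iff_eq, hg]
      simp

end PartitionHomogeneous

/-! Let λ consist of m parts equal to k. Apart from trivial cases m, k ≥ 2, and ordered partitions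
are encoded as colourings Ω → Fin m with all classes of size k.

Orbits on pairs. For a G-invariant symmetric φ, the sum of φ over monochromatic pairs is the same
for every colouring. Comparing a colouring with those obtained by two disjoint swaps gives φ(x,a) +
φ(y,b) = φ(x,b) + φ(y,a) (`four_point_identity`). A graph with this property is empty, complete, a
star or the complement of a star. Hence G is transitive on pairs, or it fixes a point z and is
transitive on the pairs of other points (`pairHomogeneous_or_fixes`). In degree at least 3
transitivity on pairs implies primitivity.

Large degree. Orbit counting gives n!·|T| = |G|·m!·(k!)^m, where T stabilises a colouring up to
renaming colours, so every prime p with m, k < p ≤ n divides |G|. For n ≥ 16 a sharpened Bertrand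
postulate yields such a p with n/2 < p ≤ n − 4. An element of order p is then a p-cycle, and
Jordan's theorem (`alternatingGroup_le_of_isCycle`) puts the alternating group inside G, or inside
its action on the points other than z.

Small degree. The degrees left over are 4, 6, 8, 10 and 14, with m = 2 or k = 2. For k = 2 the
number of pairings provides a 3-cycle or a suitable prime. For m = 2 a group fixing z is (k −
1)-homogeneous on the remaining 2k − 1 points. If there is no 3-cycle, the stabilisers that occur in
degrees 5, 6 and 9 normalise a p-cycle, hence are affine. Together with finite checks this leaves
AGL(1,5), PSL(2,5), PSL(2,8) and PΓL(2,8) as exceptions. Degree 7 is excluded by another finite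
check, and degree 13 by normalising an element of order 5. -/

open Equiv Equiv.Perm

namespace PartitionHomogeneous

/-! ### Sylow arguments for subgroups of prime order -/

section Sylow

variable {A : Type*} [Group A]

theorem exists_conj_eq_pow_aux [Finite A] {p : ℕ} [hp : Fact p.Prime] {c d : A}
    (hc : orderOf c = p) (hd : orderOf d = p) (h : ¬ p ^ 2 ∣ Nat.card A) :
    ∃ y : A, ∃ k : ℕ, y * d * y⁻¹ = c ^ k := by
  have hpA : p ∣ Nat.card A := hc ▸ orderOf_dvd_natCard c
  have hf : (Nat.card A).factorization p = 1 := by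
    have h0 : Nat.card A ≠ 0 := Nat.card_pos.ne'
    have h1 := (hp.out.dvd_iff_one_le_factorization h0).1 hpA
    have h2 : ¬ 2 ≤ (Nat.card A).factorization p := fun h2 =>
      h ((hp.out.pow_dvd_iff_le_factorization h0).2 h2)
    omega
  let P : Sylow p A := Sylow.ofCard (Subgroup.zpowers c) (by rw [Nat.card_zpowers, hc, hf, pow_one])
  let Q : Sylow p A := Sylow.ofCard (Subgroup.zpowers d) (by rw [Nat.card_zpowers, hd, hf, pow_one])
  obtain ⟨y, hy⟩ := MulAction.exists_smul_eq A Q P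
  have hyd : y * d * y⁻¹ ∈ P := by
    rw [← hy, Sylow.smul_def]
    exact Subgroup.smul_mem_pointwise_smul d (MulAut.conj y) _ (Subgroup.mem_zpowers d)
  obtain ⟨k, hk⟩ := (mem_powers_iff_mem_zpowers.2 hyd : _ ∈ Submonoid.powers c)
  exact ⟨y, k, hk.symm⟩

/-- Two elements of prime order `p` of a group whose order is not divisible by `p ^ 2` generate
conjugate subgroups. -/
theorem exists_conj_eq_pow [Finite A] {p : ℕ} [hp : Fact p.Prime] {K : Subgroup A} {c d : A}
    (hcK : c ∈ K) (hdK : d ∈ K) (hc : orderOf c = p) (hd : orderOf d = p)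
    (h : ¬ p ^ 2 ∣ Nat.card K) : ∃ y ∈ K, ∃ k : ℕ, y * d * y⁻¹ = c ^ k := by
  obtain ⟨y, k, hy⟩ := exists_conj_eq_pow_aux (A := K) (c := ⟨c, hcK⟩) (d := ⟨d, hdK⟩)
    (by simpa using hc) (by simpa using hd) h
  exact ⟨y, y.2, k, by simpa using congrArg Subtype.val hy⟩

/-- A subgroup of prime order `p` is normalised by a group of order `p * r` if no divisor of `r`
other than `1` is congruent to `1` modulo `p`. -/
theorem exists_conj_eq_pow_of_card_eq [Finite A] {p r : ℕ} [hp : Fact p.Prime] {K : Subgroup A}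
    {c : A} (hcK : c ∈ K) (hc : orderOf c = p) (hK : Nat.card K = p * r) (hr : ¬ p ∣ r)
    (hdvd : ∀ d, d ∣ r → d % p = 1 → d = 1) :
    ∀ h ∈ K, ∃ k : ℕ, h * c * h⁻¹ = c ^ k := by
  have hr0 : r ≠ 0 := fun h => hr (h ▸ dvd_zero p)
  let c' : K := ⟨c, hcK⟩
  have hc' : orderOf c' = p := by simpa [c'] using hc
  have hf : (Nat.card K).factorization p = 1 := by
    rw [hK, Nat.factorization_mul hp.out.ne_zero hr0]
    simp [hp.out.factorization_self, Nat.factorization_eq_zero_of_not_dvd hr]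
  let P : Sylow p K := Sylow.ofCard (Subgroup.zpowers c')
    (by rw [Nat.card_zpowers, hc', hf, pow_one])
  have hP : Nat.card (P : Subgroup K) = p := by
    change Nat.card (Subgroup.zpowers c') = p
    rw [Nat.card_zpowers, hc']
  have hidx : (P : Subgroup K).index = r := by
    have := (P : Subgroup K).card_mul_index
    rw [hP, hK] at this
    exact Nat.eq_of_mul_eq_mul_left hp.out.pos this
  have h1 : Nat.card (Sylow p K) = 1 := by
    refine hdvd _ (hidx ▸ P.card_dvd_index) ?_
    have := card_sylow_modEq_one p K
    rw [Nat.ModEq, Nat.mod_eq_of_lt hp.out.one_lt] at this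
    exact this
  have hsub : Subsingleton (Sylow p K) := (Nat.card_eq_one_iff_unique.1 h1).1
  have hn : (P : Subgroup K).Normal := P.normal_of_subsingleton
  intro h hh
  have hm : (⟨h, hh⟩ : K) * c' * (⟨h, hh⟩ : K)⁻¹ ∈ (P : Subgroup K) :=
    hn.conj_mem c' (Subgroup.mem_zpowers c') _
  obtain ⟨k, hk⟩ := (mem_powers_iff_mem_zpowers.2 hm : _ ∈ Submonoid.powers c')
  exact ⟨k, by simpa [c'] using (congrArg Subtype.val hk).symm⟩

end Sylow

/-! ### Permutations of prime order and their supports -/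

theorem isThreeCycle_commutator {α : Type*} [DecidableEq α] [Fintype α] {x y : Perm α} {a : α}
    (hx : x a ≠ a) (hy : y a ≠ a) (h : ∀ b, x b ≠ b → y b ≠ b → b = a) :
    (x * y * x⁻¹ * y⁻¹).IsThreeCycle := by
  have hxa : y (x a) = x a := by
    by_contra hc
    exact hx (h _ (fun h' => hx (x.injective h')) hc)
  have hya : x (y a) = y a := by
    by_contra hc
    exact hy (h _ hc (fun h' => hy (y.injective h')))
  have hne : y a ≠ x a := fun h' => by
    rw [h'] at hya
    exact hx (x.injective hya)
  -- The supports meet only in `a`, so `x` and `y` commute up to two transpositions that share the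
  -- point `a`.
  have key : x * y = swap a (y a) * swap a (x a) * (y * x) := by
    ext v
    simp only [Perm.mul_apply]
    by_cases hxv : x v = v
    · rw [hxv]
      by_cases hyv : y v = v
      · rw [hyv, hxv]
        have h1 : v ≠ a := fun h' => hx (h' ▸ hxv)
        have h2 : v ≠ x a := fun h' => by
          rw [h'] at hxv; exact hx (x.injective hxv)
        have h3 : v ≠ y a := fun h' => by
          rw [h'] at hyv; exact hy (y.injective hyv)
        rw [swap_apply_of_ne_of_ne h1 h2, swap_apply_of_ne_of_ne h1 h3]
      · by_cases hva : y v = a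
        · rw [hva, swap_apply_left, swap_apply_of_ne_of_ne hx hne.symm]
        · have h1 : x (y v) = y v := by
            by_contra hc
            exact hva (h _ hc (fun h' => hyv (y.injective h')))
          have h2 : y v ≠ x a := fun h' => by
            rw [← hxa] at h'
            have := y.injective h'
            rw [this] at hxv
            exact hx (x.injective hxv)
          have h3 : y v ≠ y a := fun h' => hx (by rw [← y.injective h']; exact hxv)
          rw [h1, swap_apply_of_ne_of_ne hva h2, swap_apply_of_ne_of_ne hva h3]
    · by_cases hva : v = a
      · subst hva
        rw [hya, hxa, swap_apply_right, swap_apply_left]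
      · have hyv : y v = v := by
          by_contra hc
          exact hva (h _ hxv hc)
        rw [hyv]
        by_cases hxva : x v = a
        · rw [hxva, swap_apply_of_ne_of_ne hy hne, swap_apply_right]
        · have h1 : y (x v) = x v := by
            by_contra hc
            exact hxva (h _ (fun h' => hxv (x.injective h')) hc)
          have h2 : x v ≠ x a := fun h' => hva (x.injective h')
          have h3 : x v ≠ y a := fun h' => by
            rw [h'] at h1; exact hy (y.injective h1)
          rw [h1, swap_apply_of_ne_of_ne hxva h2, swap_apply_of_ne_of_ne hxva h3]
  have : x * y * x⁻¹ * y⁻¹ = swap a (y a) * swap a (x a) := by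
    rw [key]; group
  rw [this]
  exact isThreeCycle_swap_mul_swap_same hy.symm hx.symm hne

/-- The permutations fixing every point outside a given set. -/
def movingOnly {α : Type*} (s : Set α) : Subgroup (Perm α) where
  carrier := {g | ∀ a ∉ s, g a = a}
  one_mem' := fun _ _ => rfl
  mul_mem' := fun {g h} hg hh a ha => by rw [Perm.mul_apply, hh a ha, hg a ha]
  inv_mem' := fun {g} hg a ha => by rw [Perm.inv_eq_iff_eq, hg a ha]

theorem card_dvd_factorial {α : Type*} [Finite α] {s : Set α} {K : Subgroup (Perm α)}
    (hK : K ≤ movingOnly s) : Nat.card K ∣ (s.ncard).factorial := by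
  classical
  have h1 : Nat.card (movingOnly s) = (s.ncard).factorial := by
    rw [← Nat.card_coe_set_eq, ← Nat.card_perm]
    exact (Nat.card_congr (Equiv.Perm.subtypeEquivSubtypePerm (· ∈ s))).symm
  rw [← h1]
  exact Subgroup.card_dvd_of_le hK

theorem not_sq_dvd_factorial {p : ℕ} (hp : p.Prime) : ¬ p ^ 2 ∣ p.factorial := by
  intro h
  have h2 : p * p ∣ p * (p - 1).factorial := by
    rwa [Nat.mul_factorial_pred hp.ne_zero, ← sq]
  have := Nat.dvd_of_mul_dvd_mul_left hp.pos h2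
  have := (hp.dvd_factorial).1 this
  have := hp.pos
  omega

/-- In prime order all nontrivial cycles have length `p`, so the number of moved points determines
the cycle type and hence the conjugacy class. -/
theorem exists_equiv_of_prime_order {α β : Type*} [Fintype α] [Fintype β] [DecidableEq α]
    [DecidableEq β] {p : ℕ} (hp : p.Prime) {σ : Perm α} {τ : Perm β} (hσ : orderOf σ = p)
    (hτ : orderOf τ = p) (hs : σ.support.card = τ.support.card)
    (hcard : Fintype.card α = Fintype.card β) : ∃ e : α ≃ β, ∀ x, e (σ x) = τ (e x) := by
  let e : α ≃ β := Fintype.equivOfCardEq hcard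
  let σ' : Perm β := e.permCongr σ
  have hσ' : orderOf σ' = p := by
    rw [← hσ]; exact MulEquiv.orderOf_eq (e.permCongrHom) σ
  have hs' : σ'.support.card = σ.support.card := by
    have : σ'.support = σ.support.map e.toEmbedding := by
      ext b
      simp [σ', Equiv.permCongr_apply, ← Equiv.symm_apply_eq, Finset.mem_map_equiv]
    rw [this, Finset.card_map]
  have hconj : IsConj σ' τ := by
    rw [isConj_iff_cycleType_eq]
    obtain ⟨a, ha⟩ := cycleType_prime_order (σ := σ') (hσ' ▸ hp)
    obtain ⟨b, hb⟩ := cycleType_prime_order (σ := τ) (hτ ▸ hp)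
    have h1 := sum_cycleType σ'
    have h2 := sum_cycleType τ
    rw [ha, hσ', Multiset.sum_replicate, smul_eq_mul] at h1
    rw [hb, hτ, Multiset.sum_replicate, smul_eq_mul] at h2
    have h3 : (a + 1) * p = (b + 1) * p := by rw [h1, h2, hs', hs]
    rw [ha, hb, hσ', hτ, Nat.eq_of_mul_eq_mul_right hp.pos h3]
  obtain ⟨g, hg⟩ := isConj_iff.1 hconj
  refine ⟨e.trans g, fun x => ?_⟩
  rw [← hg]
  simp [σ', Equiv.permCongr_apply]

theorem support_card_of_prime_order {α : Type*} [Fintype α] [DecidableEq α] {p : ℕ}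
    (hp : p.Prime) {σ : Perm α} (hσ : orderOf σ = p) : ∃ a, σ.support.card = (a + 1) * p := by
  obtain ⟨a, ha⟩ := cycleType_prime_order (σ := σ) (hσ ▸ hp)
  refine ⟨a, ?_⟩
  rw [← sum_cycleType, ha, Multiset.sum_replicate, smul_eq_mul, hσ]

/-- A permutation group of degree less than `3 * p` whose order is divisible by `p ^ 2` contains a
cycle of length `p`. -/
theorem exists_isCycle_of_sq_dvd_card {α : Type*} [Fintype α] [DecidableEq α] {p : ℕ}
    (hp : p.Prime) (hp3 : 3 ≤ p)
    {H : Subgroup (Perm α)} (h : p ^ 2 ∣ Nat.card H) (hα : Fintype.card α < 3 * p) :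
    ∃ g ∈ H, g.IsCycle ∧ orderOf g = p := by
  have : Fact p.Prime := ⟨hp⟩
  obtain ⟨P, hP⟩ := Sylow.exists_subgroup_card_pow_prime p h
  have hcomm : ∀ a b : P, a * b = b * a :=
    (IsPGroup.isMulCommutative_of_card_eq_prime_sq hP).is_comm.comm
  have hPne : ∃ c : P, c ≠ 1 := by
    have : 1 < Nat.card P := by rw [hP]; exact Nat.one_lt_pow two_ne_zero hp.one_lt
    have := Finite.one_lt_card_iff_nontrivial.1 this
    exact exists_ne 1
  obtain ⟨c, hc⟩ := hPne
  have hcx : ∃ x : α, c • x ≠ x := by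
    by_contra hcon
    push Not at hcon
    exact hc (Subtype.ext (Subtype.ext (Equiv.ext hcon)))
  obtain ⟨x, hx⟩ := hcx
  have := Fintype.ofFinite P
  have := Fintype.ofFinite (MulAction.orbit P x)
  have := Fintype.ofFinite (MulAction.stabilizer P x)
  have horb := MulAction.card_orbit_mul_card_stabilizer_eq_card_group P x
  simp only [← Nat.card_eq_fintype_card] at horb
  rw [hP] at horb
  obtain ⟨i, hi, hO⟩ := (Nat.dvd_prime_pow hp).1 (Dvd.intro _ horb)
  have hOle : Nat.card (MulAction.orbit P x) < 3 * p := by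
    rw [Nat.card_coe_set_eq]
    exact lt_of_le_of_lt (Set.ncard_le_card _) (by rwa [Nat.card_eq_fintype_card])
  -- The orbit length is a power of `p`, is not 1 because `x` is moved, and is below `p ^ 2` because
  -- the degree is below `3 * p ≤ p ^ 2`.
  have hi1 : i = 1 := by
    interval_cases i
    · exfalso
      rw [pow_zero, Nat.card_eq_one_iff_unique] at hO
      have := hO.1.elim (⟨c • x, MulAction.mem_orbit x c⟩ : MulAction.orbit P x)
        ⟨x, MulAction.mem_orbit_self x⟩
      exact hx (congrArg Subtype.val this)
    · rfl
    · nlinarith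
  subst hi1
  rw [hO, pow_one, sq] at horb
  have hstab := Nat.eq_of_mul_eq_mul_left hp.pos horb
  have : Nontrivial (MulAction.stabilizer P x) := by
    rw [← Finite.one_lt_card_iff_nontrivial, hstab]; exact hp.one_lt
  obtain ⟨g, hg⟩ := exists_ne (1 : MulAction.stabilizer P x)
  have hog : orderOf g = p := orderOf_eq_prime (hstab ▸ pow_card_eq_one') hg
  let g' : Perm α := ((g : P) : H)
  have hog' : orderOf g' = p := by
    rw [← hog]
    simp [g']
  -- `P` is abelian, so an element fixing `x` fixes its whole orbit. It moves fewer than `2 * p`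
  -- points and, being of order `p`, is a single cycle.
  have hfix : ∀ y ∈ MulAction.orbit P x, g' y = y := by
    rintro y ⟨q, rfl⟩
    have h1 : (g : P) * q = q * g := hcomm _ _
    have h2 : ((g : P) * q) • x = q • x := by
      rw [h1, mul_smul, g.2]
    exact h2
  have hsupp : g'.support.card < 2 * p := by
    have h1 : (g'.support : Set α) ⊆ (MulAction.orbit P x)ᶜ := fun y hy hy' =>
      (mem_support.1 hy) (hfix y hy')
    have h2 := Set.ncard_le_ncard h1
    rw [Set.ncard_coe_finset] at h2
    have h3 := Set.ncard_add_ncard_compl (MulAction.orbit P x)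
    rw [← Nat.card_coe_set_eq, hO, Nat.card_eq_fintype_card, pow_one] at h3
    omega
  exact ⟨g', ((g : P) : H).2, isCycle_of_prime_order (hog' ▸ hp) (hog'.symm ▸ hsupp), hog'⟩

/-! ### Jordan's theorem on cycles of prime length -/

/-- A set of pairwise moves of the fixed points of a cycle can be realised in a primitive group
containing that cycle of prime length. -/
theorem exists_mem_eq_on_fixed {α : Type*} [Fintype α] [DecidableEq α] {G : Subgroup (Perm α)}
    (hG : MulAction.IsPreprimitive G α) {c : Perm α} (hcG : c ∈ G) (hc : c.IsCycle)
    (hp : c.support.card.Prime) (hf : c.support.card < Fintype.card α) (σ : Perm α) :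
    ∃ g ∈ G, ∀ v, c v = v → g v = σ v := by
  classical
  let F : Set α := (c.support : Set α)ᶜ
  obtain ⟨n, hn⟩ : ∃ n, F.ncard = n + 1 := by
    have h3 := Set.ncard_add_ncard_compl (c.support : Set α)
    rw [Set.ncard_coe_finset, Nat.card_eq_fintype_card] at h3
    exact ⟨F.ncard - 1, by simp only [F]; omega⟩
  have hcard : c.support.card + (n + 1) = Fintype.card α := by
    have h3 := Set.ncard_add_ncard_compl (c.support : Set α)
    rw [Set.ncard_coe_finset, Nat.card_eq_fintype_card] at h3
    rw [← hn, ← h3]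
  have h2 := hp.two_le
  -- The pointwise stabiliser of `F` contains `c`, so it is transitive of prime degree on the rest,
  -- hence primitive there. Jordan's criterion turns this into (n + 2)-fold primitivity of `G`,
  -- which allows the n + 1 points of `F` to be moved at will.
  have hprim : MulAction.IsPreprimitive (fixingSubgroup G F) (SubMulAction.ofFixingSubgroup G F) := by
    have := Equiv.Perm.isPretransitive_of_isCycle_mem hc hcG
    apply MulAction.IsPreprimitive.of_prime_card
    convert! hp
    have := Fintype.ofFinite (SubMulAction.ofFixingSubgroup G F)
    rw [Nat.card_eq_fintype_card, Fintype.card_subtype]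
    congr 1
    ext x
    simp [SubMulAction.mem_ofFixingSubgroup_iff, F]
  have hm := hG.isMultiplyPreprimitive hn (by rw [Nat.card_eq_fintype_card]; omega) hprim
  have htr : MulAction.IsMultiplyPretransitive G α (n + 2) :=
    MulAction.IsMultiplyPreprimitive.isMultiplyPretransitive ..
  have htr' : MulAction.IsMultiplyPretransitive G α (n + 1) :=
    MulAction.isMultiplyPretransitive_of_le (n := n + 2) (by omega)
      (by rw [Nat.card_eq_fintype_card]; omega)
  rw [MulAction.isMultiplyPretransitive_iff] at htr'
  have e : Fin (n + 1) ≃ F := by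
    rw [← hn, ← Nat.card_coe_set_eq]
    exact (Finite.equivFin F).symm
  obtain ⟨g, hg⟩ := htr' (e.toEmbedding.trans (Function.Embedding.subtype _))
    ((e.toEmbedding.trans (Function.Embedding.subtype _)).trans σ.toEmbedding)
  refine ⟨g, g.2, fun v hv => ?_⟩
  have hvF : v ∈ F := by simpa [F] using hv
  have := DFunLike.congr_fun hg (e.symm ⟨v, hvF⟩)
  simp only [Function.Embedding.smul_apply, Function.Embedding.trans_apply, Equiv.coe_toEmbedding,
    Equiv.apply_symm_apply, Function.Embedding.subtype_apply] at this
  exact this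

/-- A Frattini argument. If `g` moves the fixed points of `c` as `σ` does, then `c` and its
conjugate by `g` both lie in the pointwise stabiliser of these points. Its order divides p!, so they
generate conjugate Sylow subgroups there, and correcting `g` inside this stabiliser does not change
it on the fixed points. -/
theorem exists_normalizing_eq_on_fixed {α : Type*} [Fintype α] [DecidableEq α]
    {G : Subgroup (Perm α)}
    (hG : MulAction.IsPreprimitive G α) {c : Perm α} (hcG : c ∈ G) (hc : c.IsCycle)
    (hp : c.support.card.Prime) (hf : c.support.card < Fintype.card α) {σ : Perm α}
    (hσ : ∀ v, c v = v → c (σ v) = σ v) :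
    ∃ g ∈ G, (∃ k : ℕ, g * c * g⁻¹ = c ^ k) ∧ ∀ v, c v = v → g v = σ v := by
  have : Fact (c.support.card).Prime := ⟨hp⟩
  obtain ⟨g, hgG, hg⟩ := exists_mem_eq_on_fixed hG hcG hc hp hf σ
  have hσ' : ∀ v, c v = v → c (σ⁻¹ v) = σ⁻¹ v := by
    let F : Finset α := c.supportᶜ
    have hm : ∀ v ∈ F, σ v ∈ F := fun v hv => by
      simp only [F, Finset.mem_compl, notMem_support] at hv ⊢
      exact hσ v hv
    have himg : F.map σ.toEmbedding = F :=
      Finset.eq_of_subset_of_card_le (fun x hx => by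
        obtain ⟨y, hy, rfl⟩ := Finset.mem_map.1 hx
        exact hm y hy) (by simp)
    intro v hv
    have hvF : v ∈ F := by simpa [F] using hv
    rw [← himg] at hvF
    obtain ⟨y, hy, rfl⟩ := Finset.mem_map.1 hvF
    simpa [F] using hy
  let K : Subgroup (Perm α) := G ⊓ movingOnly (c.support : Set α)
  have hcK : c ∈ K := ⟨hcG, fun a ha => by simpa using ha⟩
  have hgK : g * c * g⁻¹ ∈ K := by
    refine ⟨G.mul_mem (G.mul_mem hgG hcG) (G.inv_mem hgG), fun a ha => ?_⟩
    have ha' : c a = a := by simpa using ha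
    have h1 : g⁻¹ a = σ⁻¹ a := by
      rw [Perm.inv_eq_iff_eq, hg _ (hσ' a ha')]
      simp
    rw [Perm.mul_apply, Perm.mul_apply, h1, hσ' a ha', ← h1]
    simp
  have hK : ¬ (c.support.card) ^ 2 ∣ Nat.card K := fun h => by
    have h1 := card_dvd_factorial (K := K) (s := (c.support : Set α)) inf_le_right
    rw [Set.ncard_coe_finset] at h1
    exact not_sq_dvd_factorial hp (h.trans h1)
  obtain ⟨y, hy, k, hk⟩ := exists_conj_eq_pow hcK hgK hc.orderOf
    (by rw [← hc.orderOf]; exact MulEquiv.orderOf_eq (MulAut.conj g) c) hK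
  refine ⟨y * g, G.mul_mem hy.1 hgG, ⟨k, by rw [← hk]; group⟩, fun v hv => ?_⟩
  rw [Perm.mul_apply, hg v hv]
  exact hy.2 _ (by simpa using hσ v hv)

/-- The image of one point of the cycle under `d` determines `d` on the whole cycle. -/
theorem isCycle_eq_pow_of_commute {α : Type*} [Fintype α] [DecidableEq α] {c d : Perm α}
    (hc : c.IsCycle) (h : d * c = c * d) : ∃ n : ℕ, ∀ v, c v ≠ v → d v = (c ^ n) v := by
  obtain ⟨x, hx, hcx⟩ := hc
  have happ : ∀ v, d (c v) = c (d v) := fun v => DFunLike.congr_fun h v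
  have hdx : c (d x) ≠ d x := fun h' => hx (d.injective (by rw [happ, h']))
  obtain ⟨n, hn⟩ := (hcx hdx).exists_nat_pow_eq
  refine ⟨n, fun v hv => ?_⟩
  obtain ⟨i, rfl⟩ := (hcx hv).exists_nat_pow_eq
  have h1 : d * c ^ i = c ^ i * d := (Commute.pow_right h i)
  have h2 : d ((c ^ i) x) = (c ^ i) (d x) := DFunLike.congr_fun h1 x
  rw [h2, ← hn, ← Perm.mul_apply, ← Perm.mul_apply, ← pow_add, ← pow_add, add_comm]

/-- Automorphisms of a cyclic group commute, so a commutator of elements normalising ⟨c⟩ centralises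
`c`. -/
theorem commute_of_conj_eq_pow {A : Type*} [Group A] {c g h : A} {k l : ℕ}
    (hg : g * c * g⁻¹ = c ^ k) (hh : h * c * h⁻¹ = c ^ l) :
    ((h * g)⁻¹ * (g * h)) * c = c * ((h * g)⁻¹ * (g * h)) := by
  have h1 : (g * h) * c * (g * h)⁻¹ = c ^ (k * l) := by
    calc (g * h) * c * (g * h)⁻¹ = g * (h * c * h⁻¹) * g⁻¹ := by group
      _ = (g * c * g⁻¹) ^ l := by rw [hh, conj_pow]
      _ = c ^ (k * l) := by rw [hg, pow_mul]
  have h2 : (h * g) * c * (h * g)⁻¹ = c ^ (k * l) := by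
    calc (h * g) * c * (h * g)⁻¹ = h * (g * c * g⁻¹) * h⁻¹ := by group
      _ = (h * c * h⁻¹) ^ k := by rw [hg, conj_pow]
      _ = c ^ (k * l) := by rw [hh, ← pow_mul, mul_comm]
  have h3 : (g * h) * c = c ^ (k * l) * (g * h) := by rw [← h1]; group
  have h4 : (h * g)⁻¹ * c ^ (k * l) = c * (h * g)⁻¹ := by rw [← h2]; group
  rw [mul_assoc, h3, ← mul_assoc, h4, mul_assoc]

/-- Jordan's theorem: a primitive group containing a cycle of prime length `p ≥ 5` that fixes at
least three points contains the alternating group. -/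
theorem alternatingGroup_le_of_isCycle {α : Type*} [Fintype α] [DecidableEq α]
    {G : Subgroup (Perm α)} (hG : MulAction.IsPreprimitive G α) {c : Perm α} (hcG : c ∈ G)
    (hc : c.IsCycle) (hp : c.support.card.Prime) (hp5 : 5 ≤ c.support.card)
    (hf : c.support.card + 3 ≤ Fintype.card α) : alternatingGroup α ≤ G := by
  have hF : 2 < (c.supportᶜ).card := by rw [Finset.card_compl]; omega
  obtain ⟨u, v, w, hu, hv, hw, huv, huw, hvw⟩ := Finset.two_lt_card_iff.1 hF
  simp only [Finset.mem_compl, notMem_support] at hu hv hw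
  have hmoves : ∀ {a b : α}, c a = a → c b = b → ∀ x, c x = x →
      c (swap a b x) = swap a b x := by
    intro a b ha hb x hx
    rcases swap_apply_eq_iff.1 (rfl : swap a b x = swap a b x) with _
    by_cases h1 : x = a
    · subst h1; rw [swap_apply_left, hb]
    by_cases h2 : x = b
    · subst h2; rw [swap_apply_right, ha]
    rw [swap_apply_of_ne_of_ne h1 h2, hx]
  -- On the fixed points of `c`, `g` acts as (u v) and `h` as (v w), and both normalise ⟨c⟩. Their
  -- commutator `d` is a power of `c` on the support of `c`, and acts as the 3-cycle `s` on the
  -- fixed points. Raising to the power `p` removes the first part and keeps the second.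
  obtain ⟨g, hgG, ⟨k, hgk⟩, hg⟩ := exists_normalizing_eq_on_fixed hG hcG hc hp (by omega)
    (hmoves hu hv)
  obtain ⟨h, hhG, ⟨l, hhl⟩, hh⟩ := exists_normalizing_eq_on_fixed hG hcG hc hp (by omega)
    (hmoves hv hw)
  have hcomm := commute_of_conj_eq_pow hgk hhl
  obtain ⟨d, hd⟩ : ∃ d, d = (h * g)⁻¹ * (g * h) := ⟨_, rfl⟩
  rw [← hd] at hcomm
  set s : Perm α := (swap u v * swap v w) * (swap u v * swap v w) with hs
  have hdG : d ∈ G := hd ▸ G.mul_mem (G.inv_mem (G.mul_mem hhG hgG)) (G.mul_mem hgG hhG)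
  have h3 : s.IsThreeCycle := by
    refine IsThreeCycle.isThreeCycle_sq ?_
    rw [swap_comm u v]
    exact isThreeCycle_swap_mul_swap_same huv.symm hvw huw
  have hsfix : ∀ x, c x ≠ x → s x = x := by
    intro x hx
    have h1 : x ≠ u := fun h => hx (h ▸ hu)
    have h2 : x ≠ v := fun h => hx (h ▸ hv)
    have h3 : x ≠ w := fun h => hx (h ▸ hw)
    simp [hs, swap_apply_of_ne_of_ne, h1, h2, h3]
  have hds : ∀ x, c x = x → d x = s x := by
    intro x hx
    have e1 : (g * h) x = (swap u v * swap v w) x := by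
      rw [Perm.mul_apply, Perm.mul_apply, hh x hx, hg _ (hmoves hv hw x hx)]
    have e2 : ∀ y, c y = y → (h * g) y = (swap v w * swap u v) y := by
      intro y hy
      rw [Perm.mul_apply, Perm.mul_apply, hg y hy, hh _ (hmoves hu hv y hy)]
    have hsx : c (s x) = s x := by
      simp only [hs, Perm.mul_apply]
      exact hmoves hu hv _ (hmoves hv hw _ (hmoves hu hv _ (hmoves hv hw _ hx)))
    rw [hd, Perm.mul_apply, Perm.inv_eq_iff_eq, e2 _ hsx, e1]
    simp [hs]
  obtain ⟨n, hn⟩ := isCycle_eq_pow_of_commute hc hcomm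
  set p := c.support.card with hpdef
  have hdp : d ^ p = s ^ p := by
    have hinv : ∀ i : ℕ, ∀ x, (c x = x → (d ^ i) x = (s ^ i) x ∧ c ((s ^ i) x) = (s ^ i) x) ∧
        (c x ≠ x → (d ^ i) x = (c ^ (n * i)) x) := by
      intro i
      induction i with
      | zero => intro x; simp
      | succ i ih =>
        intro x
        constructor
        · intro hx
          obtain ⟨h1, h2⟩ := (ih x).1 hx
          refine ⟨by rw [pow_succ', pow_succ', Perm.mul_apply, Perm.mul_apply, h1, hds _ h2], ?_⟩
          rw [pow_succ', Perm.mul_apply]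
          simp only [hs, Perm.mul_apply]
          exact hmoves hu hv _ (hmoves hv hw _ (hmoves hu hv _ (hmoves hv hw _ h2)))
        · intro hx
          have h1 := (ih x).2 hx
          have h2 : c ((c ^ (n * i)) x) ≠ (c ^ (n * i)) x := by
            rw [← Perm.mul_apply, ← pow_succ', pow_succ, Perm.mul_apply]
            exact fun h' => hx ((c ^ (n * i)).injective h')
          rw [pow_succ', Perm.mul_apply, h1, hn _ h2, ← Perm.mul_apply, ← pow_add]
          congr 2
          ring
    ext x
    by_cases hx : c x = x
    · exact ((hinv p x).1 hx).1
    · rw [(hinv p x).2 hx]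
      have h1 : c ^ (n * p) = 1 := by
        rw [mul_comm, pow_mul, hpdef, ← hc.orderOf, pow_orderOf_eq_one, one_pow]
      have h2 : ∀ i : ℕ, (s ^ i) x = x := fun i => by
        induction i with
        | zero => simp
        | succ i ih => rw [pow_succ, Perm.mul_apply, hsfix x hx, ih]
      rw [h1, h2]; rfl
  -- Here `p ≥ 5` enters: `p` is prime to 3, so `s ^ p` is still a 3-cycle.
  have h3p : (d ^ p).IsThreeCycle := by
    rw [hdp, ← card_support_eq_three_iff, support_pow_coprime, h3.card_support]
    rw [h3.orderOf]
    exact ((Nat.coprime_primes hp Nat.prime_three).2 (by omega))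
  exact Equiv.Perm.alternatingGroup_le_of_isPreprimitive_of_isThreeCycle_mem hG h3p
    (G.pow_mem hdG p)

/-! ### Homogeneity on sets of different sizes (Livingstone–Wagner) -/

theorem eq_of_exchange {α : Type*} [DecidableEq α] {S : Finset α} {t : ℕ} {f : Finset α → ℤ}
    (h : ∀ x ∈ S, ∀ y ∈ S, x ≠ y → ∀ Y ⊆ (S.erase x).erase y, Y.card = t →
      f (insert x Y) = f (insert y Y)) :
    ∀ (n : ℕ) (A B : Finset α), A ⊆ S → B ⊆ S → A.card = t + 1 → B.card = t + 1 →
      (A \ B).card = n → f A = f B := by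
  intro n
  induction n with
  | zero =>
    intro A B _ _ hA hB h0
    rw [Finset.card_eq_zero, Finset.sdiff_eq_empty_iff_subset] at h0
    rw [Finset.eq_of_subset_of_card_le h0 (by omega)]
  | succ n ih =>
    intro A B hAS hBS hA hB hn
    have hBA : (B \ A).card = n + 1 := by
      have h1 := Finset.card_sdiff_add_card_inter A B
      have h2 := Finset.card_sdiff_add_card_inter B A
      rw [Finset.inter_comm] at h2
      omega
    obtain ⟨x, hx⟩ := Finset.card_pos.1 (by omega : 0 < (A \ B).card)
    obtain ⟨y, hy⟩ := Finset.card_pos.1 (by omega : 0 < (B \ A).card)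
    rw [Finset.mem_sdiff] at hx hy
    have hxy : x ≠ y := fun h => hx.2 (h ▸ hy.1)
    have h1 : f A = f (insert y (A.erase x)) := by
      conv_lhs => rw [← Finset.insert_erase hx.1]
      refine h x (hAS hx.1) y (hBS hy.1) hxy _ (fun z hz => ?_) ?_
      · rw [Finset.mem_erase] at hz
        exact Finset.mem_erase.2 ⟨fun h => hy.2 (h ▸ hz.2), Finset.mem_erase.2 ⟨hz.1, hAS hz.2⟩⟩
      · rw [Finset.card_erase_of_mem hx.1, hA]; rfl
    rw [h1]
    refine ih _ _ (fun z hz => ?_) hBS ?_ hB ?_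
    · rcases Finset.mem_insert.1 hz with rfl | hz
      · exact hBS hy.1
      · exact hAS (Finset.mem_of_mem_erase hz)
    · rw [Finset.card_insert_of_notMem (fun h => hy.2 (Finset.mem_of_mem_erase h)),
        Finset.card_erase_of_mem hx.1, hA]
      rfl
    · have : insert y (A.erase x) \ B = (A \ B).erase x := by
        ext z
        simp only [Finset.mem_sdiff, Finset.mem_insert, Finset.mem_erase]
        constructor
        · rintro ⟨rfl | h, h'⟩
          · exact absurd hy.1 h'
          · exact ⟨h.1, h.2, h'⟩
        · rintro ⟨h1, h2, h3⟩
          exact ⟨Or.inr ⟨h1, h2⟩, h3⟩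
      rw [this, Finset.card_erase_of_mem (Finset.mem_sdiff.2 hx), hn]
      rfl

/-- A function on `t`-sets is constant if its sums over the `t`-subsets of every `k`-set agree. -/
theorem eq_const_of_sum_powersetCard {α : Type*} [DecidableEq α] (t : ℕ) :
    ∀ (k : ℕ) (S : Finset α) (f : Finset α → ℤ) (C : ℤ), t ≤ k → t + k ≤ S.card →
      (∀ X ⊆ S, X.card = k → ∑ Y ∈ X.powersetCard t, f Y = C) →
      ∃ c, ∀ Y ⊆ S, Y.card = t → f Y = c := by
  induction t with
  | zero =>
    intro k S f C _ _ _
    exact ⟨f ∅, fun Y _ hY => by rw [Finset.card_eq_zero.1 hY]⟩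
  | succ t ih =>
    intro k S f C htk hS hF
    obtain ⟨k, rfl⟩ : ∃ j, k = j + 1 := ⟨k - 1, by omega⟩
    have hex : ∀ x ∈ S, ∀ y ∈ S, x ≠ y → ∀ Y ⊆ (S.erase x).erase y, Y.card = t →
        f (insert x Y) = f (insert y Y) := by
      intro x hx y hy hxy
      set S' := (S.erase x).erase y with hS'
      have hcard : S'.card + 2 = S.card := by
        rw [hS', Finset.card_erase_of_mem (Finset.mem_erase.2 ⟨hxy.symm, hy⟩),
          Finset.card_erase_of_mem hx]
        omega
      have hsum : ∀ z ∈ S, ∀ X ⊆ S', z ∉ S' → X.card = k →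
          ∑ Y ∈ X.powersetCard (t + 1), f Y + ∑ Y ∈ X.powersetCard t, f (insert z Y) = C := by
        intro z hz X hX hzS hk
        have hzX : z ∉ X := fun h => hzS (hX h)
        rw [← hF (insert z X) (Finset.insert_subset hz
          (hX.trans ((Finset.erase_subset _ _).trans (Finset.erase_subset _ _))))
          (by rw [Finset.card_insert_of_notMem hzX, hk]), Finset.powersetCard_succ_insert hzX,
          Finset.sum_union, Finset.sum_image]
        · intro Y hY Z hZ hYZ
          have h1 : z ∉ Y := fun h => hzX ((Finset.mem_powersetCard.1 hY).1 h)
          have h2 : z ∉ Z := fun h => hzX ((Finset.mem_powersetCard.1 hZ).1 h)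
          rw [← Finset.erase_insert h1, hYZ, Finset.erase_insert h2]
        · rw [Finset.disjoint_left]
          intro Y hY hY'
          obtain ⟨Z, _, rfl⟩ := Finset.mem_image.1 hY'
          exact hzX ((Finset.mem_powersetCard.1 hY).1 (Finset.mem_insert_self _ _))
      -- The sums over `insert x X` and `insert y X` agree, and sets containing neither `x` nor `y`
      -- cancel. Thus the differences satisfy the hypothesis for `t` with total 0. By induction they
      -- are a constant `c`, and C(k,t)·c = 0 gives `c = 0`.
      have hzero : ∀ X ⊆ S', X.card = k →
          ∑ Y ∈ X.powersetCard t, (f (insert x Y) - f (insert y Y)) = 0 := by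
        intro X hX hk
        have h1 := hsum x hx X hX (by simp [hS']) hk
        have h2 := hsum y hy X hX (by simp [hS']) hk
        rw [Finset.sum_sub_distrib]
        linarith
      obtain ⟨c, hc⟩ := ih k S' (fun Y => f (insert x Y) - f (insert y Y)) 0 (by omega) (by omega)
        hzero
      obtain ⟨X, hX, hXk⟩ := Finset.exists_subset_card_eq (by omega : k ≤ S'.card)
      have h0 := hzero X hX hXk
      rw [Finset.sum_congr rfl (g := fun _ => c) (fun Y hY => by
        rw [Finset.mem_powersetCard] at hY
        exact hc Y (hY.1.trans hX) hY.2), Finset.sum_const, Finset.card_powersetCard, hXk] at h0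
      have hpos := Nat.choose_pos (by omega : t ≤ k)
      have hc0 : c = 0 := by
        rw [nsmul_eq_mul] at h0
        rcases mul_eq_zero.1 h0 with h | h
        · exact absurd (by exact_mod_cast h) hpos.ne'
        · exact h
      intro Y hY hYt
      have := hc Y hY hYt
      simp only [hc0] at this
      linarith
    obtain ⟨A, hA, hAt⟩ := Finset.exists_subset_card_eq (by omega : t + 1 ≤ S.card)
    exact ⟨f A, fun Y hY hYt => eq_of_exchange hex _ Y A hY hA hYt hAt rfl⟩

/-- `G` is transitive on the sets of size `k`. -/
def IsSetHomogeneous {α : Type*} (G : Subgroup (Perm α)) (k : ℕ) : Prop :=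
  ∀ s t : Finset α, s.card = k → t.card = k → ∃ g ∈ G, s.map g.toEmbedding = t

/-- Apply `eq_const_of_sum_powersetCard` to the indicator of the orbit of one `t`-set: its sum over
the `t`-subsets of a `k`-set does not depend on the `k`-set, so the indicator is constant. -/
theorem IsSetHomogeneous.of_le {α : Type*} [Fintype α] {G : Subgroup (Perm α)} {t k : ℕ}
    (h : IsSetHomogeneous G k) (htk : t ≤ k) (hn : t + k ≤ Fintype.card α) :
    IsSetHomogeneous G t := by
  classical
  intro A B hA hB
  let f : Finset α → ℤ := fun Y => if ∃ g ∈ G, A.map g.toEmbedding = Y then 1 else 0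
  have hf : ∀ g ∈ G, ∀ Y : Finset α, f (Y.map g.toEmbedding) = f Y := by
    intro g hg Y
    have : (∃ h ∈ G, A.map h.toEmbedding = Y.map g.toEmbedding) ↔
        ∃ h ∈ G, A.map h.toEmbedding = Y := by
      constructor
      · rintro ⟨h, hh, e⟩
        refine ⟨g⁻¹ * h, G.mul_mem (G.inv_mem hg) hh, ?_⟩
        apply Finset.map_injective g.toEmbedding
        rw [← e, Finset.map_map]
        congr 1
        ext x
        simp
      · rintro ⟨h, hh, rfl⟩
        refine ⟨g * h, G.mul_mem hg hh, ?_⟩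
        rw [Finset.map_map]
        rfl
    simp only [f, this]
  obtain ⟨X₀, -, hX₀⟩ := Finset.exists_subset_card_eq
    (by rw [Finset.card_univ]; omega : k ≤ (Finset.univ : Finset α).card)
  obtain ⟨c, hc⟩ := eq_const_of_sum_powersetCard t k Finset.univ f
    (∑ Y ∈ X₀.powersetCard t, f Y) htk (by rw [Finset.card_univ]; exact hn) (by
      intro X _ hX
      obtain ⟨g, hg, rfl⟩ := h X₀ X hX₀ hX
      rw [Finset.powersetCard_map, Finset.sum_map]
      exact Finset.sum_congr rfl fun Y _ => hf g hg Y)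
  have h1 : f A = 1 := if_pos ⟨1, G.one_mem, Finset.map_refl⟩
  have h2 : f B = 1 := by
    rw [hc B (Finset.subset_univ _) hB, ← hc A (Finset.subset_univ _) hA, h1]
  by_contra hcon
  have h3 : f B = 0 := if_neg hcon
  omega

/-! ### A strengthened Bertrand postulate -/

open Real in
-- The exponent has an extra 2, to absorb two additional primes in Erdős's estimate. The logarithm
-- `f` of the quotient of the two sides is concave, nonnegative at 18 and nonpositive at 2048, so it
-- stays nonpositive beyond 2048.
theorem rpow_sqrt_main_inequality {x : ℝ} (x_large : (2048 : ℝ) ≤ x) :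
    x * (2 * x) ^ (√(2 * x) + 2) * 4 ^ (2 * x / 3) ≤ 4 ^ x := by
  let f : ℝ → ℝ := fun x => log x + √(2 * x) * log (2 * x) + 2 * log (2 * x) - log 4 / 3 * x
  have hf' : ∀ x, 0 < x → 0 < x * (2 * x) ^ (√(2 * x) + 2) / 4 ^ (x / 3) := fun x h =>
    div_pos (mul_pos h (rpow_pos_of_pos (mul_pos two_pos h) _)) (rpow_pos_of_pos four_pos _)
  have hf : ∀ x, 0 < x → f x = log (x * (2 * x) ^ (√(2 * x) + 2) / 4 ^ (x / 3)) := by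
    intro x h5
    have h6 := mul_pos (zero_lt_two' ℝ) h5
    have h7 := rpow_pos_of_pos h6 (√(2 * x) + 2)
    rw [log_div (mul_pos h5 h7).ne' (rpow_pos_of_pos four_pos _).ne', log_mul h5.ne' h7.ne',
      log_rpow h6, log_rpow zero_lt_four]
    simp only [f]
    ring
  have h5 : 0 < x := lt_of_lt_of_le (by norm_num1) x_large
  rw [← div_le_one (rpow_pos_of_pos four_pos x), ← div_div_eq_mul_div, ← rpow_sub four_pos, ←
    mul_div 2 x, mul_div_left_comm, ← mul_one_sub, (by norm_num1 : (1 : ℝ) - 2 / 3 = 1 / 3),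
    mul_one_div, ← log_nonpos_iff (hf' x h5).le, ← hf x h5]
  have hlog : ConcaveOn ℝ (Set.Ioi (0.5 : ℝ)) (fun x : ℝ => log (2 * x)) := by
    have h := (strictConcaveOn_log_Ioi.concaveOn.comp_linearMap
      ((2 : ℝ) • (LinearMap.id : ℝ →ₗ[ℝ] ℝ)))
    exact h.subset (fun y hy => by
      have : (0.5 : ℝ) < y := hy
      simp only [Set.mem_preimage, LinearMap.smul_apply, LinearMap.id_coe, id_eq, smul_eq_mul,
        Set.mem_Ioi]
      linarith) (convex_Ioi 0.5)
  have h : ConcaveOn ℝ (Set.Ioi 0.5) f := by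
    apply ConcaveOn.sub
    · apply ConcaveOn.add
      · apply ConcaveOn.add
        · exact strictConcaveOn_log_Ioi.concaveOn.subset
            (Set.Ioi_subset_Ioi (by norm_num)) (convex_Ioi 0.5)
        convert!
          ((strictConcaveOn_sqrt_mul_log_Ioi.concaveOn.comp_linearMap ((2 : ℝ) • LinearMap.id)))
          using 1
        ext x
        simp only [Set.mem_Ioi, Set.mem_preimage, LinearMap.smul_apply,
          LinearMap.id_coe, id_eq, smul_eq_mul]
        rw [← mul_lt_mul_iff_right₀ (two_pos)]
        norm_num1
        rfl
      · exact hlog.smul (by norm_num)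
    apply ConvexOn.smul
    · refine div_nonneg (log_nonneg (by norm_num1)) (by norm_num1)
    · exact convexOn_id (convex_Ioi (0.5 : ℝ))
  suffices ∃ x1 x2, 0.5 < x1 ∧ x1 < x2 ∧ x2 ≤ x ∧ 0 ≤ f x1 ∧ f x2 ≤ 0 by
    obtain ⟨x1, x2, h1, h2, h0, h3, h4⟩ := this
    exact (h.right_le_of_le_left'' h1 ((h1.trans h2).trans_le h0) h2 h0 (h4.trans h3)).trans h4
  -- Both points make √(2x) an integer, 6 and 64.
  refine ⟨18, 2048, by norm_num1, by norm_num1, x_large, ?_, ?_⟩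
  · have : √(2 * 18 : ℝ) = 6 := (sqrt_eq_iff_mul_self_eq_of_pos (by norm_num1)).mpr (by norm_num1)
    rw [hf _ (by norm_num1), log_nonneg_iff (by positivity), this, one_le_div (by norm_num1)]
    norm_num1
  · have h64 : √(2 * 2048) = 64 :=
      (sqrt_eq_iff_mul_self_eq_of_pos (by norm_num1)).mpr (by norm_num1)
    have e1 : log 2048 = 11 * log 2 := by
      rw [show (2048 : ℝ) = 2 ^ (11 : ℕ) by norm_num1, log_pow]; norm_num
    have e2 : log (2 * 2048) = 12 * log 2 := by
      rw [show (2 * 2048 : ℝ) = 2 ^ (12 : ℕ) by norm_num1, log_pow]; norm_num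
    have e3 : log 4 = 2 * log 2 := by
      rw [show (4 : ℝ) = 2 ^ (2 : ℕ) by norm_num1, log_pow]; norm_num
    have hl : 0 < log 2 := log_pos (by norm_num)
    simp only [f]
    rw [h64, e1, e2, e3]
    nlinarith

theorem pow_sqrt_main_inequality {n : ℕ} (n_large : 2048 ≤ n) :
    n * (2 * n) ^ (Nat.sqrt (2 * n) + 2) * 4 ^ (2 * n / 3) ≤ 4 ^ n := by
  rw [← @Nat.cast_le ℝ]
  simp only [Nat.cast_mul, Nat.cast_pow, ← Real.rpow_natCast, Nat.cast_ofNat]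
  refine _root_.trans ?_ (rpow_sqrt_main_inequality (by exact_mod_cast n_large))
  gcongr
  · have n2_pos : 0 < 2 * n := by positivity
    exact mod_cast n2_pos
  · push_cast
    gcongr
    exact_mod_cast Real.nat_sqrt_le_real_sqrt
  · norm_num1
  · exact Nat.cast_div_le.trans (by norm_cast)

open Nat in
-- Erdős's bound, with the primes 2n − 1 and 2n − 3 allowed. The prime-power contribution of each is
-- at most 2n, whence the additional factor (2n)².
theorem centralBinom_le_of_few_primes (n : ℕ) (n_large : 4 < n)
    (no_prime : ∀ p : ℕ, p.Prime → n < p → p ≤ 2 * n → p = 2 * n - 1 ∨ p = 2 * n - 3) :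
    centralBinom n ≤ (2 * n) ^ (sqrt (2 * n) + 2) * 4 ^ (2 * n / 3) := by
  have n_pos : 0 < n := (Nat.zero_le _).trans_lt n_large
  have n2_pos : 1 ≤ 2 * n := mul_pos (zero_lt_two' ℕ) n_pos
  let S := {p ∈ Finset.range (2 * n / 3 + 1) | Nat.Prime p}
  let f x := x ^ n.centralBinom.factorization x
  have hS : ∏ x ∈ S, f x = ∏ x ∈ Finset.range (2 * n / 3 + 1), f x := by
    refine Finset.prod_filter_of_ne fun p _ h => ?_
    contrapose h; dsimp only [f]
    rw [factorization_eq_zero_of_not_prime n.centralBinom h, _root_.pow_zero]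
  have hsmall : centralBinom n = ∏ x ∈ Finset.range (2 * n / 3 + 1) ∪ {2 * n - 1, 2 * n - 3}, f x := by
    refine (Eq.trans ?_ n.prod_pow_factorization_centralBinom).symm
    apply Finset.prod_subset
    · intro x hx
      simp only [Finset.mem_union, Finset.mem_range, Finset.mem_insert, Finset.mem_singleton] at hx ⊢
      omega
    intro x hx h2x
    simp only [Finset.mem_union, Finset.mem_range, Finset.mem_insert, Finset.mem_singleton] at hx h2x
    dsimp only [f]
    by_cases hp : x.Prime
    · have hxn : x ≤ n := by
        by_contra hc
        have := no_prime x hp (by omega) (by omega)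
        omega
      rw [factorization_centralBinom_of_two_mul_self_lt_three_mul (by omega) hxn (by omega),
        Nat.pow_zero]
    · rw [factorization_eq_zero_of_not_prime n.centralBinom hp, Nat.pow_zero]
  have hf : ∀ p, f p ≤ 2 * n := fun p => pow_factorization_choose_le (mul_pos two_pos n_pos)
  have hdis : Disjoint (Finset.range (2 * n / 3 + 1)) ({2 * n - 1, 2 * n - 3} : Finset ℕ) := by
    rw [Finset.disjoint_left]
    intro x hx hx'
    simp only [Finset.mem_range, Finset.mem_insert, Finset.mem_singleton] at hx hx'
    omega
  rw [hsmall, Finset.prod_union hdis, Finset.prod_pair (by omega), ← hS, ←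
    Finset.prod_filter_mul_prod_filter_not S (· ≤ sqrt (2 * n)), pow_add, sq]
  have h1 : ∏ x ∈ S with x ≤ sqrt (2 * n), f x ≤ (2 * n) ^ sqrt (2 * n) := by
    refine (Finset.prod_le_prod' fun p _ => hf p).trans ?_
    have : (Finset.Icc 1 (sqrt (2 * n))).card = sqrt (2 * n) := by rw [card_Icc, Nat.add_sub_cancel]
    rw [Finset.prod_const]
    refine pow_right_mono₀ n2_pos ((Finset.card_le_card fun x hx => ?_).trans this.le)
    obtain ⟨h1, h2⟩ := Finset.mem_filter.1 hx
    exact Finset.mem_Icc.mpr ⟨(Finset.mem_filter.1 h1).2.one_lt.le, h2⟩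
  have h2 : ∏ x ∈ S with ¬ x ≤ sqrt (2 * n), f x ≤ 4 ^ (2 * n / 3) := by
    refine le_trans ?_ (primorial_le_four_pow (2 * n / 3))
    refine (Finset.prod_le_prod' fun p hp => (?_ : f p ≤ p)).trans ?_
    · obtain ⟨h1, h2⟩ := Finset.mem_filter.1 hp
      refine (pow_right_mono₀ (Finset.mem_filter.1 h1).2.one_lt.le ?_).trans (pow_one p).le
      exact Nat.factorization_choose_le_one (sqrt_lt'.mp <| not_le.1 h2)
    refine Finset.prod_le_prod_of_subset_of_one_le' (Finset.filter_subset _ _) ?_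
    exact fun p hp _ => (Finset.mem_filter.1 hp).2.one_lt.le
  calc _ ≤ ((2 * n) ^ sqrt (2 * n) * 4 ^ (2 * n / 3)) * (2 * n * (2 * n)) :=
        mul_le_mul' (mul_le_mul' h1 h2) (mul_le_mul' (hf _) (hf _))
    _ = _ := by ring

theorem exists_prime_lt_and_le_of_list {n : ℕ} (q : ℕ) {p : ℕ} (hp : p.Prime)
    (covering : p + 4 ≤ 2 * q) (H : n < q → ∃ p : ℕ, p.Prime ∧ n < p ∧ p + 4 ≤ 2 * n)
    (hn : n < p) : ∃ p : ℕ, p.Prime ∧ n < p ∧ p + 4 ≤ 2 * n := by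
  by_cases h : n < q
  · exact H h
  · exact ⟨p, hp, hn, by omega⟩

/-- A strengthening of Bertrand's postulate. -/
theorem exists_prime_lt_and_add_four_le (n : ℕ) (hn : 8 ≤ n) :
    ∃ p : ℕ, p.Prime ∧ n < p ∧ p + 4 ≤ 2 * n := by
  rcases lt_or_ge n 2048 with h | h
  -- 2053 is a prime just above 2048, the first of a descending chain in which each prime `p`
  -- satisfies p + 4 ≤ 2q for the next prime `q`.
  · replace h : n < 2053 := by omega
    revert h
    refine exists_prime_lt_and_le_of_list 1031 (by norm_num1) (by norm_num1) ?_
    refine exists_prime_lt_and_le_of_list 521 (by norm_num1) (by norm_num1) ?_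
    refine exists_prime_lt_and_le_of_list 263 (by norm_num1) (by norm_num1) ?_
    refine exists_prime_lt_and_le_of_list 137 (by norm_num1) (by norm_num1) ?_
    refine exists_prime_lt_and_le_of_list 73 (by norm_num1) (by norm_num1) ?_
    refine exists_prime_lt_and_le_of_list 41 (by norm_num1) (by norm_num1) ?_
    refine exists_prime_lt_and_le_of_list 23 (by norm_num1) (by norm_num1) ?_
    refine exists_prime_lt_and_le_of_list 17 (by norm_num1) (by norm_num1) ?_
    refine exists_prime_lt_and_le_of_list 11 (by norm_num1) (by norm_num1) ?_
    exact fun h => ⟨11, by norm_num1, h, by omega⟩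
  · have h1 : 4 ^ n < n * n.centralBinom := Nat.four_pow_lt_mul_centralBinom n (by omega)
    contrapose! h1
    -- A counterexample to the claim has only primes above 2n − 4 in (n, 2n]. They are odd, so they
    -- are 2n − 3 or 2n − 1.
    have h2 := centralBinom_le_of_few_primes n (by omega) (fun p hp h3 h4 => by
      have h5 := h1 p hp h3
      rcases hp.eq_two_or_odd with h6 | h6 <;> omega)
    calc n * n.centralBinom ≤ n * ((2 * n) ^ (Nat.sqrt (2 * n) + 2) * 4 ^ (2 * n / 3)) :=
          Nat.mul_le_mul_left _ h2
      _ ≤ 4 ^ n := by rw [← mul_assoc]; exact pow_sqrt_main_inequality h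

/-! ### Balanced colourings and orbit counting -/

theorem ncard_mul_card_inf_stabilizer {Γ X : Type*} [Group Γ] [Finite Γ] [MulAction Γ X] (L : Subgroup Γ)
    (x : X) {O : Set X} (hO : ∀ y, y ∈ O ↔ ∃ l ∈ L, l • x = y) :
    O.ncard * Nat.card ↥(L ⊓ MulAction.stabilizer Γ x) = Nat.card L := by
  classical
  have hO' : O = MulAction.orbit L x := by
    ext y
    rw [hO]
    constructor
    · rintro ⟨l, hl, rfl⟩
      exact ⟨⟨l, hl⟩, rfl⟩
    · rintro ⟨l, rfl⟩
      exact ⟨l, l.2, rfl⟩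
  have h1 : Nat.card ↥(L ⊓ MulAction.stabilizer Γ x) = Nat.card (MulAction.stabilizer L x) := by
    refine Nat.card_congr ⟨fun g => ⟨⟨g, g.2.1⟩, g.2.2⟩, fun g => ⟨g, g.1.2, g.2⟩, fun _ => rfl,
      fun _ => rfl⟩
  rw [h1, hO', ← Nat.card_coe_set_eq]
  have := Fintype.ofFinite L
  have : Finite (MulAction.orbit L x) := Set.finite_range _
  have := Fintype.ofFinite (MulAction.orbit L x)
  have := Fintype.ofFinite (MulAction.stabilizer L x)
  have h := MulAction.card_orbit_mul_card_stabilizer_eq_card_group L x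
  simpa only [← Nat.card_eq_fintype_card] using h

variable {Ω : Type*} [Fintype Ω]

/-- A colouring with all colour classes of size `k`. -/
def IsBalanced {m : ℕ} (k : ℕ) (f : Ω → Fin m) : Prop :=
  ∀ i, (Finset.univ.filter (fun x => f x = i)).card = k

theorem IsBalanced.comp_perm {m k : ℕ} {f : Ω → Fin m} (hf : IsBalanced k f) (π : Perm (Fin m))
    (g : Perm Ω) : IsBalanced k (fun x => π (f (g x))) := by
  intro i
  rw [← hf (π.symm i)]
  refine Finset.card_bij (fun x _ => g x) ?_ ?_ ?_
  · intro x hx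
    simp only [Finset.mem_filter, Finset.mem_univ, true_and] at hx ⊢
    rw [← hx, Equiv.symm_apply_apply]
  · intro x _ y _ h
    exact g.injective h
  · intro y hy
    simp only [Finset.mem_filter, Finset.mem_univ, true_and] at hy
    refine ⟨g.symm y, ?_, by simp⟩
    simp [hy]

/-- Any colouring with classes of size `k` is carried to any other one by an element of `G`, up to
renaming the colours. -/
def IsBalancedHomogeneous (G : Subgroup (Perm Ω)) (m k : ℕ) : Prop :=
  ∀ f f' : Ω → Fin m, IsBalanced k f → IsBalanced k f' →
    ∃ g ∈ G, ∃ π : Perm (Fin m), ∀ x, f' (g x) = π (f x)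

/-- Any colouring with classes of size `k` is carried to any other one by an element of `G`. -/
def IsBalancedTransitive (G : Subgroup (Perm Ω)) (m k : ℕ) : Prop :=
  ∀ f f' : Ω → Fin m, IsBalanced k f → IsBalanced k f' → ∃ g ∈ G, ∀ x, f' (g x) = f x

theorem isOrderedPartition_fibers {lam : List ℕ} {k : ℕ} (hk : ∀ a ∈ lam, a = k)
    {f : Ω → Fin lam.length} (hf : IsBalanced k f) :
    IsOrderedPartition lam (fun i => Finset.univ.filter (fun x => f x = i)) where
  disjoint i j hij := by
    rw [Finset.disjoint_left]
    intro x hx hy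
    simp only [Finset.mem_filter, Finset.mem_univ, true_and] at hx hy
    exact hij (hx.symm.trans hy)
  cover x := ⟨f x, by simp⟩
  card_eq i := by rw [hf i, hk _ (List.get_mem _ _)]

/-- Equality of the sets of parts sends each colour class onto one colour class. Positivity of `k`
makes the resulting map of colours surjective, hence a permutation. -/
theorem IsPartitionHomogeneous.isBalancedHomogeneous {lam : List ℕ} {k : ℕ} (hk0 : 0 < k)
    (hk : ∀ a ∈ lam, a = k) {G : Subgroup (Perm Ω)} (hG : IsPartitionHomogeneous G lam) :
    IsBalancedHomogeneous G lam.length k := by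
  intro f f' hf hf'
  obtain ⟨g, hg, hr⟩ := hG _ _ (isOrderedPartition_fibers hk hf) (isOrderedPartition_fibers hk hf')
  refine ⟨g, hg, ?_⟩
  have h1 : ∀ i, ∃ j, ∀ x, f x = i → f' (g x) = j := by
    intro i
    have h2 : (Finset.univ.filter (fun x => f x = i)).map g.toEmbedding ∈
        Set.range (fun i => Finset.univ.filter (fun x => f' x = i)) := hr ▸ ⟨i, rfl⟩
    obtain ⟨j, hj⟩ := h2
    refine ⟨j, fun x hx => ?_⟩
    have h3 : g x ∈ (Finset.univ.filter (fun x => f x = i)).map g.toEmbedding :=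
      Finset.mem_map_of_mem _ (by simpa using hx)
    rw [← hj] at h3
    simpa using h3
  choose π hπ using h1
  have hsurj : Function.Surjective π := by
    intro j
    obtain ⟨y, hy⟩ := Finset.card_pos.1 ((hf' j).symm ▸ hk0)
    simp only [Finset.mem_filter, Finset.mem_univ, true_and] at hy
    refine ⟨f (g.symm y), ?_⟩
    rw [← hy, ← hπ _ _ rfl]
    simp
  exact ⟨Equiv.ofBijective π ⟨Finite.injective_iff_surjective.2 hsurj, hsurj⟩,
    fun x => hπ _ _ rfl⟩

theorem IsBalancedTransitive.isPartitionTransitive {lam : List ℕ} {k : ℕ}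
    (hk : ∀ a ∈ lam, a = k) {G : Subgroup (Perm Ω)} (hG : IsBalancedTransitive G lam.length k) :
    IsPartitionTransitive G lam := by
  have key : ∀ A : Fin lam.length → Finset Ω, IsOrderedPartition lam A →
      ∃ f : Ω → Fin lam.length, IsBalanced k f ∧ ∀ x i, x ∈ A i ↔ f x = i := by
    intro A hA
    choose f hf using hA.cover
    have hfi : ∀ x i, x ∈ A i ↔ f x = i := by
      intro x i
      constructor
      · intro hx
        by_contra hne
        exact Finset.disjoint_left.1 (hA.disjoint _ _ hne) (hf x) hx
      · rintro rfl
        exact hf x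
    refine ⟨f, fun i => ?_, hfi⟩
    rw [← hk _ (List.get_mem lam i), ← hA.card_eq i]
    congr 1
    ext x
    simp [hfi]
  intro A B hA hB
  obtain ⟨f, hf, hfA⟩ := key A hA
  obtain ⟨f', hf', hfB⟩ := key B hB
  obtain ⟨g, hg, hgf⟩ := hG f f' hf hf'
  refine ⟨g, hg, fun i => ?_⟩
  ext y
  obtain ⟨x, rfl⟩ := g.surjective y
  simp [hfA, hfB, hgf]

theorem exists_isBalanced {m k : ℕ} (h : Fintype.card Ω = m * k) :
    ∃ f : Ω → Fin m, IsBalanced k f := by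
  have e : Ω ≃ Fin m × Fin k := Fintype.equivOfCardEq (by simp [h])
  refine ⟨fun x => (e x).1, fun i => ?_⟩
  rw [Finset.card_bij (t := (Finset.univ : Finset (Fin k))) (fun x _ => (e x).2)]
  · simp
  · simp
  · intro x hx y hy h
    simp only [Finset.mem_filter, Finset.mem_univ, true_and] at hx hy
    exact e.injective (Prod.ext (hx.trans hy.symm) h)
  · intro j _
    exact ⟨e.symm (i, j), by simp, by simp⟩

theorem exists_perm_of_isBalanced {m k : ℕ} {f f' : Ω → Fin m} (hf : IsBalanced k f)
    (hf' : IsBalanced k f') : ∃ g : Perm Ω, ∀ x, f' (g x) = f x := by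
  have h : ∀ i, Nonempty ({x // f x = i} ≃ {x // f' x = i}) := fun i => by
    refine ⟨Fintype.equivOfCardEq ?_⟩
    rw [Fintype.card_subtype, Fintype.card_subtype, hf i, hf' i]
  let e := fun i => (h i).some
  exact ⟨((Equiv.sigmaFiberEquiv f).symm.trans (Equiv.sigmaCongrRight e)).trans
    (Equiv.sigmaFiberEquiv f'), fun x => (e (f x) ⟨x, rfl⟩).2⟩

/-- With colours permuted as well, homogeneity becomes transitivity of G × Sym(m), so that orbits
and stabilisers can be counted. -/
instance colouringAction (m k : ℕ) :
    MulAction (Perm Ω × Perm (Fin m)) {f : Ω → Fin m // IsBalanced k f} where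
  smul q f := ⟨fun x => q.2 (f.1 (q.1⁻¹ x)), f.2.comp_perm q.2 q.1⁻¹⟩
  one_smul f := rfl
  mul_smul q r f := Subtype.ext (funext fun x => by
    change (q.2 * r.2) (f.1 ((q.1 * r.1)⁻¹ x)) = q.2 (r.2 (f.1 (r.1⁻¹ (q.1⁻¹ x))))
    rw [mul_inv_rev]; rfl)

theorem colouring_smul_eq_iff {m k : ℕ} (q : Perm Ω × Perm (Fin m))
    (f f' : {f : Ω → Fin m // IsBalanced k f}) :
    q • f = f' ↔ ∀ x, f'.1 (q.1 x) = q.2 (f.1 x) := by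
  rw [Subtype.ext_iff, funext_iff]
  change (∀ x, q.2 (f.1 (q.1⁻¹ x)) = f'.1 x) ↔ _
  constructor
  · intro h x
    rw [← h]; simp
  · intro h x
    have := h (q.1⁻¹ x)
    rw [← this]; simp

/-- The number N of balanced colourings is counted twice. Transitivity of G × Sym(m) gives N·|T| =
|G|·m!, and transitivity of Sym(Ω) gives N·(k!)^m = n!. -/
theorem factorial_mul_card_stabilizer {m k : ℕ} {G : Subgroup (Perm Ω)}
    (hG : IsBalancedHomogeneous G m k) {f : Ω → Fin m} (hf : IsBalanced k f) :
    ∃ T : Subgroup (Perm Ω × Perm (Fin m)), (∀ q, q ∈ T ↔ q.1 ∈ G ∧ ∀ x, f (q.1 x) = q.2 (f x)) ∧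
      (Fintype.card Ω).factorial * Nat.card T =
        Nat.card G * m.factorial * (k.factorial) ^ m := by
  classical
  let F : {f : Ω → Fin m // IsBalanced k f} := ⟨f, hf⟩
  refine ⟨(G.prod ⊤) ⊓ MulAction.stabilizer _ F, fun q => ?_, ?_⟩
  · rw [Subgroup.mem_inf, Subgroup.mem_prod, MulAction.mem_stabilizer_iff, colouring_smul_eq_iff]
    simp [F]
  have h1 := ncard_mul_card_inf_stabilizer (G.prod (⊤ : Subgroup (Perm (Fin m)))) F (O := Set.univ)
    (fun f' => by
      simp only [Set.mem_univ, true_iff]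
      obtain ⟨g, hg, π, h⟩ := hG f f'.1 hf f'.2
      exact ⟨(g, π), ⟨hg, trivial⟩, (colouring_smul_eq_iff _ _ _).2 h⟩)
  have h2 := ncard_mul_card_inf_stabilizer
    ((⊤ : Subgroup (Perm Ω)).prod (⊥ : Subgroup (Perm (Fin m)))) F (O := Set.univ)
    (fun f' => by
      simp only [Set.mem_univ, true_iff]
      obtain ⟨g, h⟩ := exists_perm_of_isBalanced hf f'.2
      exact ⟨(g, 1), ⟨trivial, rfl⟩, (colouring_smul_eq_iff _ _ _).2 h⟩)
  have h3 : Nat.card ↥((⊤ : Subgroup (Perm Ω)).prod (⊥ : Subgroup (Perm (Fin m))) ⊓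
      MulAction.stabilizer _ F) = k.factorial ^ m := by
    have h4 := DomMulAct.stabilizer_card f
    rw [Finset.prod_congr rfl (g := fun _ => k.factorial) (fun i _ => by
      rw [Fintype.card_subtype, hf i]), Finset.prod_const, Finset.card_univ,
      Fintype.card_fin] at h4
    rw [← h4, ← Nat.card_eq_fintype_card]
    refine Nat.card_congr ⟨fun q => ⟨q.1.1, ?_⟩, fun g => ⟨(g.1, 1), ⟨trivial, rfl⟩,
      (colouring_smul_eq_iff _ _ _).2 fun x => congrFun g.2 x⟩, fun q => ?_, fun g => rfl⟩
    · have h5 := (colouring_smul_eq_iff _ _ _).1 q.2.2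
      have h6 : q.1.2 = 1 := q.2.1.2
      ext x
      have := h5 x
      rw [h6] at this
      exact congrArg Fin.val this
    · have h6 : q.1.2 = 1 := q.2.1.2
      exact Subtype.ext (Prod.ext rfl h6.symm)
  rw [h3] at h2
  rw [Nat.card_congr (Subgroup.prodEquiv _ _).toEquiv, Nat.card_prod] at h1 h2
  rw [Subgroup.card_top, Nat.card_perm, Nat.card_fin] at h1
  rw [Subgroup.card_top, Subgroup.card_bot, Nat.card_perm, Nat.card_eq_fintype_card (α := Ω), mul_one] at h2
  rw [← h2, ← h1]
  ring

/-- Such a prime divides n! but neither m! nor k!. -/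
theorem prime_dvd_card {m k p : ℕ} (hp : p.Prime) (hm : m < p) (hk : k < p)
    (hn : Fintype.card Ω = m * k) (hpn : p ≤ m * k) {G : Subgroup (Perm Ω)}
    (hG : IsBalancedHomogeneous G m k) : p ∣ Nat.card G := by
  obtain ⟨f, hf⟩ := exists_isBalanced hn
  obtain ⟨T, -, hT⟩ := factorial_mul_card_stabilizer hG hf
  have h1 : p ∣ Nat.card G * m.factorial * (k.factorial) ^ m := by
    rw [← hT, hn]
    exact Dvd.dvd.mul_right ((hp.dvd_factorial).2 hpn) _
  rcases (hp.dvd_mul).1 h1 with h | h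
  · rcases (hp.dvd_mul).1 h with h | h
    · exact h
    · exact absurd ((hp.dvd_factorial).1 h) (by omega)
  · exact absurd ((hp.dvd_factorial).1 (hp.dvd_of_dvd_pow h)) (by omega)

/-- An odd permutation becomes even after composition with a swap inside a colour class, which has
at least two points. -/
theorem IsBalancedTransitive.of_alternatingGroup_le [DecidableEq Ω] {m k : ℕ} (hm : 0 < m) (hk : 2 ≤ k)
    {G : Subgroup (Perm Ω)} (hG : alternatingGroup Ω ≤ G) : IsBalancedTransitive G m k := by
  intro f f' hf hf'
  obtain ⟨g, hg⟩ := exists_perm_of_isBalanced hf hf'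
  by_cases h : sign g = 1
  · exact ⟨g, hG h, hg⟩
  · obtain ⟨x, hx, y, hy, hxy⟩ := Finset.one_lt_card.1 (lt_of_lt_of_eq hk (hf ⟨0, hm⟩).symm)
    simp only [Finset.mem_filter, Finset.mem_univ, true_and] at hx hy
    refine ⟨g * swap x y, hG ?_, fun z => ?_⟩
    · rw [mem_alternatingGroup, Perm.sign_mul, sign_swap hxy]
      rcases Int.units_eq_one_or (sign g) with h' | h'
      · exact absurd h' h
      · rw [h']; rfl
    · rw [Perm.mul_apply, hg]
      by_cases hzx : z = x
      · rw [hzx, swap_apply_left, hx, hy]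
      by_cases hzy : z = y
      · rw [hzy, swap_apply_right, hx, hy]
      rw [swap_apply_of_ne_of_ne hzx hzy]

theorem IsBalancedTransitive.of_isSetHomogeneous {k : ℕ} {G : Subgroup (Perm Ω)}
    (hG : IsSetHomogeneous G k) : IsBalancedTransitive G 2 k := by
  intro f f' hf hf'
  obtain ⟨g, hg, h⟩ := hG _ _ (hf 0) (hf' 0)
  refine ⟨g, hg, fun x => ?_⟩
  have h1 : f x = 0 ↔ f' (g x) = 0 := by
    have h2 : g x ∈ (Finset.univ.filter (fun x => f x = 0)).map g.toEmbedding ↔ f x = 0 := by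
      simp
    rw [← h2, h]
    simp
  generalize f x = a at *
  generalize f' (g x) = b at *
  revert h1
  revert a b
  decide

/-! ### The four-point identity and orbits on pairs -/

/-- `G` is transitive on unordered pairs of distinct points. -/
def IsPairHomogeneous {α : Type*} (G : Subgroup (Perm α)) : Prop :=
  ∀ x y u v : α, x ≠ y → u ≠ v → ∃ g ∈ G, (g x = u ∧ g y = v) ∨ (g x = v ∧ g y = u)

theorem exists_isBalanced_with {Ω : Type*} [Fintype Ω] {m k : ℕ} (h : Fintype.card Ω = m * k)
    (hk : 2 ≤ k) {i j : Fin m} (hij : i ≠ j) {x y a b : Ω} (hxy : x ≠ y) (hxa : x ≠ a) (hxb : x ≠ b)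
    (hya : y ≠ a) (hyb : y ≠ b) (hab : a ≠ b) :
    ∃ f : Ω → Fin m, IsBalanced k f ∧ f x = i ∧ f a = i ∧ f y = j ∧ f b = j := by
  obtain ⟨f, hf⟩ := exists_isBalanced h
  obtain ⟨p, hp, q, hq, hpq⟩ := Finset.one_lt_card.1 (lt_of_lt_of_eq hk (hf i).symm)
  obtain ⟨r, hr, s, hs, hrs⟩ := Finset.one_lt_card.1 (lt_of_lt_of_eq hk (hf j).symm)
  simp only [Finset.mem_filter, Finset.mem_univ, true_and] at hp hq hr hs
  have hne : ∀ {u v}, f u = i → f v = j → u ≠ v := fun hu hv h => hij (by rw [← hu, ← hv, h])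
  obtain ⟨σ, hσ⟩ := Equiv.Perm.exists_extending_pair ![x, a, y, b] ![p, q, r, s]
    (by
      intro c d hcd
      fin_cases c <;> fin_cases d <;> simp_all [eq_comm])
    (by
      have h1 := hne hp hr
      have h2 := hne hp hs
      have h3 := hne hq hr
      have h4 := hne hq hs
      intro c d hcd
      fin_cases c <;> fin_cases d <;> simp_all)
  have h0 : σ x = p := hσ 0
  have h1 : σ a = q := hσ 1
  have h2 : σ y = r := hσ 2
  have h3 : σ b = s := hσ 3
  exact ⟨fun z => f (σ z), hf.comp_perm 1 σ, by simp [h0, hp], by simp [h1, hq], by simp [h2, hr],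
    by simp [h3, hs]⟩

/-- The energy `E f`, the sum of φ over monochromatic pairs, is constant by homogeneity. Choosing
`x`, `a` of one colour and `y`, `b` of another, its alternating sum over the colourings obtained
from 1, (x y), (a b) and (x y)(a b) is a multiple of the mixed difference of φ. -/
theorem four_point_identity {Ω : Type*} [Fintype Ω] {m k : ℕ} (hn : Fintype.card Ω = m * k)
    (hm : 2 ≤ m) (hk : 2 ≤ k) {G : Subgroup (Perm Ω)} (hG : IsBalancedHomogeneous G m k)
    {φ : Ω → Ω → ℤ} (hsymm : ∀ u v, φ u v = φ v u) (hφ : ∀ g ∈ G, ∀ u v, φ (g u) (g v) = φ u v)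
    {x y a b : Ω} (hxy : x ≠ y) (hxa : x ≠ a) (hxb : x ≠ b) (hya : y ≠ a) (hyb : y ≠ b)
    (hab : a ≠ b) : φ x a + φ y b = φ x b + φ y a := by
  classical
  let i : Fin m := ⟨0, by omega⟩
  let j : Fin m := ⟨1, by omega⟩
  have hij : i ≠ j := by simp [i, j]
  obtain ⟨f, hf, hfx, hfa, hfy, hfb⟩ := exists_isBalanced_with hn hk hij hxy hxa hxb hya hyb hab
  let E : (Ω → Fin m) → ℤ := fun f => ∑ u, ∑ v, (if f u = f v then 1 else 0) * φ u v
  have hE : ∀ f f' : Ω → Fin m, IsBalanced k f → IsBalanced k f' → E f = E f' := by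
    intro f f' hf hf'
    obtain ⟨g, hg, π, hgf⟩ := hG f f' hf hf'
    simp only [E]
    rw [← Equiv.sum_comp g (fun u => ∑ v, (if f' u = f' v then 1 else 0) * φ u v)]
    refine Finset.sum_congr rfl fun u _ => ?_
    rw [← Equiv.sum_comp g (fun v => (if f' (g u) = f' v then 1 else 0) * φ (g u) v)]
    refine Finset.sum_congr rfl fun v _ => ?_
    rw [hφ g hg, hgf, hgf]
    simp
  let χ : Ω → ℤ := fun u => (if u = x then 1 else 0) - (if u = y then 1 else 0)
  let ψ : Ω → ℤ := fun u => (if u = a then 1 else 0) - (if u = b then 1 else 0)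
  -- Pairs not joining {x, y} to {a, b} cancel. Each joining pair is monochromatic in exactly two of
  -- the four colourings, and with equal signs; this is the factor 2.
  have hW : ∀ u v, (if f u = f v then (1 : ℤ) else 0)
      - (if f (swap x y u) = f (swap x y v) then 1 else 0)
      - (if f (swap a b u) = f (swap a b v) then 1 else 0)
      + (if f (swap x y (swap a b u)) = f (swap x y (swap a b v)) then 1 else 0)
      = 2 * (χ u * ψ v + ψ u * χ v) := by
    have table : ∀ u : Ω, ∃ p q r s : Fin m, f u = p ∧ f (swap x y u) = q ∧ f (swap a b u) = r ∧
        f (swap x y (swap a b u)) = s ∧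
        ((p = i ∧ q = j ∧ r = i ∧ s = j ∧ χ u = 1 ∧ ψ u = 0) ∨
         (p = j ∧ q = i ∧ r = j ∧ s = i ∧ χ u = -1 ∧ ψ u = 0) ∨
         (p = i ∧ q = i ∧ r = j ∧ s = j ∧ χ u = 0 ∧ ψ u = 1) ∨
         (p = j ∧ q = j ∧ r = i ∧ s = i ∧ χ u = 0 ∧ ψ u = -1) ∨
         (q = p ∧ r = p ∧ s = p ∧ χ u = 0 ∧ ψ u = 0)) := by
      intro u
      refine ⟨_, _, _, _, rfl, rfl, rfl, rfl, ?_⟩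
      by_cases h1 : u = x
      · subst h1
        left
        simp [χ, ψ, swap_apply_of_ne_of_ne hxa hxb, hfx, hfy, hxy, hxa, hxb]
      by_cases h2 : u = y
      · subst h2
        right; left
        simp [χ, ψ, swap_apply_of_ne_of_ne hya hyb, hfx, hfy, hxy.symm, hya, hyb]
      by_cases h3 : u = a
      · subst h3
        right; right; left
        simp [χ, ψ, swap_apply_of_ne_of_ne hxa.symm hya.symm,
          swap_apply_of_ne_of_ne hxb.symm hyb.symm, hfa, hfb, h1, h2, hab]
      by_cases h4 : u = b
      · subst h4
        right; right; right; left
        simp [χ, ψ, swap_apply_of_ne_of_ne hxa.symm hya.symm,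
          swap_apply_of_ne_of_ne hxb.symm hyb.symm, hfa, hfb, h1, h2, h3]
      · right; right; right; right
        simp [χ, ψ, swap_apply_of_ne_of_ne h1 h2, swap_apply_of_ne_of_ne h3 h4, h1, h2, h3, h4]
    intro u v
    obtain ⟨p, q, r, s, hp, hq, hr, hs, h⟩ := table u
    obtain ⟨p', q', r', s', hp', hq', hr', hs', h'⟩ := table v
    rw [hp, hq, hr, hs, hp', hq', hr', hs']
    clear hp hq hr hs hp' hq' hr' hs'
    rcases h with ⟨rfl, rfl, rfl, rfl, h1, h2⟩ | ⟨rfl, rfl, rfl, rfl, h1, h2⟩ |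
      ⟨rfl, rfl, rfl, rfl, h1, h2⟩ | ⟨rfl, rfl, rfl, rfl, h1, h2⟩ | ⟨rfl, rfl, rfl, h1, h2⟩ <;>
    rcases h' with ⟨rfl, rfl, rfl, rfl, h1', h2'⟩ | ⟨rfl, rfl, rfl, rfl, h1', h2'⟩ |
      ⟨rfl, rfl, rfl, rfl, h1', h2'⟩ | ⟨rfl, rfl, rfl, rfl, h1', h2'⟩ | ⟨rfl, rfl, rfl, h1', h2'⟩ <;>
    simp [h1, h2, h1', h2', hij, hij.symm]
  have e1 : E f = E (fun z => f (swap x y z)) := hE _ _ hf (hf.comp_perm 1 (swap x y))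
  have e2 : E f = E (fun z => f (swap a b z)) := hE _ _ hf (hf.comp_perm 1 (swap a b))
  have e3 : E f = E (fun z => f (swap x y (swap a b z))) :=
    hE _ _ hf (hf.comp_perm 1 (swap x y * swap a b))
  have hsum : ∑ u, ∑ v, (2 * (χ u * ψ v + ψ u * χ v)) * φ u v = 0 := by
    have : ∑ u, ∑ v, (2 * (χ u * ψ v + ψ u * χ v)) * φ u v =
        E f - E (fun z => f (swap x y z))
          - E (fun z => f (swap a b z))
          + E (fun z => f (swap x y (swap a b z))) := by
      simp only [E, ← Finset.sum_sub_distrib, ← Finset.sum_add_distrib]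
      refine Finset.sum_congr rfl fun u _ => Finset.sum_congr rfl fun v _ => ?_
      rw [← hW]
      ring
    rw [this]
    linarith
  have hψ : ∀ u, ∑ v, ψ v * φ u v = φ u a - φ u b := fun u => by
    simp [ψ, sub_mul, Finset.sum_sub_distrib]
  have hχ : ∀ u, ∑ v, χ v * φ u v = φ u x - φ u y := fun u => by
    simp [χ, sub_mul, Finset.sum_sub_distrib]
  have hsum2 : ∑ u, ∑ v, (2 * (χ u * ψ v + ψ u * χ v)) * φ u v =
      2 * ∑ u, (χ u * (φ u a - φ u b) + ψ u * (φ u x - φ u y)) := by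
    rw [Finset.mul_sum]
    refine Finset.sum_congr rfl fun u _ => ?_
    rw [← hψ, ← hχ, Finset.mul_sum, Finset.mul_sum, ← Finset.sum_add_distrib, Finset.mul_sum]
    exact Finset.sum_congr rfl fun v _ => by ring
  rw [hsum2] at hsum
  have h5 : ∑ u, (χ u * (φ u a - φ u b) + ψ u * (φ u x - φ u y)) =
      (φ x a - φ x b) - (φ y a - φ y b) + ((φ a x - φ a y) - (φ b x - φ b y)) := by
    simp [χ, ψ, sub_mul, Finset.sum_sub_distrib, Finset.sum_add_distrib]
  rw [h5, hsymm a x, hsymm a y, hsymm b x, hsymm b y] at hsum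
  linarith

/-- A graph satisfying the four-point identity is empty, complete, a star or the complement of a
star. -/
theorem star_of_four_point {Ω : Type*} {R : Ω → Ω → Prop} (hsymm : ∀ u v, R u v → R v u)
    (hR : ∀ x y a b : Ω, x ≠ y → x ≠ a → x ≠ b → y ≠ a → y ≠ b → a ≠ b →
      R x a → ¬ R y a → R x b ∧ ¬ R y b)
    (hne : ∃ u v, u ≠ v ∧ R u v) (hne' : ∃ u v, u ≠ v ∧ ¬ R u v) :
    ∃ z, (∀ u v, u ≠ v → (R u v ↔ (u = z ∨ v = z))) ∨
      (∀ u v, u ≠ v → (R u v ↔ ¬ (u = z ∨ v = z))) := by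
  -- Without such a triple, being joined to `a` would not depend on the other endpoint, and one edge
  -- would make the graph complete.
  obtain ⟨x, y, a, hxy, hxa, hya, hRx, hRy⟩ : ∃ x y a : Ω, x ≠ y ∧ x ≠ a ∧ y ≠ a ∧ R x a ∧ ¬ R y a := by
    by_contra hcon
    push Not at hcon
    have h1 : ∀ {x y a : Ω}, x ≠ a → y ≠ a → R x a → R y a := fun {x y a} hx hy h => by
      by_cases hxy : x = y
      · exact hxy ▸ h
      · exact hcon x y a hxy hx hy h
    obtain ⟨u, v, huv, hu⟩ := hne
    obtain ⟨p, q, hpq, hp⟩ := hne'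
    apply hp
    apply hsymm
    by_cases hpv : p = v
    · subst hpv
      exact h1 huv hpq.symm hu
    · exact h1 (Ne.symm hpv) hpq.symm (hsymm _ _ (h1 huv hpv hu))
  have hb : ∀ b, b ≠ x → b ≠ y → R x b ∧ ¬ R y b := by
    intro b hbx hby
    by_cases hba : b = a
    · exact hba ▸ ⟨hRx, hRy⟩
    · exact hR x y a b hxy hxa hbx.symm hya hby.symm (Ne.symm hba) hRx hRy
  -- Every other point is now joined to `x` and not to `y`. If x and y are joined the graph is the
  -- star at `x`; otherwise it is the complement of the star at `y`.
  by_cases hxyR : R x y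
  · have hbb : ∀ b c, b ≠ x → b ≠ y → c ≠ x → c ≠ y → b ≠ c → ¬ R b c :=
      fun b c hbx hby hcx hcy hbc => (hR x b y c hbx.symm hxy hcx.symm hby hbc hcy.symm hxyR
        (fun h => (hb b hbx hby).2 (hsymm _ _ h))).2
    refine ⟨x, Or.inl fun u v huv => ?_⟩
    have hall : ∀ v, v ≠ x → R x v := fun v hv => by
      by_cases hvy : v = y
      · exact hvy ▸ hxyR
      · exact (hb v hv hvy).1
    constructor
    · intro h
      by_contra hcon
      push Not at hcon
      by_cases huy : u = y
      · subst huy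
        exact (hb v hcon.2 huv.symm).2 h
      by_cases hvy : v = y
      · subst hvy
        exact (hb u hcon.1 huv).2 (hsymm _ _ h)
      exact hbb u v hcon.1 huy hcon.2 hvy huv h
    · rintro (rfl | rfl)
      · exact hall v huv.symm
      · exact hsymm _ _ (hall u huv)
  · have hbb : ∀ b c, b ≠ x → b ≠ y → c ≠ x → c ≠ y → b ≠ c → R b c :=
      fun b c hbx hby hcx hcy hbc => (hR b y x c hby hbx hbc hxy.symm hcy.symm hcx.symm
        (hsymm _ _ (hb b hbx hby).1) (fun h => hxyR (hsymm _ _ h))).1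
    refine ⟨y, Or.inr fun u v huv => ?_⟩
    have hall : ∀ v, v ≠ y → ¬ R y v := fun v hv => by
      by_cases hvx : v = x
      · exact hvx ▸ fun h => hxyR (hsymm _ _ h)
      · exact (hb v hvx hv).2
    constructor
    · rintro h (rfl | rfl)
      · exact hall v huv.symm h
      · exact hall u huv (hsymm _ _ h)
    · intro hcon
      push Not at hcon
      by_cases hux : u = x
      · subst hux
        exact (hb v huv.symm hcon.2).1
      by_cases hvx : v = x
      · subst hvx
        exact hsymm _ _ (hb u huv hcon.1).1
      exact hbb u v hux hcon.1 hvx hcon.2 huv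

theorem four_point_of_orbit {Ω : Type*} [Fintype Ω] {m k : ℕ} (hn : Fintype.card Ω = m * k)
    (hm : 2 ≤ m) (hk : 2 ≤ k) {G : Subgroup (Perm Ω)} (hG : IsBalancedHomogeneous G m k)
    {R : Ω → Ω → Prop} (hsymm : ∀ u v, R u v → R v u)
    (hRG : ∀ g ∈ G, ∀ u v, R u v → R (g u) (g v))
    (hne : ∃ u v, u ≠ v ∧ R u v) (hne' : ∃ u v, u ≠ v ∧ ¬ R u v) :
    ∃ z, (∀ u v, u ≠ v → (R u v ↔ (u = z ∨ v = z))) ∨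
      (∀ u v, u ≠ v → (R u v ↔ ¬ (u = z ∨ v = z))) := by
  classical
  refine star_of_four_point hsymm ?_ hne hne'
  intro x y a b hxy hxa hxb hya hyb hab h1 h2
  have h := four_point_identity hn hm hk hG (φ := fun u v => if R u v then 1 else 0)
    (fun u v => by simp only [show R u v ↔ R v u from ⟨hsymm _ _, hsymm _ _⟩])
    (fun g hg u v => by
      have : R (g u) (g v) ↔ R u v := by
        refine ⟨fun h => ?_, hRG g hg u v⟩
        simpa using hRG g⁻¹ (G.inv_mem hg) _ _ h
      simp only [this]) hxy hxa hxb hya hyb hab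
  simp only [if_pos h1, if_neg h2] at h
  constructor
  · by_contra h3
    rw [if_neg h3] at h
    split_ifs at h <;> omega
  · intro h3
    rw [if_pos h3] at h
    split_ifs at h <;> omega

/-- A partition-homogeneous group is transitive on pairs of points, or it fixes a point and is
transitive on the remaining points and on pairs of them. -/
theorem pairHomogeneous_or_fixes {Ω : Type*} [Fintype Ω] {m k : ℕ} (hn : Fintype.card Ω = m * k)
    (hm : 2 ≤ m) (hk : 2 ≤ k) {G : Subgroup (Perm Ω)} (hG : IsBalancedHomogeneous G m k) :
    IsPairHomogeneous G ∨ ∃ z, (∀ g ∈ G, g z = z) ∧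
      (∀ x u, x ≠ z → u ≠ z → ∃ g ∈ G, g x = u) ∧
      (∀ x y u v, x ≠ y → u ≠ v → x ≠ z → y ≠ z → u ≠ z → v ≠ z →
        ∃ g ∈ G, (g x = u ∧ g y = v) ∨ (g x = v ∧ g y = u)) := by
  classical
  by_cases hP : IsPairHomogeneous G
  · exact Or.inl hP
  right
  let R : Ω → Ω → Ω → Ω → Prop := fun p q u v => ∃ g ∈ G, (g p = u ∧ g q = v) ∨ (g p = v ∧ g q = u)
  have hRsymm : ∀ p q u v, R p q u v → R p q v u := by
    rintro p q u v ⟨g, hg, h⟩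
    exact ⟨g, hg, h.symm⟩
  have hRG : ∀ p q, ∀ g ∈ G, ∀ u v, R p q u v → R p q (g u) (g v) := by
    rintro p q g hg u v ⟨h, hh, h'⟩
    refine ⟨g * h, G.mul_mem hg hh, ?_⟩
    rcases h' with ⟨rfl, rfl⟩ | ⟨rfl, rfl⟩
    · exact Or.inl ⟨rfl, rfl⟩
    · exact Or.inr ⟨rfl, rfl⟩
  have hRself : ∀ p q, R p q p q := fun p q => ⟨1, G.one_mem, Or.inl ⟨rfl, rfl⟩⟩
  have hRtrans : ∀ p q u v s t, R p q u v → R p q s t → R u v s t := by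
    rintro p q u v s t ⟨g, hg, h⟩ ⟨h', hh', h''⟩
    refine ⟨h' * g⁻¹, G.mul_mem hh' (G.inv_mem hg), ?_⟩
    rcases h with ⟨rfl, rfl⟩ | ⟨rfl, rfl⟩ <;> rcases h'' with ⟨rfl, rfl⟩ | ⟨rfl, rfl⟩ <;> simp
  have hcard : 4 ≤ Fintype.card Ω := by rw [hn]; nlinarith
  have havoid : ∀ z w : Ω, ∃ u v, u ≠ v ∧ u ≠ z ∧ u ≠ w ∧ v ≠ z ∧ v ≠ w := by
    intro z w
    have h2 : 1 < (({z, w} : Finset Ω)ᶜ).card := by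
      rw [Finset.card_compl]
      have := Finset.card_le_two (a := z) (b := w)
      omega
    obtain ⟨u, hu, v, hv, huv⟩ := Finset.one_lt_card.1 h2
    simp only [Finset.mem_compl, Finset.mem_insert, Finset.mem_singleton, not_or] at hu hv
    exact ⟨u, v, huv, hu.1, hu.2, hv.1, hv.2⟩
  unfold IsPairHomogeneous at hP
  push Not at hP
  obtain ⟨p, q, s, t, hpq, hst, hno⟩ := hP
  have hno' : ¬ R p q s t := fun ⟨g, hg, h⟩ => by
    rcases h with h | h
    · exact (hno g hg).1 h.1 h.2
    · exact (hno g hg).2 h.1 h.2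
  -- every orbit on pairs is a star or the complement of a star
  have hshape : ∀ u v, u ≠ v → ∃ z, (∀ a b, a ≠ b → (R u v a b ↔ (a = z ∨ b = z))) ∨
      (∀ a b, a ≠ b → (R u v a b ↔ ¬ (a = z ∨ b = z))) := by
    intro u v huv
    refine four_point_of_orbit hn hm hk hG (hRsymm u v) (hRG u v) ⟨u, v, huv, hRself u v⟩ ?_
    by_contra hcon
    push Not at hcon
    exact hno' (hRtrans u v _ _ _ _ (hcon p q hpq) (hcon s t hst))
  obtain ⟨z, hz⟩ := hshape p q hpq
  -- The orbit of {p, q} is a G-invariant graph with centre `z`. A moved centre would be a second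
  -- centre, which is impossible with at least four points.
  have hfix : ∀ g ∈ G, g z = z := by
    intro g hg
    by_contra hgz
    obtain ⟨u, v, huv, huz, hugz, hvz, hvgz⟩ := havoid z (g z)
    rcases hz with hz | hz
    · have h1 := (hz z (g⁻¹ u) (fun h => hugz (by rw [h]; simp))).2 (Or.inl rfl)
      have h2 := hRG p q g hg _ _ h1
      rw [← Perm.mul_apply, mul_inv_cancel, Perm.one_apply] at h2
      have h3 := (hz _ _ hugz.symm).1 h2
      rcases h3 with h3 | h3
      · exact hgz h3
      · exact huz h3
    · have h1 := (hz z u huz.symm).not.2 (by simp)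
      have hne : g z ≠ g u := fun h => huz (g.injective h).symm
      have h0 : u ≠ z := huz
      have h2 : ¬ R p q (g z) (g u) := fun h => h1 (by simpa using hRG p q g⁻¹ (G.inv_mem hg) _ _ h)
      have h3 := (hz _ _ hne).not.1 h2
      rw [not_not] at h3
      rcases h3 with h3 | h3
      · exact hgz h3
      · have h4 := (hz z v hvz.symm).not.2 (by simp)
        have hne4 : g z ≠ g v := fun h => hvz (g.injective h).symm
        have h5 : ¬ R p q (g z) (g v) := fun h =>
          h4 (by simpa using hRG p q g⁻¹ (G.inv_mem hg) _ _ h)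
        have h6 := (hz _ _ hne4).not.1 h5
        rw [not_not] at h6
        rcases h6 with h6 | h6
        · exact hgz h6
        · exact huv (g.injective (h3.trans h6.symm))
  have hinvol : ∀ u v, u ≠ v → ∀ a b, a ≠ b → ((u = z ∨ v = z) ↔ (a = z ∨ b = z)) → R u v a b := by
    intro u v huv
    obtain ⟨w, hw⟩ := hshape u v huv
    have hself := hRself u v
    have hmem : ∀ a b, R u v a b → ((u = z ∨ v = z) ↔ (a = z ∨ b = z)) := by
      rintro a b ⟨g, hg, h⟩
      have h1 : ∀ x, g x = z ↔ x = z := fun x =>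
        ⟨fun h => g.injective (h.trans (hfix g hg).symm), fun h => h ▸ hfix g hg⟩
      rcases h with ⟨rfl, rfl⟩ | ⟨rfl, rfl⟩
      · simp [h1]
      · simp [h1, or_comm]
    -- As `z` is fixed, an orbit consists only of pairs through `z` or only of pairs avoiding it. A
    -- star, or its complement, centred elsewhere contains both kinds. So these two kinds are
    -- exactly the orbits.
    have hwz : w = z := by
      by_contra hwz
      obtain ⟨c, d, hcd, hcz, hcw, hdz, hdw⟩ := havoid z w
      rcases hw with hw | hw
      · have h1 := hmem _ _ ((hw w z hwz).2 (Or.inl rfl))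
        have h2 := hmem _ _ ((hw w c hcw.symm).2 (Or.inl rfl))
        simp [hcz, hwz] at h1 h2
        tauto
      · have h1 := hmem _ _ ((hw z c hcz.symm).2 (by simp [hcw, Ne.symm hwz]))
        have h2 := hmem _ _ ((hw c d hcd).2 (by simp [hcw, hdw]))
        simp [hcz, hdz] at h1 h2
        tauto
    subst hwz
    intro a b hab hiff
    rcases hw with hw | hw
    · exact (hw a b hab).2 (hiff.1 ((hw u v huv).1 hself))
    · exact (hw a b hab).2 (hiff.not.1 ((hw u v huv).1 hself))
  refine ⟨z, hfix, fun x u hx hu => ?_, fun x y u v hxy huv hx hy hu hv => ?_⟩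
  · obtain ⟨g, hg, h⟩ := hinvol z x hx.symm z u hu.symm (by simp)
    rcases h with h | h
    · exact ⟨g, hg, h.2⟩
    · exact absurd (h.1.symm.trans (hfix g hg)) hu
  · exact hinvol x y hxy u v huv (by simp [hx, hy, hu, hv])

open Pointwise in
theorem IsPairHomogeneous.isPreprimitive {α : Type*} [Fintype α] {G : Subgroup (Perm α)}
    (hG : IsPairHomogeneous G) (h3 : 3 ≤ Fintype.card α) : MulAction.IsPreprimitive G α := by
  classical
  have hthird : ∀ x y : α, ∃ z, z ≠ x ∧ z ≠ y := by
    intro x y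
    have h2 : 0 < (({x, y} : Finset α)ᶜ).card := by
      rw [Finset.card_compl]
      have := Finset.card_le_two (a := x) (b := y)
      omega
    obtain ⟨z, hz⟩ := Finset.card_pos.1 h2
    simp only [Finset.mem_compl, Finset.mem_insert, Finset.mem_singleton, not_or] at hz
    exact ⟨z, hz.1, hz.2⟩
  have htrans : MulAction.IsPretransitive G α := by
    refine ⟨fun x y => ?_⟩
    by_cases hxy : x = y
    · exact ⟨1, by rw [one_smul, hxy]⟩
    -- an element moving `{x, z}` onto `{z, y}` or its variants sends `x` to `y`
    obtain ⟨z, hzx, hzy⟩ := hthird x y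
    obtain ⟨g, hg, h⟩ := hG x z y z hzx.symm hzy.symm
    rcases h with h | h
    · exact ⟨⟨g, hg⟩, h.1⟩
    · refine ⟨⟨g, hg⟩ * ⟨g, hg⟩, ?_⟩
      change g (g x) = y
      rw [h.1, h.2]
  refine MulAction.IsPreprimitive.mk fun {B} hB => ?_
  by_cases hs : B.Subsingleton
  · exact Or.inl hs
  right
  rw [Set.not_subsingleton_iff] at hs
  obtain ⟨x, hx, y, hy, hxy⟩ := hs
  rw [Set.eq_univ_iff_forall]
  intro w
  by_cases hwx : w = x
  · exact hwx ▸ hx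
  obtain ⟨g, hg, h⟩ := hG x y x w hxy (Ne.symm hwx)
  have hgB : (⟨g, hg⟩ : G) • B = B := by
    -- The chosen point of the block is the one that `g` sends to `x`.
    refine hB.smul_eq_of_mem (a := if g x = x then x else y) ?_ ?_
    · split_ifs <;> assumption
    · rcases h with h | h
      · rw [if_pos h.1]
        change g x ∈ B
        rw [h.1]; exact hx
      · rw [if_neg (by rw [h.1]; exact hwx)]
        change g y ∈ B
        rw [h.2]; exact hx
  rw [← hgB]
  rcases h with h | h
  · exact ⟨y, hy, h.2⟩
  · exact ⟨x, hx, h.1⟩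

/-! ### Removing a fixed point -/

section Restrict

variable {Ω : Type*} [DecidableEq Ω]

/-- The permutations of the points other than `z` which, extended by `z ↦ z`, belong to `G`. -/
def restrictAway (G : Subgroup (Perm Ω)) (z : Ω) : Subgroup (Perm {x : Ω // x ≠ z}) :=
  G.comap ofSubtype

theorem ofSubtype_apply_ne {z : Ω} (h : Perm {x : Ω // x ≠ z}) (x : {x : Ω // x ≠ z}) :
    ofSubtype h (x : Ω) = h x := ofSubtype_apply_coe h x

theorem exists_restrict {G : Subgroup (Perm Ω)} {z : Ω} (hz : ∀ g ∈ G, g z = z) {g : Perm Ω}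
    (hg : g ∈ G) : ∃ h ∈ restrictAway G z, ofSubtype h = g := by
  have h1 : ∀ x, g x ≠ z ↔ x ≠ z := fun x => not_congr
    ⟨fun h => g.injective (h.trans (hz g hg).symm), fun h => h ▸ hz g hg⟩
  have h2 : ofSubtype (g.subtypePerm h1) = g :=
    ofSubtype_subtypePerm (p := fun x => x ≠ z) h1 (fun x hx (h : x = z) => hx (by rw [h, hz g hg]))
  exact ⟨g.subtypePerm h1, by rw [restrictAway, Subgroup.mem_comap, h2]; exact hg, h2⟩

theorem card_restrictAway {G : Subgroup (Perm Ω)} {z : Ω} (hz : ∀ g ∈ G, g z = z) :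
    Nat.card (restrictAway G z) = Nat.card G := by
  refine Nat.card_congr (Equiv.ofBijective (fun h => ⟨ofSubtype h.1, h.2⟩) ⟨?_, ?_⟩)
  · intro h h' e
    exact Subtype.ext (ofSubtype_injective (congrArg Subtype.val e))
  · rintro ⟨g, hg⟩
    obtain ⟨h, hh, rfl⟩ := exists_restrict hz hg
    exact ⟨⟨h, hh⟩, rfl⟩

theorem FixesAndActsAs.of_restrictAway {Δ : Type*} {G : Subgroup (Perm Ω)} {z : Ω}
    (hz : ∀ g ∈ G, g z = z) {K : Subgroup (Perm Δ)}
    (h : IsPermIsomorphic (restrictAway G z) K) : FixesAndActsAs G z K := by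
  obtain ⟨e, he⟩ := h
  refine ⟨hz, e, fun k => ?_⟩
  rw [he]
  constructor
  · rintro ⟨h, hh, hk⟩
    exact ⟨ofSubtype h, hh, fun d => by rw [ofSubtype_apply_ne, hk]⟩
  · rintro ⟨g, hg, hk⟩
    obtain ⟨h, hh, rfl⟩ := exists_restrict hz hg
    exact ⟨h, hh, fun d => Subtype.ext (by rw [← hk, ofSubtype_apply_ne])⟩

theorem IsPermIsomorphic.refl {α : Type*} (H : Subgroup (Perm α)) : IsPermIsomorphic H H :=
  ⟨Equiv.refl α, fun h => ⟨fun hh => ⟨h, hh, fun _ => rfl⟩, fun ⟨g, hg, hgh⟩ => by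
    have : g = h := Equiv.ext hgh
    exact this ▸ hg⟩⟩

theorem eq_alternatingGroup_or_eq_top {α : Type*} [Fintype α] [DecidableEq α]
    {H : Subgroup (Perm α)} (h : alternatingGroup α ≤ H) : H = alternatingGroup α ∨ H = ⊤ := by
  by_cases hle : H ≤ alternatingGroup α
  · exact Or.inl (le_antisymm hle h)
  right
  obtain ⟨g, hg, hg'⟩ := SetLike.not_le_iff_exists.1 hle
  rw [eq_top_iff]
  intro x _
  by_cases hx : x ∈ alternatingGroup α
  · exact h hx
  rw [mem_alternatingGroup] at hx hg'
  have h1 : x * g⁻¹ ∈ alternatingGroup α := by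
    rw [mem_alternatingGroup, Perm.sign_mul, Perm.sign_inv, (Int.units_eq_one_or _).resolve_left hx,
      (Int.units_eq_one_or _).resolve_left hg']
    rfl
  simpa using H.mul_mem (h h1) hg

theorem fixesAndActsAs_of_alternatingGroup_le [Fintype Ω] {G : Subgroup (Perm Ω)} {z : Ω}
    (hz : ∀ g ∈ G, g z = z) (h : alternatingGroup {x : Ω // x ≠ z} ≤ restrictAway G z) :
    FixesAndActsAs G z (alternatingGroup {x : Ω // x ≠ z}) ∨
      FixesAndActsAs G z (⊤ : Subgroup (Perm {x : Ω // x ≠ z})) := by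
  rcases eq_alternatingGroup_or_eq_top h with h1 | h1
  · exact Or.inl (FixesAndActsAs.of_restrictAway hz (h1 ▸ IsPermIsomorphic.refl _))
  · exact Or.inr (FixesAndActsAs.of_restrictAway hz (h1 ▸ IsPermIsomorphic.refl _))

theorem isPairHomogeneous_restrictAway {G : Subgroup (Perm Ω)} {z : Ω} (hz : ∀ g ∈ G, g z = z)
    (h : ∀ x y u v, x ≠ y → u ≠ v → x ≠ z → y ≠ z → u ≠ z → v ≠ z →
        ∃ g ∈ G, (g x = u ∧ g y = v) ∨ (g x = v ∧ g y = u)) :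
    IsPairHomogeneous (restrictAway G z) := by
  intro x y u v hxy huv
  obtain ⟨g, hg, h'⟩ := h x y u v (fun e => hxy (Subtype.ext e)) (fun e => huv (Subtype.ext e))
    x.2 y.2 u.2 v.2
  obtain ⟨k, hk, rfl⟩ := exists_restrict hz hg
  refine ⟨k, hk, ?_⟩
  simp only [ofSubtype_apply_ne] at h'
  simpa only [Subtype.ext_iff] using h'

theorem exists_isThreeCycle_restrictAway [Fintype Ω] {G : Subgroup (Perm Ω)} {z : Ω}
    (hz : ∀ g ∈ G, g z = z) (h : ∃ g ∈ G, g.IsThreeCycle) :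
    ∃ g ∈ restrictAway G z, g.IsThreeCycle := by
  obtain ⟨g, hg, h3⟩ := h
  obtain ⟨k, hk, rfl⟩ := exists_restrict hz hg
  refine ⟨k, hk, ?_⟩
  rw [IsThreeCycle] at h3 ⊢
  rw [← h3, cycleType_ofSubtype]

/-- A set of size `k` avoiding `z`, enlarged by `z`, is one half of a balanced 2-colouring. Since
`z` is fixed, the half containing it goes to the half containing it, so the colours cannot be
exchanged. -/
theorem isSetHomogeneous_restrictAway [Fintype Ω] {k : ℕ} (hn : Fintype.card Ω = 2 * (k + 1))
    {G : Subgroup (Perm Ω)} (hG : IsBalancedHomogeneous G 2 (k + 1)) {z : Ω}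
    (hz : ∀ g ∈ G, g z = z) : IsSetHomogeneous (restrictAway G z) k := by
  have key : ∀ s : Finset {x : Ω // x ≠ z}, s.card = k → ∃ f : Ω → Fin 2, IsBalanced (k + 1) f ∧
      f z = 0 ∧ ∀ x : {x : Ω // x ≠ z}, f x = 0 ↔ x ∈ s := by
    intro s hs
    let S : Finset Ω := insert z (s.map (Function.Embedding.subtype _))
    have hzS : z ∉ s.map (Function.Embedding.subtype _) := by simp
    have hS : S.card = k + 1 := by
      rw [Finset.card_insert_of_notMem hzS, Finset.card_map, hs]
    refine ⟨fun x => if x ∈ S then 0 else 1, ?_, by simp [S], fun x => ?_⟩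
    · intro i
      have h0 : (Finset.univ.filter (fun x => (if x ∈ S then (0 : Fin 2) else 1) = 0)) = S := by
        ext x; simp
      have h1 : (Finset.univ.filter (fun x => (if x ∈ S then (0 : Fin 2) else 1) = 1)) = Sᶜ := by
        ext x; simp
      fin_cases i
      · exact (congrArg Finset.card h0).trans hS
      · refine (congrArg Finset.card h1).trans ?_
        rw [Finset.card_compl, hS, hn]; omega
    · have : (x : Ω) ∈ S ↔ x ∈ s := by
        simp [S, x.2]
      simp [this]
  intro s t hs ht
  obtain ⟨f, hf, hfz, hfs⟩ := key s hs
  obtain ⟨f', hf', hfz', hft⟩ := key t ht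
  obtain ⟨g, hg, π, hgf⟩ := hG f f' hf hf'
  have hπ : π 0 = 0 := by rw [← hfz, ← hgf, hz g hg, hfz', hfz]
  obtain ⟨h, hh, rfl⟩ := exists_restrict hz hg
  refine ⟨h, hh, ?_⟩
  ext y
  obtain ⟨x, rfl⟩ := h.surjective y
  rw [← hft, ← ofSubtype_apply_ne, hgf]
  have : π (f x) = 0 ↔ f x = 0 := by
    conv_lhs => rw [← hπ]
    exact π.injective.eq_iff
  rw [this, hfs]
  simp

end Restrict

/-! ### Primes dividing the order, and groups on pairings -/

section Degree

variable {α : Type*} [Fintype α] [DecidableEq α]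

omit [DecidableEq α] in
theorem exists_isCycle_of_dvd_card {p : ℕ} (hp : p.Prime) {H : Subgroup (Perm α)}
    (hdvd : p ∣ Nat.card H) (hlt : Fintype.card α < 2 * p) :
    ∃ c ∈ H, c.IsCycle ∧ orderOf c = p := by
  have : Fact p.Prime := ⟨hp⟩
  obtain ⟨c, hc⟩ := exists_prime_orderOf_dvd_card' p hdvd
  have hc' : orderOf (c : Perm α) = p := by rw [← hc]; simp
  exact ⟨c, c.2, isCycle_of_prime_order' (hc' ▸ hp) (hc'.symm ▸ hlt), hc'⟩

theorem alternatingGroup_le_of_prime_dvd_card {p : ℕ} (hp : p.Prime) (hp5 : 5 ≤ p)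
    {H : Subgroup (Perm α)} (hH : MulAction.IsPreprimitive H α) (hdvd : p ∣ Nat.card H)
    (hlt : Fintype.card α < 2 * p) (hle : p + 3 ≤ Fintype.card α) : alternatingGroup α ≤ H := by
  obtain ⟨c, hcH, hc, ho⟩ := exists_isCycle_of_dvd_card hp hdvd hlt
  rw [hc.orderOf] at ho
  exact alternatingGroup_le_of_isCycle hH hcH hc (ho ▸ hp) (by omega) (by omega)

theorem isThreeCycle_of_isCycle {c : Perm α} (hc : c.IsCycle) (h : orderOf c = 3) :
    c.IsThreeCycle := by
  rw [← card_support_eq_three_iff, ← hc.orderOf, h]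

theorem alternatingGroup_le_of_exists_isThreeCycle {H : Subgroup (Perm α)}
    (hH : MulAction.IsPreprimitive H α) (h : ∃ g ∈ H, g.IsThreeCycle) : alternatingGroup α ≤ H := by
  obtain ⟨g, hg, h3⟩ := h
  exact Equiv.Perm.alternatingGroup_le_of_isPreprimitive_of_isThreeCycle_mem hH h3 hg

/-- A group homogeneous on pairings of `6` or `8` points contains a 3-cycle, as otherwise an
element of order `3` fixes a pairing and the order of the group is divisible by `9`. -/
theorem exists_isThreeCycle_of_pairings {m r : ℕ} {G : Subgroup (Perm α)}
    (hG : IsBalancedHomogeneous G m 2) (hα : Fintype.card α = m * 2) (hα9 : Fintype.card α < 9)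
    (hr : (m * 2).factorial = m.factorial * 2 ^ m * (3 * r))
    (d₀ : Perm (Fin (m * 2))) (f₀ : Fin (m * 2) → Fin m) (π : Perm (Fin m)) (hd₀ : d₀ ^ 3 = 1)
    (hd₀s : d₀.support.card = 6) (hf₀ : IsBalanced 2 f₀) (hdf : ∀ x, f₀ (d₀ x) = π (f₀ x)) :
    ∃ g ∈ G, g.IsThreeCycle := by
  obtain ⟨f₁, hf₁⟩ := exists_isBalanced hα
  have hcard : ∀ {f : α → Fin m} (T : Subgroup (Perm α × Perm (Fin m))),
      (Fintype.card α).factorial * Nat.card T = Nat.card G * m.factorial * (Nat.factorial 2) ^ m →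
      3 * r * Nat.card T = Nat.card G := by
    intro f T hT
    have hpos : 0 < m.factorial * 2 ^ m := by positivity
    apply Nat.eq_of_mul_eq_mul_left hpos
    rw [hα, hr, Nat.factorial_two] at hT
    linarith
  obtain ⟨T₁, -, hT₁⟩ := factorial_mul_card_stabilizer hG hf₁
  have h3 : 3 ∣ Nat.card G := ⟨r * Nat.card T₁, by rw [← hcard (f := f₁) T₁ hT₁, mul_assoc]⟩
  have : Fact (Nat.Prime 3) := ⟨Nat.prime_three⟩
  obtain ⟨d, hd⟩ := exists_prime_orderOf_dvd_card' 3 h3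
  have hd' : orderOf (d : Perm α) = 3 := by rw [← hd]; simp
  obtain ⟨a, ha⟩ := support_card_of_prime_order Nat.prime_three hd'
  have hle : (d : Perm α).support.card ≤ Fintype.card α := Finset.card_le_univ _
  obtain rfl | rfl : a = 0 ∨ a = 1 := by omega
  · exact ⟨d, d.2, card_support_eq_three_iff.1 ha⟩
  have hd₀' : orderOf d₀ = 3 := orderOf_eq_prime hd₀ (by
    rintro rfl
    simp at hd₀s)
  -- `d` has the same cycle type as `d₀`, so the model pairing transports to one that `d` preserves.
  obtain ⟨e, he⟩ := exists_equiv_of_prime_order Nat.prime_three hd' hd₀' (by omega) (by simp [hα])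
  have hf : IsBalanced 2 (fun x => f₀ (e x)) := by
    intro i
    refine Eq.trans ?_ (hf₀ i)
    refine Finset.card_bij (fun x _ => e x) ?_ ?_ ?_
    · intro x hx
      simpa using hx
    · intro x _ y _ h
      exact e.injective h
    · intro y hy
      exact ⟨e.symm y, by simpa using hy, by simp⟩
  obtain ⟨T, hmem, hT⟩ := factorial_mul_card_stabilizer hG hf
  have h3T : 3 ∣ Nat.card T := by
    let t : T := ⟨(d, π), (hmem _).2 ⟨d.2, fun x => by simp [he, hdf]⟩⟩
    have h1 : 3 ∣ orderOf t := by
      rw [← hd', ← Subgroup.orderOf_coe t]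
      exact orderOf_map_dvd (MonoidHom.fst _ _) (t : Perm α × Perm (Fin m))
    exact h1.trans (orderOf_dvd_natCard t)
  -- |G| = 3r·|T|, and the stabiliser `T` of this pairing contributes a second factor 3.
  have h9 : 3 ^ 2 ∣ Nat.card G := by
    obtain ⟨b, hb⟩ := h3T
    exact ⟨r * b, by rw [← hcard (f := fun x => f₀ (e x)) T hT, hb]; ring⟩
  obtain ⟨g, hg, hgc, ho⟩ := exists_isCycle_of_sq_dvd_card Nat.prime_three le_rfl h9 (by omega)
  exact ⟨g, hg, isThreeCycle_of_isCycle hgc ho⟩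

/-- There are 6!/(3!·2³) = 15 = 3·5 pairings. The model element consists of two 3-cycles and
permutes the three pairs cyclically. -/
theorem exists_isThreeCycle_of_three_pairs {G : Subgroup (Perm α)}
    (hG : IsBalancedHomogeneous G 3 2) (hα : Fintype.card α = 6) : ∃ g ∈ G, g.IsThreeCycle :=
  exists_isThreeCycle_of_pairings (r := 5) hG hα (by omega) (by decide)
    (c[0, 2, 4] * c[1, 3, 5] : Perm (Fin 6)) ![0, 1, 2, 0, 1, 2] (c[0, 2, 1] : Perm (Fin 3))
    (by decide) (by decide) (by unfold IsBalanced; decide) (by decide)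

/-- There are 8!/(4!·2⁴) = 105 = 3·35 pairings. The same model element fixes the two points of a
fourth pair. -/
theorem exists_isThreeCycle_of_four_pairs {G : Subgroup (Perm α)}
    (hG : IsBalancedHomogeneous G 4 2) (hα : Fintype.card α = 8) : ∃ g ∈ G, g.IsThreeCycle :=
  exists_isThreeCycle_of_pairings (r := 35) hG hα (by omega) (by decide)
    (c[0, 2, 4] * c[1, 3, 5] : Perm (Fin 8)) ![0, 1, 2, 0, 1, 2, 3, 3] (c[0, 2, 1] : Perm (Fin 4))
    (by decide) (by decide) (by unfold IsBalanced; decide) (by decide)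

end Degree

/-! ### Degree thirteen -/

section Thirteen

variable {α : Type*} [Fintype α] [DecidableEq α]

omit [DecidableEq α] in
open Pointwise in
theorem IsSetHomogeneous.choose_dvd_card {H : Subgroup (Perm α)} {t : ℕ} (hH : IsSetHomogeneous H t)
    (ht : t ≤ Fintype.card α) : (Fintype.card α).choose t ∣ Nat.card H := by
  classical
  obtain ⟨s, -, hs⟩ := Finset.exists_subset_card_eq
    (by rwa [Finset.card_univ] : t ≤ (Finset.univ : Finset α).card)
  have hsmul : ∀ (g : Perm α) (s : Finset α), g • s = s.map g.toEmbedding := fun g s => by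
    rw [Finset.map_eq_image]; rfl
  have h := ncard_mul_card_inf_stabilizer H s
    (O := ((Finset.univ.powersetCard t : Finset (Finset α)) : Set (Finset α))) (fun y => by
      rw [Finset.mem_coe, Finset.mem_powersetCard_univ]
      constructor
      · intro hy
        obtain ⟨g, hg, h⟩ := hH s y hs hy
        exact ⟨g, hg, by rw [hsmul, h]⟩
      · rintro ⟨g, -, rfl⟩
        rw [hsmul, Finset.card_map, hs])
  rw [Set.ncard_coe_finset, Finset.card_powersetCard, Finset.card_univ] at h
  exact Dvd.intro _ h

/-- The exponent is prime to `p`, so the power has the same support as `e`. An element normalising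
⟨e⟩ therefore preserves the fixed points of `e`. -/
theorem support_eq_of_conj_eq_pow {p k : ℕ} (hp : p.Prime) {e g : Perm α} (he : orderOf e = p)
    (hg : g * e * g⁻¹ = e ^ k) : k.Coprime p ∧ ∀ x, e (g x) = g x ↔ e x = x := by
  have hk : k.Coprime p := by
    rw [Nat.coprime_comm, hp.coprime_iff_not_dvd]
    intro h
    rw [← he] at h
    rw [orderOf_dvd_iff_pow_eq_one.1 h, mul_inv_eq_one, mul_eq_left] at hg
    rw [hg, orderOf_one] at he
    exact hp.one_lt.ne he
  refine ⟨hk, fun x => ?_⟩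
  have h1 : (e ^ k).support = e.support := support_pow_coprime (by rw [he]; exact hk)
  have hinv : g⁻¹ (g x) = x := by simp
  have h2 : g x ∈ (e ^ k).support ↔ x ∈ e.support := by
    rw [← hg, mem_support, mem_support, Perm.mul_apply, Perm.mul_apply, hinv]
    exact not_congr g.injective.eq_iff
  rw [h1, mem_support, mem_support] at h2
  exact not_iff_not.1 h2

/-- An element normalising a group of order `5` generated by two disjoint 5-cycles and permuting
the three remaining points cyclically has a power that is a 3-cycle. -/
theorem isThreeCycle_pow_forty {e g : Perm α} {k : ℕ} (he : orderOf e = 5)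
    (hs : e.support.card = 10) (hg : g * e * g⁻¹ = e ^ k) {u v w : α} (huv : u ≠ v) (huw : u ≠ w)
    (hvw : v ≠ w) (hF : ∀ x, e x = x ↔ x = u ∨ x = v ∨ x = w) (hu : g u = v) (hv : g v = w)
    (hw : g w = u) : (g ^ 40).IsThreeCycle := by
  obtain ⟨hk, hgf⟩ := support_eq_of_conj_eq_pow Nat.prime_five he hg
  obtain ⟨q, hq⟩ : ∃ q, q = g ^ 4 := ⟨_, rfl⟩
  -- The automorphism group of a cyclic group of order 5 has order 4, so `g ^ 4` centralises `e`.
  have hcomm : Commute q e := by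
    have h1 : ∀ i : ℕ, g ^ i * e * (g ^ i)⁻¹ = e ^ (k ^ i) := by
      intro i
      induction i with
      | zero => simp
      | succ i ih =>
        calc g ^ (i + 1) * e * (g ^ (i + 1))⁻¹ = g * (g ^ i * e * (g ^ i)⁻¹) * g⁻¹ := by
              rw [pow_succ']; group
          _ = (g * e * g⁻¹) ^ (k ^ i) := by rw [ih, conj_pow]
          _ = e ^ (k ^ (i + 1)) := by rw [hg, ← pow_mul, pow_succ']
    have h2 : e ^ (k ^ 4) = e := by
      have h3 := Nat.ModEq.pow_totient hk
      rw [Nat.totient_prime Nat.prime_five] at h3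
      conv_rhs => rw [← pow_one e]
      rwa [pow_eq_pow_iff_modEq, he]
    have h3 := h1 4
    rw [h2, ← hq] at h3
    exact mul_inv_eq_iff_eq_mul.1 h3
  have hqe : ∀ (n : ℕ) x, q ((e ^ n) x) = (e ^ n) (q x) := fun n x =>
    DFunLike.congr_fun (hcomm.pow_right n).eq x
  have hqf : ∀ x, e x ≠ x → e (q x) ≠ q x := by
    intro x hx h
    apply hx
    apply q.injective
    have := hqe 1 x
    rw [pow_one] at this
    rw [this, h]
  have hlen : ∀ x, e x ≠ x → (e.cycleOf x).support.card = 5 := by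
    intro x hx
    have h1 : (e.cycleOf x).support.card ∣ 5 := by
      rw [← he, ← (isCycle_cycleOf e hx).orderOf]
      exact orderOf_cycleOf_dvd_orderOf e x
    have h2 := (isCycle_cycleOf e hx).two_le_card_support
    exact ((Nat.dvd_prime Nat.prime_five).1 h1).resolve_left (by omega)
  have hsc : ∀ x y, e x ≠ x → e y ≠ y → ¬ e.SameCycle x y →
      Disjoint (e.cycleOf x).support (e.cycleOf y).support := by
    intro x y hx hy hxy
    rw [Finset.disjoint_left]
    intro z hz hz'
    rw [mem_support_cycleOf_iff] at hz hz'
    exact hxy (hz.1.trans hz'.1.symm)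
  have hsub : ∀ x, (e.cycleOf x).support ⊆ e.support := fun x => support_cycleOf_le e x
  -- `q` permutes the cycles of `e`. Ten moved points leave room for only two 5-cycles, so `q ^ 2`
  -- preserves each of them and acts on it as a power of `e`.
  have hq2 : ∀ x, e x ≠ x → e.SameCycle x (q (q x)) := by
    intro x hx
    have hx1 := hqf x hx
    have hx2 := hqf _ hx1
    have step : ∀ y, e.SameCycle y (q y) → ∃ n : ℕ, q y = (e ^ n) y := by
      intro y hy
      obtain ⟨n, hn⟩ := hy.exists_nat_pow_eq
      exact ⟨n, hn.symm⟩
    by_contra hcon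
    have h1 : ¬ e.SameCycle x (q x) := by
      intro h
      obtain ⟨n, hn⟩ := step x h
      apply hcon
      rw [hn, hqe, hn]
      exact ⟨((n + n : ℕ) : ℤ), by rw [zpow_natCast, pow_add, Perm.mul_apply]⟩
    have h2 : ¬ e.SameCycle (q x) (q (q x)) := by
      intro h
      obtain ⟨n, hn⟩ := step _ h
      rw [← hqe] at hn
      apply h1
      rw [q.injective hn]
      exact ⟨(n : ℤ), by rw [zpow_natCast]⟩
    have h3 := Finset.card_le_card (Finset.union_subset (Finset.union_subset (hsub x) (hsub (q x)))
      (hsub (q (q x))))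
    rw [Finset.card_union_of_disjoint, Finset.card_union_of_disjoint (hsc _ _ hx hx1 h1),
      hlen _ hx, hlen _ hx1, hlen _ hx2, hs] at h3
    · omega
    · rw [Finset.disjoint_union_left]
      exact ⟨hsc _ _ hx hx2 hcon, hsc _ _ hx1 hx2 h2⟩
  have hfix : ∀ x, e x ≠ x → (g ^ 40) x = x := by
    intro x hx
    obtain ⟨n, hn⟩ := (hq2 x hx).exists_nat_pow_eq
    have h1 : ∀ i : ℕ, ((q * q) ^ i) x = (e ^ (n * i)) x := by
      intro i
      induction i with
      | zero => simp
      | succ i ih =>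
        rw [pow_succ', Perm.mul_apply, ih, Perm.mul_apply, hqe, hqe, ← hn, ← Perm.mul_apply,
          ← pow_add]
        congr 2
    have h2 : g ^ 40 = (q * q) ^ 5 := by rw [hq, ← pow_add, ← pow_mul]
    rw [h2, h1, mul_comm, pow_mul, ← he, pow_orderOf_eq_one, one_pow]
    rfl
  -- 40 = 3·13 + 1, so `g ^ 40` acts as `g` on points of period dividing 3.
  have hpow : ∀ x, g (g (g x)) = x → (g ^ 40) x = g x := by
    intro x hx
    have h1 : ∀ i : ℕ, (g ^ (3 * i)) x = x := by
      intro i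
      induction i with
      | zero => simp
      | succ i ih =>
        rw [Nat.mul_succ, pow_add, Perm.mul_apply]
        have : (g ^ 3) x = x := by
          rw [pow_succ, pow_two]; exact hx
        rw [this, ih]
    have h2 : (g ^ 40) x = g ((g ^ (3 * 13)) x) := by
      rw [← Perm.mul_apply, ← pow_succ']
    rw [h2, h1]
  rw [← card_support_eq_three_iff, Finset.card_eq_three]
  refine ⟨u, v, w, huv, huw, hvw, ?_⟩
  ext x
  simp only [mem_support, Finset.mem_insert, Finset.mem_singleton]
  constructor
  · intro h
    by_contra hx
    exact h (hfix x (fun h' => hx ((hF x).1 h')))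
  · rintro (rfl | rfl | rfl)
    · rw [hpow _ (by rw [hu, hv, hw]), hu]; exact huv.symm
    · rw [hpow _ (by rw [hv, hw, hu]), hv]; exact hvw.symm
    · rw [hpow _ (by rw [hw, hu, hv]), hw]; exact huw

/-- 4-homogeneity makes C(13,4) = 715, hence 5, divide |H|. A 5-cycle would finish by Jordan's
theorem. Otherwise 25 does not divide |H| and `e`, of order 5, has two 5-cycles and three fixed
points. 6-homogeneity and Sylow's theorem make the normaliser of ⟨e⟩ transitive on these three
points, and an element permuting them cyclically yields a 3-cycle. -/
theorem degree_thirteen {H : Subgroup (Perm α)} (hα : Fintype.card α = 13)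
    (hH : MulAction.IsPreprimitive H α) (h6 : IsSetHomogeneous H 6) :
    alternatingGroup α ≤ H := by
  have : Fact (Nat.Prime 5) := ⟨Nat.prime_five⟩
  have h4 : IsSetHomogeneous H 4 := h6.of_le (by omega) (by omega)
  have h5 : 5 ∣ Nat.card H := by
    refine Dvd.dvd.trans ?_ (h4.choose_dvd_card (by omega))
    rw [hα]; decide
  have hcyc : ∀ c ∈ H, c.IsCycle → orderOf c = 5 → alternatingGroup α ≤ H := by
    intro c hc hcc ho
    rw [hcc.orderOf] at ho
    exact alternatingGroup_le_of_isCycle hH hc hcc (ho ▸ Nat.prime_five) (by omega) (by omega)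
  by_cases h25 : 5 ^ 2 ∣ Nat.card H
  · obtain ⟨c, hc, hcc, ho⟩ := exists_isCycle_of_sq_dvd_card Nat.prime_five (by omega) h25 (by omega)
    exact hcyc c hc hcc ho
  obtain ⟨⟨e, heH⟩, he⟩ := exists_prime_orderOf_dvd_card' 5 h5
  replace he : orderOf e = 5 := by simpa using he
  obtain ⟨a, ha⟩ := support_card_of_prime_order Nat.prime_five he
  have hle : e.support.card ≤ Fintype.card α := Finset.card_le_univ _
  obtain rfl | rfl : a = 0 ∨ a = 1 := by omega
  · exact hcyc e heH (isCycle_of_prime_order (he ▸ Nat.prime_five) (by omega)) he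
  obtain ⟨x, hx⟩ := Finset.card_pos.1 (by omega : 0 < e.support.card)
  rw [mem_support] at hx
  obtain ⟨Y, hY⟩ : ∃ Y, Y = (e.cycleOf x).support := ⟨_, rfl⟩
  have hY5 : Y.card = 5 := by
    have h1 : (e.cycleOf x).support.card ∣ 5 := by
      rw [← he, ← (isCycle_cycleOf e hx).orderOf]
      exact orderOf_cycleOf_dvd_orderOf e x
    have h2 := (isCycle_cycleOf e hx).two_le_card_support
    rw [hY]
    exact ((Nat.dvd_prime Nat.prime_five).1 h1).resolve_left (by omega)
  have hYe : ∀ y, e y ∈ Y ↔ y ∈ Y := by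
    intro y
    rw [hY, mem_support_cycleOf_iff, mem_support_cycleOf_iff, sameCycle_apply_right]
  have hYfix : ∀ y, e y = y → y ∉ Y := by
    intro y hy hyY
    exact mem_support.1 (support_cycleOf_le e x (hY ▸ hyY)) hy
  -- the normaliser of `e` is transitive on the fixed points of `e`
  have hmove : ∀ b c, e b = b → e c = c →
      ∃ g ∈ H, (∃ k : ℕ, g * e * g⁻¹ = e ^ k) ∧ g b = c := by
    intro b c hb hc
    obtain ⟨h, hh, hhX⟩ := h6 (insert b Y) (insert c Y)
      (by rw [Finset.card_insert_of_notMem (hYfix b hb), hY5])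
      (by rw [Finset.card_insert_of_notMem (hYfix c hc), hY5])
    -- The stabiliser of the set Y ∪ {c}. It contains both `e` and the conjugate of `e` by `h`. The
    -- corrected element normalises ⟨e⟩ and sends `b` to a point of Y ∪ {c} fixed by `e`, which can
    -- only be `c`.
    let S : Subgroup (Perm α) :=
      { carrier := {g | ∀ y, g y ∈ insert c Y ↔ y ∈ insert c Y}
        one_mem' := fun _ => Iff.rfl
        mul_mem' := fun {g g'} hg hg' y => by rw [Perm.mul_apply, hg, hg']
        inv_mem' := fun {g} hg y => by
          have : g (g⁻¹ y) = y := by simp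
          rw [← hg, this] }
    have heS : ∀ d, e d = d → ∀ y, e y ∈ insert d Y ↔ y ∈ insert d Y := by
      intro d hd y
      rw [Finset.mem_insert, Finset.mem_insert, hYe]
      have : e y = d ↔ y = d := by
        conv_lhs => rw [← hd]
        exact e.injective.eq_iff
      rw [this]
    have hhy : ∀ y, h y ∈ insert c Y ↔ y ∈ insert b Y := by
      intro y
      rw [← hhX]
      simp
    have heK : e ∈ H ⊓ S := ⟨heH, heS c hc⟩
    have hhK : h * e * h⁻¹ ∈ H ⊓ S := by
      refine ⟨H.mul_mem (H.mul_mem hh heH) (H.inv_mem hh), fun y => ?_⟩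
      have : h (h⁻¹ y) = y := by simp
      rw [Perm.mul_apply, Perm.mul_apply, hhy, heS b hb, ← hhy, this]
    obtain ⟨y, hy, k, hk⟩ := exists_conj_eq_pow heK hhK he
      (by rw [← he]; exact MulEquiv.orderOf_eq (MulAut.conj h) e)
      (fun hd => h25 (hd.trans (Subgroup.card_dvd_of_le inf_le_left)))
    have hgk : (y * h) * e * (y * h)⁻¹ = e ^ k := by rw [← hk]; group
    refine ⟨y * h, H.mul_mem hy.1 hh, ⟨k, hgk⟩, ?_⟩
    have h1 : e ((y * h) b) = (y * h) b :=
      ((support_eq_of_conj_eq_pow Nat.prime_five he hgk).2 b).2 hb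
    have h2 : (y * h) b ∈ insert c Y := by
      rw [Perm.mul_apply]
      exact (hy.2 _).2 ((hhy b).2 (Finset.mem_insert_self _ _))
    exact (Finset.mem_insert.1 h2).resolve_right (hYfix _ h1)
  have hF3 : (e.supportᶜ).card = 3 := by rw [Finset.card_compl]; omega
  obtain ⟨u, v, w, huv, huw, hvw, hF⟩ := Finset.card_eq_three.1 hF3
  replace hF : ∀ x, e x = x ↔ x = u ∨ x = v ∨ x = w := by
    intro x
    have : x ∈ e.supportᶜ ↔ x ∈ ({u, v, w} : Finset α) := by rw [hF]
    simpa using this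
  have hgF : ∀ g : Perm α, (∃ k : ℕ, g * e * g⁻¹ = e ^ k) → ∀ x, (x = u ∨ x = v ∨ x = w) →
      (g x = u ∨ g x = v ∨ g x = w) := by
    rintro g ⟨k, hk⟩ x hx
    exact (hF _).1 (((support_eq_of_conj_eq_pow Nat.prime_five he hk).2 x).2 ((hF _).2 hx))
  have hfinish : ∀ (g : Perm α) (u v w : α), g ∈ H → (∃ k : ℕ, g * e * g⁻¹ = e ^ k) → u ≠ v → u ≠ w →
      v ≠ w → (∀ x, e x = x ↔ x = u ∨ x = v ∨ x = w) → g u = v → g v = w → g w = u →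
      alternatingGroup α ≤ H := by
    rintro g u v w hg ⟨k, hk⟩ huv huw hvw hF hu hv hw
    exact alternatingGroup_le_of_exists_isThreeCycle hH
      ⟨g ^ 40, H.pow_mem hg 40, isThreeCycle_pow_forty he (by omega) hk huv huw hvw hF hu hv hw⟩
  obtain ⟨g₁, hg₁, hk₁, h1⟩ := hmove u v ((hF u).2 (by simp)) ((hF v).2 (by simp))
  obtain ⟨g₂, hg₂, hk₂, h2⟩ := hmove v w ((hF v).2 (by simp)) ((hF w).2 (by simp))
  have inj : ∀ (g : Perm α) {x y z : α}, g x = z → g y = z → x = y := fun g x y z h h' =>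
    g.injective (h.trans h'.symm)
  -- Either `g₁` or `g₂` is a 3-cycle on {u, v, w}, or both are transpositions there and their
  -- product is a 3-cycle.
  rcases hgF g₁ hk₁ v (by simp) with h3 | h3 | h3
  · have h4 : g₁ w = w := by
      rcases hgF g₁ hk₁ w (by simp) with h | h | h
      · exact absurd (inj g₁ h3 h) hvw
      · exact absurd (inj g₁ h1 h) huw
      · exact h
    rcases hgF g₂ hk₂ w (by simp) with h5 | h5 | h5
    · have h6 : g₂ u = v := by
        rcases hgF g₂ hk₂ u (by simp) with h | h | h
        · exact absurd (inj g₂ h h5) huw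
        · exact h
        · exact absurd (inj g₂ h h2) huv
      exact hfinish g₂ u v w hg₂ hk₂ huv huw hvw hF h6 h2 h5
    · have h6 : g₂ u = u := by
        rcases hgF g₂ hk₂ u (by simp) with h | h | h
        · exact h
        · exact absurd (inj g₂ h h5) huw
        · exact absurd (inj g₂ h h2) huv
      obtain ⟨k₁, hk₁⟩ := hk₁
      obtain ⟨k₂, hk₂⟩ := hk₂
      refine hfinish (g₂ * g₁) u w v (H.mul_mem hg₂ hg₁) ⟨k₂ * k₁, ?_⟩ huw huv hvw.symm ?_ ?_ ?_ ?_
      · calc (g₂ * g₁) * e * (g₂ * g₁)⁻¹ = g₂ * (g₁ * e * g₁⁻¹) * g₂⁻¹ := by group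
          _ = e ^ (k₂ * k₁) := by rw [hk₁, ← conj_pow, hk₂, pow_mul]
      · intro x; rw [hF]; tauto
      · rw [Perm.mul_apply, h1, h2]
      · rw [Perm.mul_apply, h4, h5]
      · rw [Perm.mul_apply, h3, h6]
    · exact absurd (inj g₂ h2 h5) hvw
  · exact absurd (inj g₁ h1 h3) huv
  · have h4 : g₁ w = u := by
      rcases hgF g₁ hk₁ w (by simp) with h | h | h
      · exact h
      · exact absurd (inj g₁ h1 h) huw
      · exact absurd (inj g₁ h3 h) hvw
    exact hfinish g₁ u v w hg₁ hk₁ huv huw hvw hF h1 h3 h4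

end Thirteen

/-! ### Relabelling of points -/

section Relabel

variable {α β : Type*}

/-- The permutation group on `β` corresponding to `H` under the relabelling `e`. -/
def relabel (H : Subgroup (Perm α)) (e : β ≃ α) : Subgroup (Perm β) :=
  H.comap e.permCongrHom.toMonoidHom

theorem mem_relabel {H : Subgroup (Perm α)} {e : β ≃ α} {g : Perm β} :
    g ∈ relabel H e ↔ e.permCongr g ∈ H := Iff.rfl

theorem exists_mem_relabel {H : Subgroup (Perm α)} (e : β ≃ α) {h : Perm α} (hh : h ∈ H) :
    ∃ g ∈ relabel H e, e.permCongr g = h := by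
  have : e.permCongr (e.permCongr.symm h) = h := e.permCongr.apply_symm_apply h
  exact ⟨e.permCongr.symm h, by rwa [mem_relabel, this], this⟩

theorem card_relabel (H : Subgroup (Perm α)) (e : β ≃ α) :
    Nat.card (relabel H e) = Nat.card H :=
  Nat.card_congr (Equiv.subtypeEquiv e.permCongr fun _ => Iff.rfl)

theorem IsPermIsomorphic.of_relabel {Δ : Type*} {H : Subgroup (Perm α)} {e : β ≃ α}
    {K : Subgroup (Perm Δ)} (h : IsPermIsomorphic (relabel H e) K) : IsPermIsomorphic H K := by
  obtain ⟨f, hf⟩ := h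
  refine ⟨f.trans e, fun k => ?_⟩
  rw [hf]
  constructor
  · rintro ⟨g, hg, h⟩
    exact ⟨e.permCongr g, hg, fun d => by simp [h]⟩
  · rintro ⟨g, hg, h⟩
    obtain ⟨g', hg', rfl⟩ := exists_mem_relabel e hg
    exact ⟨g', hg', fun d => by simpa using h d⟩

theorem alternatingGroup_le_of_relabel [Fintype α] [DecidableEq α] [Fintype β] [DecidableEq β]
    {H : Subgroup (Perm α)} {e : β ≃ α} (h : alternatingGroup β ≤ relabel H e) :
    alternatingGroup α ≤ H := by
  intro g hg
  obtain ⟨g', -, rfl⟩ := exists_mem_relabel (H := ⊤) e (Subgroup.mem_top g)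
  rw [mem_alternatingGroup, sign_permCongr] at hg
  exact h (mem_alternatingGroup.2 hg)

theorem IsPairHomogeneous.relabel {H : Subgroup (Perm α)} (h : IsPairHomogeneous H) (e : β ≃ α) :
    IsPairHomogeneous (relabel H e) := by
  intro x y u v hxy huv
  obtain ⟨g, hg, h⟩ := h (e x) (e y) (e u) (e v) (e.injective.ne hxy) (e.injective.ne huv)
  obtain ⟨g', hg', rfl⟩ := exists_mem_relabel e hg
  exact ⟨g', hg', by simpa using h⟩

theorem IsSetHomogeneous.relabel {H : Subgroup (Perm α)} {k : ℕ} (h : IsSetHomogeneous H k)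
    (e : β ≃ α) : IsSetHomogeneous (relabel H e) k := by
  intro s t hs ht
  obtain ⟨g, hg, h⟩ := h (s.map e.toEmbedding) (t.map e.toEmbedding) (by simpa) (by simpa)
  obtain ⟨g', hg', rfl⟩ := exists_mem_relabel e hg
  refine ⟨g', hg', ?_⟩
  apply Finset.map_injective e.toEmbedding
  rw [← h, Finset.map_map, Finset.map_map]
  congr 1
  ext x
  simp

theorem IsSetHomogeneous.of_relabel {H : Subgroup (Perm α)} {k : ℕ} {e : β ≃ α}
    (h : IsSetHomogeneous (PartitionHomogeneous.relabel H e) k) : IsSetHomogeneous H k := by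
  intro s t hs ht
  obtain ⟨g, hg, h⟩ := h (s.map e.symm.toEmbedding) (t.map e.symm.toEmbedding) (by simpa) (by simpa)
  refine ⟨e.permCongr g, hg, ?_⟩
  apply Finset.map_injective e.symm.toEmbedding
  rw [← h, Finset.map_map, Finset.map_map]
  congr 1
  ext x
  simp

theorem isPreprimitive_relabel {H : Subgroup (Perm α)} (h : MulAction.IsPreprimitive H α)
    (e : β ≃ α) : MulAction.IsPreprimitive (relabel H e) β := by
  let φ : relabel H e → H := fun g => ⟨e.permCongr g, g.2⟩
  have hφ : Function.Surjective φ := by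
    rintro ⟨h, hh⟩
    obtain ⟨g, hg, rfl⟩ := exists_mem_relabel e hh
    exact ⟨⟨g, hg⟩, rfl⟩
  let f : β →ₑ[φ] α := 
    { toFun := e
      map_smul' := fun g x => by
        change e ((g : Perm β) x) = e.permCongr (g : Perm β) (e x)
        simp }
  exact (MulAction.isPreprimitive_congr (f := f) hφ e.bijective).2 h

end Relabel

/-! ### Normalisers of p-cycles, and degree five -/

theorem apply_eq_of_conj_eq_pow {α : Type*} {p : ℕ} [NeZero p] {c h : Perm α} {k : ℕ} {u : ZMod p → α}
    (hc : ∀ x, c (u x) = u (x + 1)) (hh : h * c * h⁻¹ = c ^ k) {b : ZMod p} (hb : h (u 0) = u b)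
    (x : ZMod p) : h (u x) = u (k * x + b) := by
  have hpow : ∀ (n : ℕ) y, (c ^ n) (u y) = u (y + n) := by
    intro n
    induction n with
    | zero => intro y; simp
    | succ n ih =>
      intro y
      rw [pow_succ, Perm.mul_apply, hc, ih]
      push_cast
      congr 1
      ring
  obtain ⟨n, rfl⟩ := ZMod.natCast_zmod_surjective x
  -- On a cycle labelled by `ZMod p`, normalising the translations means being affine, with the
  -- exponent `k` as multiplier.
  have h1 : h * c ^ n = c ^ (k * n) * h := by
    rw [pow_mul, ← hh, conj_pow, inv_mul_cancel_right]
  have h2 := DFunLike.congr_fun h1 (u 0)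
  rw [Perm.mul_apply, Perm.mul_apply, hpow, hb, hpow, zero_add] at h2
  rw [h2]
  push_cast
  congr 1
  ring

/-- Used to name the points so that a given p-cycle of the group becomes a standard translation. -/
theorem exists_mem_relabel_of_isCycle {α β : Type*} [Fintype α] [Fintype β] [DecidableEq α]
    [DecidableEq β] {p : ℕ} (hp : p.Prime) {H : Subgroup (Perm α)} {c : Perm α} (hcH : c ∈ H)
    (hc : c.IsCycle) (ho : orderOf c = p) {τ : Perm β} (hτ : orderOf τ = p)
    (hs : τ.support.card = p) (hcard : Fintype.card α = Fintype.card β) :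
    ∃ e : β ≃ α, τ ∈ relabel H e := by
  obtain ⟨e, he⟩ := exists_equiv_of_prime_order hp ho hτ (by rw [hs, ← ho, hc.orderOf]) hcard
  refine ⟨e.symm, ?_⟩
  rw [mem_relabel]
  convert hcH using 1
  ext x
  simp [← he]

theorem isThreeCycle_of_dvd_card {α : Type*} [Fintype α] [DecidableEq α] {K H : Subgroup (Perm α)}
    {s : Set α} (hK : K ≤ movingOnly s) (hs : s.ncard < 6) (hKH : K ≤ H) (h3 : 3 ∣ Nat.card K) :
    ∃ g ∈ H, g.IsThreeCycle := by
  have : Fact (Nat.Prime 3) := ⟨Nat.prime_three⟩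
  obtain ⟨⟨c, hcK⟩, hc⟩ := exists_prime_orderOf_dvd_card' 3 h3
  replace hc : orderOf c = 3 := by simpa using hc
  refine ⟨c, hKH hcK, ?_⟩
  obtain ⟨a, ha⟩ := support_card_of_prime_order Nat.prime_three hc
  have h1 : (c.support : Set α) ⊆ s := by
    intro x hx
    by_contra hxs
    exact mem_support.1 (Finset.mem_coe.1 hx) (hK hcK x hxs)
  have h2 := Set.ncard_le_ncard h1 (Set.toFinite s)
  rw [Set.ncard_coe_finset] at h2
  rw [← card_support_eq_three_iff]
  obtain rfl : a = 0 := by omega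
  omega

/-- A permutation group on `5` of the points without 3-cycles normalises each of its subgroups of
order `5`. -/
theorem exists_conj_eq_pow_of_movingOnly_five {α : Type*} [Fintype α] [DecidableEq α]
    {K : Subgroup (Perm α)} {s : Set α} (hK : K ≤ movingOnly s) (hs : s.ncard = 5) {c : Perm α}
    (hcK : c ∈ K) (hc : orderOf c = 5) (h3 : ¬ 3 ∣ Nat.card K) :
    ∀ h ∈ K, ∃ k : ℕ, h * c * h⁻¹ = c ^ k := by
  have h1 := card_dvd_factorial hK
  rw [hs] at h1
  obtain ⟨r, hr⟩ : 5 ∣ Nat.card K := by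
    rw [← hc]
    exact Subgroup.orderOf_dvd_natCard K hcK
  have hr1 : r ∣ 24 := by
    rw [hr, show Nat.factorial 5 = 5 * 24 from rfl] at h1
    exact Nat.dvd_of_mul_dvd_mul_left (by norm_num) h1
  have h3r : ¬ 3 ∣ r := fun h => h3 (hr ▸ Dvd.dvd.mul_left h 5)
  have hr2 : r ∣ 8 := by
    have : Nat.Coprime r 3 := ((Nat.prime_three.coprime_iff_not_dvd).2 h3r).symm
    exact this.dvd_of_dvd_mul_right (by simpa using hr1)
  -- |K| = 5r with r dividing 24 and prime to 3, so r divides 8, and 1 is the only divisor of 8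
  -- congruent to 1 modulo 5.
  refine exists_conj_eq_pow_of_card_eq hcK hc hr (fun h => ?_) fun d hd h => ?_
  · exact absurd (h.trans hr2) (by norm_num)
  · have hd8 := hd.trans hr2
    have : d ≤ 8 := Nat.le_of_dvd (by norm_num) hd8
    interval_cases d <;> omega

/-- 2 and 3 are the generators of the multiplicative group modulo 5, so one such element and the
translations generate everything. -/
theorem AGL1_five_le {H : Subgroup (Perm (ZMod 5))} (hc : Equiv.addRight (1 : ZMod 5) ∈ H)
    {g : Perm (ZMod 5)} (hg : g ∈ H) {k b : ZMod 5} (hk : k = 2 ∨ k = 3)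
    (hx : ∀ x, g x = k * x + b) : AGL1 (ZMod 5) ≤ H := by
  have hpow : ∀ i : ℕ, ∃ b : ZMod 5, ∀ x, (g ^ i) x = k ^ i * x + b := by
    intro i
    induction i with
    | zero => exact ⟨0, fun x => by simp⟩
    | succ i ih =>
      obtain ⟨b', h'⟩ := ih
      exact ⟨k * b' + b, fun x => by rw [pow_succ', Perm.mul_apply, h', hx]; ring⟩
  have hcpow : ∀ n : ℕ, ∀ x : ZMod 5, (Equiv.addRight (1 : ZMod 5) ^ n) x = x + n := by
    intro n
    induction n with
    | zero => intro x; simp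
    | succ n ih =>
      intro x
      rw [pow_succ', Perm.mul_apply, ih]
      simp [add_assoc]
  have hgen : ∀ a : ZMod 5, a ≠ 0 → ∃ i : ℕ, k ^ i = a := by
    have : ∀ a : ZMod 5, a ≠ 0 → ∃ i : Fin 4, k ^ (i : ℕ) = a := by
      rcases hk with rfl | rfl <;> decide
    exact fun a ha => ⟨_, (this a ha).choose_spec⟩
  rintro f ⟨a, d, ha, hf⟩
  obtain ⟨i, rfl⟩ := hgen a ha
  obtain ⟨b', hb'⟩ := hpow i
  obtain ⟨n, hn⟩ := ZMod.natCast_zmod_surjective (d - b')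
  have : f = Equiv.addRight (1 : ZMod 5) ^ n * g ^ i := by
    ext1 x
    rw [Perm.mul_apply, hcpow, hb', hn, hf]
    ring
  rw [this]
  exact H.mul_mem (H.pow_mem hc n) (H.pow_mem hg i)

/-- As 3 does not divide |H|, the translations are normalised and all elements are affine. An
element taking {0, 1} to {0, 2} has multiplier ±2, a generator. -/
theorem eq_AGL1_five {H : Subgroup (Perm (ZMod 5))} (hH : IsPairHomogeneous H)
    (hc : Equiv.addRight (1 : ZMod 5) ∈ H) (h3 : ¬ 3 ∣ Nat.card H) : H = AGL1 (ZMod 5) := by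
  have hord : orderOf (Equiv.addRight (1 : ZMod 5)) = 5 :=
    orderOf_eq_prime (by decide) (by decide)
  have hnorm := exists_conj_eq_pow_of_movingOnly_five (K := H) (s := Set.univ)
    (fun g _ a ha => absurd (Set.mem_univ a) ha) (by simp) hc hord h3
  have haff : ∀ h ∈ H, ∃ k b : ZMod 5, ∀ x, h x = k * x + b := by
    intro h hh
    obtain ⟨k, hk⟩ := hnorm h hh
    exact ⟨k, h 0, apply_eq_of_conj_eq_pow (u := id) (fun x => rfl) hk rfl⟩
  have hne : ∀ (h : Perm (ZMod 5)) (k b : ZMod 5), (∀ x, h x = k * x + b) → k ≠ 0 := by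
    rintro h k b hx rfl
    exact absurd (h.injective ((hx 0).trans (by rw [hx 1]; ring))) (by decide)
  apply le_antisymm
  · intro h hh
    obtain ⟨k, b, hx⟩ := haff h hh
    exact ⟨k, b, hne h k b hx, hx⟩
  · obtain ⟨g, hg, h⟩ := hH 0 1 0 2 (by decide) (by decide)
    obtain ⟨k, b, hx⟩ := haff g hg
    refine AGL1_five_le hc hg ?_ hx
    rw [hx, hx] at h
    revert h
    clear hx
    revert k b
    decide

theorem degree_five {α : Type*} [Fintype α] [DecidableEq α] {H : Subgroup (Perm α)}
    (hα : Fintype.card α = 5) (hH : IsPairHomogeneous H) (h5 : 5 ∣ Nat.card H) :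
    alternatingGroup α ≤ H ∨ IsPermIsomorphic H (AGL1 (ZMod 5)) := by
  by_cases h3 : 3 ∣ Nat.card H
  · refine Or.inl (alternatingGroup_le_of_exists_isThreeCycle (hH.isPreprimitive (by omega)) ?_)
    obtain ⟨c, hc, hcc, ho⟩ := exists_isCycle_of_dvd_card Nat.prime_three h3 (by omega)
    exact ⟨c, hc, isThreeCycle_of_isCycle hcc ho⟩
  · obtain ⟨c, hc, hcc, ho⟩ := exists_isCycle_of_dvd_card Nat.prime_five h5 (by omega)
    obtain ⟨e, he⟩ := exists_mem_relabel_of_isCycle Nat.prime_five hc hcc ho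
      (τ := Equiv.addRight (1 : ZMod 5)) (orderOf_eq_prime (by decide) (by decide)) (by decide)
      (by rw [hα, ZMod.card])
    refine Or.inr (IsPermIsomorphic.of_relabel (e := e) ?_)
    rw [eq_AGL1_five (hH.relabel e) he (by rwa [card_relabel])]
    exact IsPermIsomorphic.refl _

/-! ### The projective line in homogeneous coordinates -/

section ProjectiveLine

variable {K : Type*} [Field K]

/-- Homogeneous coordinates of a point of the line `K ∪ {∞}`. -/
def homogeneous (x : Option K) : Fin 2 → K := ![x.getD 1, if x.isSome then 1 else 0]

@[simp] theorem homogeneous_none : homogeneous (none : Option K) = ![1, 0] := rfl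

@[simp] theorem homogeneous_some (x : K) : homogeneous (some x) = ![x, 1] := rfl

theorem homogeneous_ne_zero (x : Option K) : homogeneous x ≠ 0 := by
  intro h
  cases x
  · simpa using congrFun h 0
  · simpa using congrFun h 1

theorem mk_eq_mk_iff_mul_eq {v w : Fin 2 → K} (hv : v ≠ 0) (hw : w ≠ 0) :
    Projectivization.mk K v hv = Projectivization.mk K w hw ↔ v 0 * w 1 = v 1 * w 0 := by
  rw [Projectivization.mk_eq_mk_iff']
  constructor
  · rintro ⟨a, rfl⟩
    simp only [Pi.smul_apply, smul_eq_mul]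
    ring
  · intro h
    by_cases h0 : w 0 = 0
    · have h1 : w 1 ≠ 0 := fun h1 => hw (by ext i; fin_cases i <;> simpa)
      refine ⟨v 1 / w 1, ?_⟩
      have hv0 : v 0 = 0 := by simpa [h0, h1] using h
      ext i
      fin_cases i
      · simp [h0, hv0]
      · simp [h1]
    · refine ⟨v 0 / w 0, ?_⟩
      ext i
      fin_cases i
      · simp [h0]
      · simp only [Fin.mk_one, Pi.smul_apply, smul_eq_mul]
        rw [div_mul_eq_mul_div, h, mul_div_assoc, div_self h0, mul_one]

variable (K) in
/-- The projective line over `K` as `K` together with a point at infinity. -/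
noncomputable def projLine : Option K ≃ ℙ K (Fin 2 → K) :=
  Equiv.ofBijective (fun x => Projectivization.mk K (homogeneous x) (homogeneous_ne_zero x)) (by
    constructor
    · intro x y h
      rw [mk_eq_mk_iff_mul_eq] at h
      cases x <;> cases y <;> simp_all
    · intro p
      induction p using Projectivization.ind with | _ v hv =>
      by_cases h : v 1 = 0
      · exact ⟨none, by rw [mk_eq_mk_iff_mul_eq]; simp [h]⟩
      · exact ⟨some (v 0 / v 1), by rw [mk_eq_mk_iff_mul_eq]; simp [h]⟩)

theorem projLine_apply (x : Option K) :
    projLine K x = Projectivization.mk K (homogeneous x) (homogeneous_ne_zero x) := rfl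

theorem mem_PSL2_iff {g : Perm (ℙ K (Fin 2 → K))} :
    g ∈ PSL2 K ↔ ∃ M : SL(2, K), ∀ p, g p = M • p := by
  constructor
  · rintro ⟨q, rfl⟩
    induction q using QuotientGroup.induction_on with | _ M =>
    exact ⟨M, fun p => rfl⟩
  · rintro ⟨M, h⟩
    exact ⟨QuotientGroup.mk M, Equiv.ext fun p => (h p).symm⟩

/-- Equality of projective points is written by cross-multiplication, so the point at infinity needs
no separate case and the condition is decidable over a finite field. -/
theorem mem_relabel_PSL2_iff {g : Perm (Option K)} :
    g ∈ relabel (PSL2 K) (projLine K) ↔ ∃ a b c d : K, a * d - b * c = 1 ∧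
      ∀ x, (a * homogeneous x 0 + b * homogeneous x 1) * homogeneous (g x) 1 =
        (c * homogeneous x 0 + d * homogeneous x 1) * homogeneous (g x) 0 := by
  have key : ∀ (M : SL(2, K)) (x : Option K), projLine K (g x) = M • projLine K x ↔
      (M.1 0 0 * homogeneous x 0 + M.1 0 1 * homogeneous x 1) * homogeneous (g x) 1 =
        (M.1 1 0 * homogeneous x 0 + M.1 1 1 * homogeneous x 1) * homogeneous (g x) 0 := by
    intro M x
    rw [projLine_apply, projLine_apply, Projectivization.smul_mk, eq_comm, mk_eq_mk_iff_mul_eq]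
    have : ∀ i, (M • homogeneous x) i =
        M.1 i 0 * homogeneous x 0 + M.1 i 1 * homogeneous x 1 := by
      intro i
      change Matrix.mulVec M.1 (homogeneous x) i = _
      rw [Matrix.mulVec, dotProduct, Fin.sum_univ_two]
    rw [this, this]
  rw [mem_relabel, mem_PSL2_iff]
  constructor
  · rintro ⟨M, hM⟩
    have hdet := M.2
    rw [Matrix.det_fin_two] at hdet
    refine ⟨_, _, _, _, hdet, fun x => (key M x).1 ?_⟩
    rw [← hM, permCongr_apply, symm_apply_apply]
  · rintro ⟨a, b, c, d, hdet, h⟩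
    refine ⟨⟨!![a, b; c, d], by rw [Matrix.det_fin_two]; exact hdet⟩, fun p => ?_⟩
    obtain ⟨x, rfl⟩ := (projLine K).surjective p
    rw [permCongr_apply, symm_apply_apply]
    exact (key _ x).2 (h x)

theorem exists_of_mem_relabel_PGammaL2 {g : Perm (Option K)}
    (hg : g ∈ relabel (PGammaL2 K) (projLine K)) : ∃ (τ : K ≃+* K) (a b c d : K), (a ≠ 0 ∨ c ≠ 0) ∧
      ∀ x, (a * τ (homogeneous x 0) + b * τ (homogeneous x 1)) * homogeneous (g x) 1 =
        (c * τ (homogeneous x 0) + d * τ (homogeneous x 1)) * homogeneous (g x) 0 := by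
  obtain ⟨τ, f, hf, hfg⟩ := hg
  refine ⟨τ, f ![1, 0] 0, f ![0, 1] 0, f ![1, 0] 1, f ![0, 1] 1, ?_, fun x => ?_⟩
  · have h0 : f ![1, 0] ≠ 0 := f.map_ne_zero_iff.2 (homogeneous_ne_zero none)
    by_contra! h
    exact h0 (by ext i; fin_cases i; exacts [h.1, h.2])
  have h := hfg (homogeneous x) (homogeneous_ne_zero x)
  rw [← projLine_apply] at h
  have h' : projLine K (g x) = _ := (by simp : _ = _).trans h
  rw [projLine_apply, eq_comm, mk_eq_mk_iff_mul_eq] at h'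
  have hfx : f (homogeneous x) =
      τ (homogeneous x 0) • f ![1, 0] + τ (homogeneous x 1) • f ![0, 1] := by
    rw [← hf, ← hf, ← map_add]
    congr 1
    ext i
    fin_cases i <;> simp
  rw [hfx] at h'
  simp only [Pi.add_apply, Pi.smul_apply, smul_eq_mul] at h'
  linear_combination h'

theorem PSL2_le_PGammaL2 : PSL2 K ≤ PGammaL2 K := by
  intro g hg
  obtain ⟨M, hM⟩ := mem_PSL2_iff.1 hg
  exact ⟨RingEquiv.refl K, DistribMulAction.toAddEquiv (Fin 2 → K) M, fun c v => smul_comm M c v,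
    fun v hv => hM _⟩

theorem optionCongr_mem_relabel_PGammaL2 (τ : K ≃+* K) :
    Equiv.optionCongr τ.toEquiv ∈ relabel (PGammaL2 K) (projLine K) := by
  refine ⟨τ, AddEquiv.piCongrRight fun _ => τ.toAddEquiv, fun c v => ?_, fun v hv => ?_⟩
  · ext i
    simp
  · obtain ⟨x, hx⟩ := (projLine K).surjective (Projectivization.mk K v hv)
    have h' : (projLine K).permCongr (Equiv.optionCongr τ.toEquiv) (projLine K x) =
        projLine K (Equiv.optionCongr τ.toEquiv x) := by
      rw [permCongr_apply, symm_apply_apply]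
    rw [← hx]
    refine h'.trans ?_
    rw [projLine_apply, mk_eq_mk_iff_mul_eq] at hx ⊢
    have h := congrArg τ hx
    rw [map_mul, map_mul] at h
    cases x
    · simpa [eq_comm] using h
    · simpa [eq_comm] using h

end ProjectiveLine

/-- A common subgroup `Y` brings every permutation to one satisfying `B`, so `H` and `P` need only
be compared on such elements. In the applications `B` says that certain base points are fixed. -/
theorem eq_of_le_of_le {α : Type*} {H P Y : Subgroup (Perm α)} {B : Perm α → Prop} (hYH : Y ≤ H)
    (hYP : Y ≤ P) (hY : ∀ g, ∃ y ∈ Y, B (y * g)) (hH : ∀ h ∈ H, B h → h ∈ P)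
    (hP : ∀ h ∈ P, B h → h ∈ H) : H = P := by
  have key : ∀ H P : Subgroup (Perm α), Y ≤ H → Y ≤ P → (∀ h ∈ H, B h → h ∈ P) → H ≤ P := by
    intro H P hYH hYP hH h hh
    obtain ⟨y, hy, hyh⟩ := hY h
    exact (P.mul_mem_cancel_left (hYP hy)).1 (hH (y * h) (H.mul_mem (hYH hy) hh) hyh)
  exact le_antisymm (key H P hYH hYP hH) (key P H hYP hYH hP)

/-! ### Degree six -/

/-- The permutation `x ↦ x + a` fixing the point at infinity. -/
def shift {p : ℕ} (a : ZMod p) : Perm (Option (ZMod p)) := Equiv.optionCongr (Equiv.addRight a)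

-- The word in the hypothesis runs ∞ → 0 → i → j → 0 → ∞, so in the application it fixes ∞ and must
-- be affine with multiplier ±1. The two solutions are x ↦ 1/x and x ↦ −1/x.
set_option synthInstance.maxSize 1000 in
set_option synthInstance.maxHeartbeats 200000 in
theorem swap_five_classification : ∀ s : Perm (Option (ZMod 5)), s none = some 0 →
    s (some 0) = none → (∀ i j : ZMod 5, i ≠ 0 → s (some i) = some j → ∃ k b : ZMod 5,
      (k = 1 ∨ k = -1) ∧ ∀ x, s (shift (-j) (s (shift i (s (some x))))) = some (k * x + b)) →
    (s (some 1) = some 1 ∧ s (some 2) = some 3 ∧ s (some 3) = some 2 ∧ s (some 4) = some 4) ∨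
    (s (some 1) = some 4 ∧ s (some 2) = some 2 ∧ s (some 3) = some 3 ∧ s (some 4) = some 1) := by
  decide +kernel

theorem isPermIsomorphic_relabel {α β : Type*} (H : Subgroup (Perm α)) (e : β ≃ α) :
    IsPermIsomorphic (relabel H e) H := by
  refine ⟨e.symm, fun h => ?_⟩
  constructor
  · intro hh
    obtain ⟨g, hg, rfl⟩ := exists_mem_relabel e hh
    exact ⟨g, hg, fun d => by simp⟩
  · rintro ⟨g, hg, h'⟩
    have : e.permCongr g = h := by
      ext d
      simp [h']
    exact this ▸ hg

theorem shift_mem {p : ℕ} [NeZero p] {H : Subgroup (Perm (Option (ZMod p)))}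
    (hc : shift (1 : ZMod p) ∈ H) (a : ZMod p) : shift a ∈ H := by
  obtain ⟨n, rfl⟩ := ZMod.natCast_zmod_surjective a
  have : ∀ n : ℕ, shift (n : ZMod p) = shift (1 : ZMod p) ^ n := by
    intro n
    induction n with
    | zero => ext1 x; cases x <;> simp [shift]
    | succ n ih =>
      rw [pow_succ', ← ih]
      ext1 x
      cases x <;> simp [shift, add_assoc]
  rw [this]
  exact H.pow_mem hc n

/-- Move one point of a 3-set to ∞ and normalise the other two to 0 and 1 by an affine map. -/
theorem isSetHomogeneous_three_of_affine {H : Subgroup (Perm (Option (ZMod 5)))}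
    (ht : ∀ x, ∃ h ∈ H, h x = none)
    (haff : ∀ a b : ZMod 5, a ≠ 0 → ∃ h ∈ H, h none = none ∧ ∀ x, h (some x) = some (a * x + b)) :
    IsSetHomogeneous H 3 := by
  have key : ∀ s : Finset (Option (ZMod 5)), s.card = 3 →
      ∃ h ∈ H, s.map h.toEmbedding = {none, some 0, some 1} := by
    intro s hs
    obtain ⟨x, y, z, hxy, hxz, hyz, rfl⟩ := Finset.card_eq_three.1 hs
    obtain ⟨g, hg, hgx⟩ := ht x
    have hne : ∀ w, x ≠ w → ∃ v, g w = some v := by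
      intro w hw
      refine Option.ne_none_iff_exists'.1 fun h => hw (g.injective (hgx.trans h.symm))
    obtain ⟨v, hv⟩ := hne y hxy
    obtain ⟨w, hw⟩ := hne z hxz
    have hvw : w - v ≠ 0 := by
      intro h
      rw [sub_eq_zero] at h
      exact hyz (g.injective (by rw [hv, hw, h]))
    obtain ⟨h, hh, h1, h2⟩ := haff (w - v)⁻¹ (-((w - v)⁻¹ * v)) (inv_ne_zero hvw)
    refine ⟨h * g, H.mul_mem hh hg, ?_⟩
    have h3 : (w - v)⁻¹ * w + -((w - v)⁻¹ * v) = 1 := by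
      rw [← inv_mul_cancel₀ hvw]; ring
    simp only [Finset.map_insert, Finset.map_singleton, coe_toEmbedding, Perm.mul_apply, hgx, hv, hw,
      h1, h2, h3, add_neg_cancel]
  intro s t hs ht
  obtain ⟨g, hg, h1⟩ := key s hs
  obtain ⟨g', hg', h2⟩ := key t ht
  refine ⟨g'⁻¹ * g, H.mul_mem (H.inv_mem hg') hg, ?_⟩
  apply Finset.map_injective g'.toEmbedding
  rw [h2, ← h1, Finset.map_map]
  congr 1
  ext x
  simp

/-- Without 3-cycles the stabiliser of ∞ is affine. A multiplier 2 or 3 gives all of AGL(1,5) and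
3-homogeneity. Otherwise all multipliers are ±1, an element exchanging ∞ and 0 is x ↦ ±1/x, and H
agrees with PSL(2,5) on the stabiliser of ∞ and on representatives moving any point to ∞. -/
theorem classification_six {H : Subgroup (Perm (Option (ZMod 5)))}
    (hH : MulAction.IsPreprimitive H (Option (ZMod 5))) (hc : shift (1 : ZMod 5) ∈ H)
    (h3 : ∀ g ∈ H, ¬ g.IsThreeCycle) :
    IsSetHomogeneous H 3 ∨ IsPermIsomorphic H (PSL2 (ZMod 5)) := by
  have hord : orderOf (shift (1 : ZMod 5)) = 5 := orderOf_eq_prime (by decide) (by decide)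
  have hS : ({none}ᶜ : Set (Option (ZMod 5))).ncard = 5 := by
    rw [Set.ncard_compl, Set.ncard_singleton, Nat.card_eq_fintype_card]
    rfl
  have hnorm := exists_conj_eq_pow_of_movingOnly_five
    (K := H ⊓ movingOnly {none}ᶜ) (s := {none}ᶜ) inf_le_right hS (c := shift (1 : ZMod 5))
    ⟨hc, fun a ha => by
      obtain rfl : a = none := by simpa using ha
      rfl⟩ hord (by
      intro h
      obtain ⟨g, hg, h⟩ := isThreeCycle_of_dvd_card (H := H) inf_le_right (by omega) inf_le_left h
      exact h3 g hg h)
  have haff : ∀ h ∈ H, h none = none → ∃ k b : ZMod 5, ∀ x, h (some x) = some (k * x + b) := by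
    intro h hh hn
    obtain ⟨k, hk⟩ := hnorm h ⟨hh, fun a ha => by
      obtain rfl : a = none := by simpa using ha
      exact hn⟩
    obtain ⟨b, hb⟩ : ∃ b, h (some 0) = some b :=
      Option.ne_none_iff_exists'.1 fun h' => by simpa using h.injective (hn.trans h'.symm)
    exact ⟨k, b, apply_eq_of_conj_eq_pow (u := some) (fun x => rfl) hk hb⟩
  have hk0 : ∀ h : Perm (Option (ZMod 5)), ∀ k b : ZMod 5, (∀ x, h (some x) = some (k * x + b)) →
      k ≠ 0 := by
    rintro h k b hx rfl
    exact absurd (h.injective ((hx 0).trans (by rw [hx 1, zero_mul, zero_mul]))) (by decide)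
  have ht : ∀ x, ∃ h ∈ H, h x = none := fun x => by
    obtain ⟨⟨g, hg⟩, h⟩ := hH.exists_smul_eq x none
    exact ⟨g, hg, h⟩
  by_cases hR : ∃ h ∈ H, h none = none ∧ ∃ k b : ZMod 5, (∀ x, h (some x) = some (k * x + b)) ∧
      (k = 2 ∨ k = 3)
  · left
    obtain ⟨h, hh, hn, k, b, hx, hk⟩ := hR
    refine isSetHomogeneous_three_of_affine ht fun a d ha => ?_
    let L : Subgroup (Perm (ZMod 5)) := H.comap
      { toFun := Equiv.optionCongr
        map_one' := Equiv.optionCongr_refl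
        map_mul' := fun f g => Equiv.ext fun x => by cases x <;> rfl }
    have hL : ∀ σ, σ ∈ L ↔ Equiv.optionCongr σ ∈ H := fun σ => Iff.rfl
    obtain ⟨σ, hσ⟩ : ∃ σ : Perm (ZMod 5), Equiv.optionCongr σ = h := by
      refine ⟨Equiv.removeNone h, Equiv.ext fun x => ?_⟩
      cases x
      · rw [hn]; rfl
      · rw [optionCongr_apply, Option.map_some]
        exact Equiv.removeNone_some _ ⟨_, hx _⟩
    have hle := AGL1_five_le (H := L) hc (g := σ) (by rw [hL, hσ]; exact hh) hk (b := b)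
      (fun x => by
        apply Option.some_injective
        rw [← hx, ← hσ]
        rfl)
    let τ : Perm (ZMod 5) := (Equiv.mulLeft₀ a ha).trans (Equiv.addRight d)
    exact ⟨Equiv.optionCongr τ, hle (x := τ) ⟨a, d, ha, fun x => rfl⟩, rfl, fun x => rfl⟩
  right
  have haff' : ∀ h ∈ H, h none = none →
      ∃ k b : ZMod 5, (k = 1 ∨ k = -1) ∧ ∀ x, h (some x) = some (k * x + b) := by
    intro h hh hn
    obtain ⟨k, b, hx⟩ := haff h hh hn
    refine ⟨k, b, ?_, hx⟩
    have h1 := hk0 h k b hx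
    have h2 : ¬ (k = 2 ∨ k = 3) := fun hk => hR ⟨h, hh, hn, k, b, hx, hk⟩
    clear hx
    revert k
    decide
  obtain ⟨s, hs, hs1, hs2⟩ : ∃ s ∈ H, s none = some 0 ∧ s (some 0) = none := by
    obtain ⟨g, hg, hg0⟩ := ht (some 0)
    obtain ⟨y, hy⟩ : ∃ y, g none = some y :=
      Option.ne_none_iff_exists'.1 fun h' => by simpa using g.injective (h'.trans hg0.symm)
    refine ⟨shift (-y) * g, H.mul_mem (shift_mem hc _) hg, ?_, ?_⟩
    · rw [Perm.mul_apply, hy]; simp [shift]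
    · rw [Perm.mul_apply, hg0]; rfl
  have hs3 := swap_five_classification s hs1 hs2 (fun i j hi hij => by
    obtain ⟨k, b, hk, hx⟩ := haff' (s * shift (-j) * s * shift i * s)
      (H.mul_mem (H.mul_mem (H.mul_mem (H.mul_mem hs (shift_mem hc _)) hs) (shift_mem hc _)) hs) (by
        simp only [Perm.mul_apply, hs1]
        have : shift i (some 0) = some i := by simp [shift]
        rw [this, hij]
        have : shift (-j) (some j) = some 0 := by simp [shift]
        rw [this, hs2])
    exact ⟨k, b, hk, hx⟩)
  -- `s₀` is x ↦ −1/x and `r` is x ↦ −x.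
  obtain ⟨s₀, hs₀⟩ : ∃ s₀ : Perm (Option (ZMod 5)), s₀ = swap none (some 0) * swap (some 1) (some 4) :=
    ⟨_, rfl⟩
  obtain ⟨r, hr⟩ : ∃ r : Perm (Option (ZMod 5)), r = Equiv.optionCongr (Equiv.neg (ZMod 5)) :=
    ⟨_, rfl⟩
  have hmem : s₀ ∈ H ∧ r ∈ H := by
    rcases hs3 with ⟨h1, h2, h3, h4⟩ | ⟨h1, h2, h3, h4⟩
    · have hss : s = s₀ * r := by
        rw [hs₀, hr]
        ext1 x
        rcases x with _ | x
        · exact hs1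
        · fin_cases x
          · exact hs2
          · exact h1
          · exact h2
          · exact h3
          · exact h4
      -- The five-letter word in `s` is affine with multiplier −1; a further translation turns it
      -- into negation.
      have hrH : r ∈ H := by
        have : r = shift 1 * (s * shift (-1) * s * shift 1 * s) := by
          rw [hss, hr, hs₀]; decide
        rw [this]
        exact H.mul_mem (shift_mem hc _) (H.mul_mem (H.mul_mem (H.mul_mem (H.mul_mem hs (shift_mem hc _)) hs) (shift_mem hc _)) hs)
      exact ⟨(H.mul_mem_cancel_right hrH).1 (hss ▸ hs), hrH⟩
    · have hss : s = s₀ := by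
        rw [hs₀]
        ext1 x
        rcases x with _ | x
        · exact hs1
        · fin_cases x
          · exact hs2
          · exact h1
          · exact h2
          · exact h3
          · exact h4
      have hrH : r ∈ H := by
        have : r = shift 2 * (s * shift (-2) * s * shift 2 * s) := by
          rw [hss, hr, hs₀]; decide
        rw [this]
        exact H.mul_mem (shift_mem hc _) (H.mul_mem (H.mul_mem (H.mul_mem (H.mul_mem hs (shift_mem hc _)) hs) (shift_mem hc _)) hs)
      exact ⟨hss ▸ hs, hrH⟩
  obtain ⟨P, hP⟩ : ∃ P, P = relabel (PSL2 (ZMod 5)) (projLine (ZMod 5)) := ⟨_, rfl⟩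
  have hcP : shift (1 : ZMod 5) ∈ P := by
    rw [hP, mem_relabel_PSL2_iff]
    exact ⟨1, 1, 0, 1, by decide, by decide⟩
  have hsP : s₀ ∈ P := by
    rw [hP, mem_relabel_PSL2_iff]
    refine ⟨0, -1, 1, 0, by decide, ?_⟩
    rw [hs₀]; decide
  have hrP : r ∈ P := by
    rw [hP, mem_relabel_PSL2_iff]
    refine ⟨2, 0, 0, 3, by decide, ?_⟩
    rw [hr]; decide
  have hshape : ∀ L : Subgroup (Perm (Option (ZMod 5))), shift (1 : ZMod 5) ∈ L → r ∈ L →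
      ∀ h : Perm (Option (ZMod 5)), h none = none → ∀ k b : ZMod 5, (k = 1 ∨ k = -1) →
      (∀ x, h (some x) = some (k * x + b)) → h ∈ L := by
    intro L hcL hrL h hn k b hk hx
    rcases hk with rfl | rfl
    · have : h = shift b := by
        ext1 x
        rcases x with _ | x
        · exact hn
        · rw [hx, one_mul]; rfl
      exact this ▸ shift_mem hcL b
    · have : h = shift b * r := by
        ext1 x
        rcases x with _ | x
        · rw [hn, hr]; rfl
        · rw [hx, neg_one_mul, hr]; rfl
      rw [this]
      exact L.mul_mem (shift_mem hcL b) hrL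
  have hHP : H = P := by
    refine eq_of_le_of_le (Y := H ⊓ P) (B := fun g => g none = none) inf_le_left inf_le_right ?_ ?_ ?_
    · intro g
      rcases hg : g none with _ | x
      · exact ⟨1, Subgroup.one_mem _, hg⟩
      · refine ⟨s₀ * shift (-x), Subgroup.mul_mem _ ⟨hmem.1, hsP⟩
          ⟨shift_mem hc _, shift_mem hcP _⟩, ?_⟩
        rw [Perm.mul_apply, hg, Perm.mul_apply, hs₀]
        have : shift (-x) (some x) = some 0 := by simp [shift]
        rw [this]
        rfl
    · intro h hh hn
      obtain ⟨k, b, hk, hx⟩ := haff' h hh hn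
      exact hshape P hcP hrP h hn k b hk hx
    · intro h hh hn
      rw [hP, mem_relabel_PSL2_iff] at hh
      obtain ⟨a, b, c, d, hdet, hx⟩ := hh
      have hc0 : c = 0 := by simpa [hn, eq_comm] using hx none
      subst hc0
      have had : a * d = 1 := by linear_combination hdet
      -- The matrix acts on finite points as x ↦ a²x + ab, and the nonzero squares modulo 5 are ±1.
      have ha : a * a = 1 ∨ a * a = -1 := by
        clear hx hdet
        revert a d
        decide
      refine hshape H hc hmem.2 h hn (a * a) (a * b) ha fun x => ?_
      obtain ⟨y, hy⟩ : ∃ y, h (some x) = some y :=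
        Option.ne_none_iff_exists'.1 fun h' => by simpa using h.injective (h'.trans hn.symm)
      have := hx (some x)
      rw [hy] at this ⊢
      simp at this
      congr 1
      linear_combination (-a) * this + (- y) * had
  rw [hHP, hP]
  exact isPermIsomorphic_relabel _ _

/-- Parity is corrected by a swap inside the source set, which has at least two points. -/
theorem isSetHomogeneous_of_alternatingGroup_le {α : Type*} [Fintype α] [DecidableEq α]
    {H : Subgroup (Perm α)} (h : alternatingGroup α ≤ H) {k : ℕ} (hk : 2 ≤ k) :
    IsSetHomogeneous H k := by
  intro s t hs ht
  obtain ⟨g, hg⟩ : ∃ g : Perm α, s.map g.toEmbedding = t := by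
    let e : s ≃ t := Finset.equivOfCardEq (hs.trans ht.symm)
    refine ⟨e.extendSubtype, ?_⟩
    refine Finset.eq_of_subset_of_card_le (fun y hy => ?_) (by rw [Finset.card_map, hs, ht])
    obtain ⟨x, hx, rfl⟩ := Finset.mem_map.1 hy
    exact Equiv.extendSubtype_mem e x hx
  rcases Int.units_eq_one_or (sign g) with h1 | h1
  · exact ⟨g, h (mem_alternatingGroup.2 h1), hg⟩
  · obtain ⟨x, hx, y, hy, hxy⟩ := Finset.one_lt_card.1 (by omega : 1 < s.card)
    refine ⟨g * swap x y, h (mem_alternatingGroup.2 (by rw [Perm.sign_mul, sign_swap hxy, h1]; rfl)), ?_⟩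
    rw [← hg]
    have : s.map (swap x y).toEmbedding = s := by
      refine Finset.eq_of_subset_of_card_le (fun z hz => ?_) (by rw [Finset.card_map])
      obtain ⟨w, hw, rfl⟩ := Finset.mem_map.1 hz
      rw [coe_toEmbedding, swap_apply_def]
      split_ifs <;> assumption
    conv_rhs => rw [← this]
    rw [Finset.map_map]
    congr 1

theorem degree_six {α : Type*} [Fintype α] [DecidableEq α] {H : Subgroup (Perm α)}
    (hα : Fintype.card α = 6) (hH : IsPairHomogeneous H) (h5 : 5 ∣ Nat.card H) :
    IsSetHomogeneous H 3 ∨ IsPermIsomorphic H (PSL2 (ZMod 5)) := by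
  have hprim := hH.isPreprimitive (by omega)
  obtain ⟨c, hc, hcc, ho⟩ := exists_isCycle_of_dvd_card Nat.prime_five h5 (by omega)
  obtain ⟨e, he⟩ := exists_mem_relabel_of_isCycle Nat.prime_five hc hcc ho
    (τ := shift (1 : ZMod 5)) (orderOf_eq_prime (by decide) (by decide)) (by decide)
    (by rw [hα, Fintype.card_option, ZMod.card])
  have hprim' := isPreprimitive_relabel hprim e
  by_cases h3 : ∃ g ∈ relabel H e, g.IsThreeCycle
  · exact Or.inl (isSetHomogeneous_of_alternatingGroup_le (alternatingGroup_le_of_relabel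
      (alternatingGroup_le_of_exists_isThreeCycle hprim' h3)) (by omega))
  · push Not at h3
    exact (classification_six hprim' he h3).imp IsSetHomogeneous.of_relabel
      IsPermIsomorphic.of_relabel

/-! ### Three-cycles in homogeneous groups -/

section Homogeneity

variable {α : Type*} [Fintype α] [DecidableEq α]

theorem IsSetHomogeneous.compl {H : Subgroup (Perm α)} {k l : ℕ} (h : IsSetHomogeneous H k)
    (hkl : k + l = Fintype.card α) : IsSetHomogeneous H l := by
  intro s t hs ht
  obtain ⟨g, hg, h⟩ := h sᶜ tᶜ (by rw [Finset.card_compl]; omega) (by rw [Finset.card_compl]; omega)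
  refine ⟨g, hg, ?_⟩
  ext x
  have := Finset.ext_iff.1 h x
  simp only [Finset.mem_map_equiv, Finset.mem_compl] at this ⊢
  tauto

/-- In a `k`-homogeneous group, a nontrivial element moving exactly `k` points has a conjugate that
moves exactly one common point with it. -/
theorem IsSetHomogeneous.exists_isThreeCycle {H : Subgroup (Perm α)} {k : ℕ}
    (h : IsSetHomogeneous H k) (hk : 1 ≤ k) (hα : 2 * k ≤ Fintype.card α + 1) {d : Perm α}
    (hd : d ∈ H) (hs : d.support.card = k) : ∃ g ∈ H, g.IsThreeCycle := by
  obtain ⟨a, ha⟩ := Finset.card_pos.1 (by omega : 0 < d.support.card)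
  -- The bound 2k − 1 ≤ n leaves k − 1 points outside the support. A conjugate with support {a} ∪ B
  -- meets the support of `d` only in `a`, so their commutator is a 3-cycle.
  obtain ⟨B, hB, hBk⟩ := Finset.exists_subset_card_eq (s := d.supportᶜ) (n := k - 1)
    (by rw [Finset.card_compl]; omega)
  have haB : a ∉ B := fun h => Finset.mem_compl.1 (hB h) ha
  obtain ⟨g, hg, hgs⟩ := h d.support (insert a B) hs
    (by rw [Finset.card_insert_of_notMem haB]; omega)
  rw [← support_conj] at hgs
  refine ⟨_, ?_, isThreeCycle_commutator (x := d) (y := g * d * g⁻¹) (a := a) (mem_support.1 ha) ?_ ?_⟩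
  · have := H.mul_mem (H.mul_mem hg hd) (H.inv_mem hg)
    exact H.mul_mem (H.mul_mem (H.mul_mem hd this) (H.inv_mem hd)) (H.inv_mem this)
  · rw [← mem_support, hgs]
    exact Finset.mem_insert_self _ _
  · intro b h1 h2
    rw [← mem_support, hgs] at h2
    refine (Finset.mem_insert.1 h2).resolve_right fun h => ?_
    exact Finset.mem_compl.1 (hB h) (mem_support.2 h1)

end Homogeneity

/-! ### Primitive groups containing a p-cycle with two fixed points -/

section TwoFixedPoints

variable {p : ℕ}

/-- The permutation `x ↦ x + a` of `ZMod p` fixing two additional points. -/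
def shift₂ (a : ZMod p) : Perm (Option (Option (ZMod p))) := Equiv.optionCongr (shift a)

@[simp] theorem shift₂_none (a : ZMod p) : shift₂ a none = none := rfl

@[simp] theorem shift₂_some_none (a : ZMod p) : shift₂ a (some none) = some none := rfl

@[simp] theorem shift₂_some_some (a x : ZMod p) : shift₂ a (some (some x)) = some (some (x + a)) :=
  rfl

theorem shift₂_apply_eq_iff (hp : 2 ≤ p) (v : Option (Option (ZMod p))) :
    shift₂ (1 : ZMod p) v = v ↔ v = none ∨ v = some none := by
  have : Fact (1 < p) := ⟨hp⟩
  rcases v with _ | _ | x <;> simp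

theorem orderOf_shift₂ (hp : p.Prime) : orderOf (shift₂ (1 : ZMod p)) = p := by
  have : Fact p.Prime := ⟨hp⟩
  refine orderOf_eq_prime ?_ ?_
  · have : ∀ n : ℕ, ∀ x, (shift₂ (1 : ZMod p) ^ n) (some (some x)) = some (some (x + n)) := by
      intro n
      induction n with
      | zero => intro x; simp
      | succ n ih => intro x; rw [pow_succ', Perm.mul_apply, ih]; simp [add_assoc]
    have hfix : ∀ n : ℕ, ∀ x, shift₂ (1 : ZMod p) x = x → (shift₂ (1 : ZMod p) ^ n) x = x :=
      fun n x hx => pow_apply_eq_self_of_apply_eq_self hx n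
    ext1 x
    rcases x with _ | _ | x
    · exact hfix p _ rfl
    · exact hfix p _ rfl
    · rw [this]; simp
  · intro h
    have := DFunLike.congr_fun h (some (some 0))
    simp at this

variable [NeZero p]

theorem shift₂_mem {H : Subgroup (Perm (Option (Option (ZMod p))))}
    (hc : shift₂ (1 : ZMod p) ∈ H) (a : ZMod p) : shift₂ a ∈ H := by
  obtain ⟨n, rfl⟩ := ZMod.natCast_zmod_surjective a
  have : ∀ n : ℕ, shift₂ (n : ZMod p) = shift₂ (1 : ZMod p) ^ n := by
    intro n
    induction n with
    | zero => ext1 x; rcases x with _ | _ | x <;> simp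
    | succ n ih =>
      rw [pow_succ', ← ih]
      ext1 x
      rcases x with _ | _ | x <;> simp [add_assoc]
  rw [this]
  exact H.pow_mem hc n

theorem support_shift₂ (hp : p.Prime) : (shift₂ (1 : ZMod p)).support.card = p := by
  have h1 : (shift₂ (1 : ZMod p)).supportᶜ = {none, some none} := by
    ext v
    rw [Finset.mem_compl, notMem_support, shift₂_apply_eq_iff hp.two_le]
    simp
  have h2 := Finset.card_compl (shift₂ (1 : ZMod p)).support
  have h3 := Finset.card_le_univ (shift₂ (1 : ZMod p)).support
  rw [h1, Finset.card_pair (by simp)] at h2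
  rw [Fintype.card_option, Fintype.card_option, ZMod.card] at h2 h3
  omega

theorem isCycle_shift₂ (hp : p.Prime) : (shift₂ (1 : ZMod p)).IsCycle := by
  refine isCycle_of_prime_order (by rwa [orderOf_shift₂ hp]) ?_
  rw [orderOf_shift₂ hp, support_shift₂ hp]
  have := hp.pos
  omega

variable {H : Subgroup (Perm (Option (Option (ZMod p))))}

/-- 3-transitivity: Jordan's argument moves the two fixed points of the cycle at will, and the cycle
itself takes care of the third point. -/
theorem exists_mem_to_base (hp : p.Prime)
    (hH : MulAction.IsPreprimitive H (Option (Option (ZMod p)))) (hc : shift₂ (1 : ZMod p) ∈ H)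
    {x y z : Option (Option (ZMod p))} (hxy : x ≠ y) (hxz : x ≠ z) (hyz : y ≠ z) :
    ∃ h ∈ H, h x = none ∧ h y = some none ∧ h z = some (some 0) := by
  obtain ⟨σ, hσ1, hσ2⟩ : ∃ σ : Perm (Option (Option (ZMod p))), σ none = x ∧ σ (some none) = y := by
    refine ⟨swap (swap none x (some none)) y * swap none x, ?_, ?_⟩
    · rw [Perm.mul_apply, swap_apply_left, swap_apply_of_ne_of_ne _ hxy]
      intro h
      rw [← swap_apply_left none x] at h
      simpa using (swap none x).injective h
    · rw [Perm.mul_apply, swap_apply_left]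
  obtain ⟨g, hg, h⟩ := exists_mem_eq_on_fixed hH hc (isCycle_shift₂ hp)
    (by rwa [support_shift₂ hp]) (by
      rw [support_shift₂ hp, Fintype.card_option, Fintype.card_option, ZMod.card]; omega) σ
  have h1 : g⁻¹ x = none := by
    rw [Perm.inv_eq_iff_eq, h _ rfl, hσ1]
  have h2 : g⁻¹ y = some none := by
    rw [Perm.inv_eq_iff_eq, h _ rfl, hσ2]
  obtain ⟨j, hj⟩ : ∃ j, g⁻¹ z = some (some j) := by
    rcases hz : g⁻¹ z with _ | _ | j
    · exact absurd (g⁻¹.injective (h1.trans hz.symm)) hxz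
    · exact absurd (g⁻¹.injective (h2.trans hz.symm)) hyz
    · exact ⟨j, rfl⟩
  refine ⟨shift₂ (-j) * g⁻¹, H.mul_mem (shift₂_mem hc _) (H.inv_mem hg), ?_, ?_, ?_⟩
  · rw [Perm.mul_apply, h1, shift₂_none]
  · rw [Perm.mul_apply, h2, shift₂_some_none]
  · rw [Perm.mul_apply, hj, shift₂_some_some, add_neg_cancel]

theorem affine_of_conj_eq_pow (hp : p.Prime) {h : Perm (Option (Option (ZMod p)))} {k : ℕ}
    (hk : h * shift₂ 1 * h⁻¹ = shift₂ 1 ^ k) :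
    ∃ b : ZMod p, ∀ x, h (some (some x)) = some (some (k * x + b)) := by
  obtain ⟨b, hb⟩ : ∃ b, h (some (some 0)) = some (some b) := by
    have h1 := (support_eq_of_conj_eq_pow hp (orderOf_shift₂ hp) hk).2 (some (some 0))
    rw [shift₂_apply_eq_iff hp.two_le, shift₂_apply_eq_iff hp.two_le] at h1
    rcases h2 : h (some (some 0)) with _ | _ | b
    · simp [h2] at h1
    · simp [h2] at h1
    · exact ⟨b, rfl⟩
  exact ⟨b, apply_eq_of_conj_eq_pow (u := fun x => some (some x)) (fun x => rfl) hk hb⟩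

/-- The element is taken in the normaliser of the p-cycle, so it is affine on `ZMod p`; a
translation removes the constant term. -/
theorem exists_swapping (hp : p.Prime)
    (hH : MulAction.IsPreprimitive H (Option (Option (ZMod p)))) (hc : shift₂ (1 : ZMod p) ∈ H) :
    ∃ s ∈ H, s none = some none ∧ s (some none) = none ∧
      ∃ k : ZMod p, ∀ x, s (some (some x)) = some (some (k * x)) := by
  obtain ⟨g, hg, ⟨k, hk⟩, h⟩ := exists_normalizing_eq_on_fixed hH hc (isCycle_shift₂ hp)
    (by rwa [support_shift₂ hp]) (by
      rw [support_shift₂ hp, Fintype.card_option, Fintype.card_option, ZMod.card]; omega)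
    (σ := swap none (some none)) (fun v hv => by
      rw [shift₂_apply_eq_iff hp.two_le] at hv ⊢
      rcases hv with rfl | rfl
      · right; rw [swap_apply_left]
      · left; rw [swap_apply_right])
  obtain ⟨b, hb⟩ := affine_of_conj_eq_pow hp hk
  refine ⟨shift₂ (-b) * g, H.mul_mem (shift₂_mem hc _) hg, ?_, ?_, k, fun x => ?_⟩
  · rw [Perm.mul_apply, h _ rfl, swap_apply_left, shift₂_some_none]
  · rw [Perm.mul_apply, h _ rfl, swap_apply_right, shift₂_none]
  · rw [Perm.mul_apply, hb, shift₂_some_some, add_neg_cancel_right]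

end TwoFixedPoints

theorem exists_optionCongr_eq {α : Type*} {h : Perm (Option α)} (hn : h none = none) :
    ∃ σ : Perm α, Equiv.optionCongr σ = h := by
  refine ⟨Equiv.removeNone h, Equiv.ext fun x => ?_⟩
  cases x with
  | none => rw [hn]; rfl
  | some x =>
    rw [optionCongr_apply, Option.map_some]
    refine Equiv.removeNone_some _ (Option.ne_none_iff_exists'.1 fun h' => ?_)
    simpa using h.injective (h'.trans hn.symm)

/-- The permutation that agrees with `τ` on `ZMod p`, followed by the exchange of `0` and the
second additional point. -/
def exchangeZero {p : ℕ} (τ : Perm (ZMod p)) : Perm (Option (Option (ZMod p))) :=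
  swap (some none) (some (some 0)) * Equiv.optionCongr (Equiv.optionCongr τ)

theorem exists_exchangeZero_eq {p : ℕ} {t : Perm (Option (Option (ZMod p)))} (h1 : t none = none)
    (h2 : t (some none) = some (some 0)) (h3 : t (some (some 0)) = some none) :
    ∃ τ : Perm (ZMod p), τ 0 = 0 ∧ t = exchangeZero τ := by
  obtain ⟨g, hg⟩ : ∃ g, g = swap (some none) (some (some 0)) * t := ⟨_, rfl⟩
  obtain ⟨σ, hσ⟩ := exists_optionCongr_eq (h := g) (by
    rw [hg, Perm.mul_apply, h1]; exact swap_apply_of_ne_of_ne (by simp) (by simp))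
  have h4 : ∀ x : Option (ZMod p), g (some x) = some (σ x) := fun x => by rw [← hσ]; rfl
  obtain ⟨τ, hτ⟩ := exists_optionCongr_eq (h := σ) (by
    apply Option.some_injective
    rw [← h4, hg, Perm.mul_apply, h2, swap_apply_right])
  have h5 : ∀ x : ZMod p, g (some (some x)) = some (some (τ x)) := fun x => by rw [h4, ← hτ]; rfl
  refine ⟨τ, ?_, ?_⟩
  · have := h5 0
    rw [hg, Perm.mul_apply, h3, swap_apply_left] at this
    simpa using this.symm
  · rw [exchangeZero, hτ, hσ, hg, swap_mul_self_mul]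

/-- The permutation negating `ZMod p` and exchanging the two additional points. -/
def exchangeNeg {p : ℕ} : Perm (Option (Option (ZMod p))) :=
  swap none (some none) * Equiv.optionCongr (Equiv.optionCongr (Equiv.neg (ZMod p)))

/-! ### Degree seven -/

section Seven

/-- A permutation that is trivial as soon as it fixes three points. -/
def IsRigid {α : Type*} [Fintype α] [DecidableEq α] (g : Perm α) : Prop :=
  g = 1 ∨ (Finset.univ.filter fun x => g x = x).card ≤ 2

instance {α : Type*} [Fintype α] [DecidableEq α] : DecidablePred (IsRigid (α := α)) := fun g =>
  inferInstanceAs (Decidable (g = 1 ∨ (Finset.univ.filter fun x => g x = x).card ≤ 2))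

-- The finite check that excludes a sharply 3-transitive group of degree 7, in which all four kinds
-- of words would be rigid.
set_option synthInstance.maxSize 1000 in
set_option synthInstance.maxHeartbeats 200000 in
theorem exists_not_isRigid : ∀ τ : Perm (ZMod 5), τ 0 = 0 →
    ¬ (IsRigid (exchangeZero τ) ∧ IsRigid (exchangeZero τ * exchangeZero τ) ∧
      IsRigid (exchangeNeg * exchangeZero τ) ∧
      ∀ i, IsRigid (exchangeZero τ * shift₂ i * exchangeZero τ * shift₂ (-i))) := by
  decide +kernel

/-- Without 3-cycles the pointwise stabiliser of three points is trivial, so every element of H is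
rigid. The elements exchanging 0 or the first additional point with the second then have the shapes
refuted by `exists_not_isRigid`. -/
theorem isThreeCycle_of_seven {H : Subgroup (Perm (Option (Option (ZMod 5))))}
    (hH : MulAction.IsPreprimitive H (Option (Option (ZMod 5)))) (hc : shift₂ (1 : ZMod 5) ∈ H)
    (h3 : IsSetHomogeneous H 3) : ∃ g ∈ H, g.IsThreeCycle := by
  by_contra hno
  have hcard : Fintype.card (Option (Option (ZMod 5))) = 7 := rfl
  have h4 : IsSetHomogeneous H 4 := h3.compl (by rw [hcard])
  have h2 : IsSetHomogeneous H 2 := h3.of_le (by omega) (by rw [hcard]; omega)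
  have hbase : ∀ g ∈ H, g none = none → g (some none) = some none →
      g (some (some 0)) = some (some 0) → g = 1 := by
    obtain ⟨S, hS⟩ : ∃ S : Set (Option (Option (ZMod 5))), S = {none, some none, some (some 0)}ᶜ :=
      ⟨_, rfl⟩
    have hSc : S.ncard = 4 := by
      rw [hS, Set.ncard_compl, Nat.card_eq_fintype_card, hcard, Set.ncard_eq_three.2]
      exact ⟨none, some none, some (some 0), by simp, by simp, by simp, rfl⟩
    obtain ⟨K, hK⟩ : ∃ K, K = H ⊓ movingOnly S := ⟨_, rfl⟩
    have hKS : K ≤ movingOnly S := hK ▸ inf_le_right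
    have hKH : K ≤ H := hK ▸ inf_le_left
    have hfac := card_dvd_factorial hKS
    rw [hSc] at hfac
    have hK3 : ¬ 3 ∣ Nat.card K := fun h => hno (isThreeCycle_of_dvd_card hKS (by omega) hKH h)
    -- An involution here moves two or four points, and 2- or 4-homogeneity would turn it into a
    -- 3-cycle.
    have hK2 : ¬ 2 ∣ Nat.card K := by
      intro h
      have : Fact (Nat.Prime 2) := ⟨Nat.prime_two⟩
      obtain ⟨⟨d, hdK⟩, hd⟩ := exists_prime_orderOf_dvd_card' 2 h
      replace hd : orderOf d = 2 := by simpa using hd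
      obtain ⟨a, ha⟩ := support_card_of_prime_order Nat.prime_two hd
      have h1 : (d.support : Set _) ⊆ S := by
        intro x hx
        by_contra hxs
        exact mem_support.1 (Finset.mem_coe.1 hx) (hKS hdK x hxs)
      have h5 := Set.ncard_le_ncard h1 (Set.toFinite S)
      rw [Set.ncard_coe_finset, hSc] at h5
      obtain rfl | rfl : a = 0 ∨ a = 1 := by omega
      · exact hno (h2.exists_isThreeCycle (by omega) (by rw [hcard]; omega) (hKH hdK) ha)
      · exact hno (h4.exists_isThreeCycle (by omega) (by rw [hcard]) (hKH hdK) ha)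
    have hone : Nat.card K = 1 := by
      have hle : Nat.card K ≤ 24 := Nat.le_of_dvd (by norm_num) hfac
      have hpos : 0 < Nat.card K := Nat.card_pos
      rw [show Nat.factorial 4 = 24 from rfl] at hfac
      generalize Nat.card K = n at *
      interval_cases n <;> omega
    rw [Subgroup.card_eq_one] at hone
    intro g hg h1 h2 h3
    rw [← Subgroup.mem_bot, ← hone, hK]
    refine ⟨hg, fun a ha => ?_⟩
    have : a = none ∨ a = some none ∨ a = some (some 0) := by
      simpa [hS, or_iff_not_imp_left] using ha
    rcases this with rfl | rfl | rfl <;> assumption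
  have hrigid : ∀ g ∈ H, IsRigid g := by
    intro g hg
    rw [IsRigid, or_iff_not_imp_right, not_le, Finset.two_lt_card]
    rintro ⟨x, hx, y, hy, z, hz, hxy, hxz, hyz⟩
    simp only [Finset.mem_filter, Finset.mem_univ, true_and] at hx hy hz
    obtain ⟨h, hh, h1, h2, h3⟩ := exists_mem_to_base Nat.prime_five hH hc hxy hxz hyz
    have h4 := hbase (h * g * h⁻¹) (H.mul_mem (H.mul_mem hh hg) (H.inv_mem hh))
      (by rw [← h1]; simp [hx]) (by rw [← h2]; simp [hy]) (by rw [← h3]; simp [hz])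
    rwa [mul_inv_eq_one, mul_eq_left] at h4
  obtain ⟨s, hs, hs1, hs2, k, hsk⟩ := exists_swapping Nat.prime_five hH hc
  -- `s * s` fixes three points, so it is trivial and k = ±1. For k = 1 the element `s` is a
  -- transposition, which is not rigid.
  have hs' : s = exchangeNeg := by
    have hss := hbase (s * s) (H.mul_mem hs hs) (by rw [Perm.mul_apply, hs1, hs2])
      (by rw [Perm.mul_apply, hs2, hs1]) (by simp [hsk])
    have hk : k = 1 ∨ k = -1 := by
      have := DFunLike.congr_fun hss (some (some 1))
      rw [Perm.mul_apply, hsk, hsk] at this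
      simpa [mul_self_eq_one_iff] using this
    rcases hk with rfl | rfl
    · exfalso
      rcases hrigid s hs with h | h
      · rw [h] at hs1; simp at hs1
      · have h5 : (Finset.univ.image fun x : ZMod 5 => some (some x)) ⊆
            (Finset.univ.filter fun x => s x = x) := by
          intro x hx
          obtain ⟨y, -, rfl⟩ := Finset.mem_image.1 hx
          simp [hsk]
        have h6 := Finset.card_le_card h5
        rw [Finset.card_image_of_injective _ (by
          intro x y h; simpa using h), Finset.card_univ, ZMod.card] at h6
        omega
    · ext1 x
      rcases x with _ | _ | x
      · rw [hs1]; rfl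
      · rw [hs2]; rfl
      · rw [hsk, neg_one_mul]; rfl
  obtain ⟨t, ht, ht1, ht2, ht3⟩ := exists_mem_to_base Nat.prime_five hH hc
    (x := none) (y := some (some 0)) (z := some none) (by simp) (by simp) (by simp)
  obtain ⟨τ, hτ, rfl⟩ := exists_exchangeZero_eq ht1 ht3 ht2
  refine exists_not_isRigid τ hτ ⟨hrigid _ ht, hrigid _ (H.mul_mem ht ht),
    hrigid _ (H.mul_mem (hs' ▸ hs) ht), fun i => hrigid _ ?_⟩
  exact H.mul_mem (H.mul_mem (H.mul_mem ht (shift₂_mem hc _)) ht) (shift₂_mem hc _)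

theorem degree_seven {α : Type*} [Fintype α] [DecidableEq α] {H : Subgroup (Perm α)}
    (hα : Fintype.card α = 7) (hH : MulAction.IsPreprimitive H α) (h5 : 5 ∣ Nat.card H)
    (h3 : IsSetHomogeneous H 3) : alternatingGroup α ≤ H := by
  obtain ⟨c, hc, hcc, ho⟩ := exists_isCycle_of_dvd_card Nat.prime_five h5 (by omega)
  obtain ⟨e, he⟩ := exists_mem_relabel_of_isCycle Nat.prime_five hc hcc ho
    (τ := shift₂ (1 : ZMod 5)) (orderOf_shift₂ Nat.prime_five) (support_shift₂ Nat.prime_five)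
    (by rw [hα]; rfl)
  have hprim' := isPreprimitive_relabel hH e
  exact alternatingGroup_le_of_relabel (alternatingGroup_le_of_exists_isThreeCycle hprim'
    (isThreeCycle_of_seven hprim' he (h3.relabel e)))

end Seven

/-! ### Degree nine -/

/-- The pairing of the nonzero `j` with `1 + ω ^ j = ω ^ i`, for `ω` in the field of order `8` with
`ω ^ 3 = 1 + ω`. -/
def starter : Perm (ZMod 7) := swap 1 3 * swap 2 6 * swap 4 5

/-- A map that is affine on `ZMod 7`, with a square as its multiplier. -/
def IsSquareAffine (g : Option (Option (ZMod 7)) → Option (Option (ZMod 7))) : Prop :=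
  ∃ k : ZMod 7, (k = 1 ∨ k = 2 ∨ k = 4) ∧ ∃ b : ZMod 7,
    ∀ x, g (some (some x)) = some (some (k * x + b))

instance : DecidablePred IsSquareAffine := fun g =>
  inferInstanceAs (Decidable (∃ k : ZMod 7, (k = 1 ∨ k = 2 ∨ k = 4) ∧ ∃ b : ZMod 7,
    ∀ x, g (some (some x)) = some (some (k * x + b))))

/-- The map underlying `exchangeZero`. -/
def exchangeMap (v : ZMod 7 → ZMod 7) : Option (Option (ZMod 7)) → Option (Option (ZMod 7))
  | none => none
  | some none => some (some 0)
  | some (some x) => if x = 0 then some none else some (some (v x))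

/-- The relations that hold for the pairing of the nonzero elements of `ZMod 7` induced by an
element of order two in a suitable group of degree nine. -/
def IsAdmissible (v : ZMod 7 → ZMod 7) : Prop :=
  (∀ x, v (v x) = x) ∧
  (∀ j, j ≠ 0 → IsSquareAffine (exchangeMap v ∘ shift₂ (-(v j)) ∘ exchangeMap v ∘ shift₂ j ∘
    exchangeMap v)) ∧
  IsSquareAffine (exchangeNeg ∘ exchangeMap v ∘ exchangeNeg ∘ exchangeMap v ∘ exchangeNeg ∘
    exchangeMap v)

instance : DecidablePred IsAdmissible := fun v =>
  inferInstanceAs (Decidable ((∀ x, v (v x) = x) ∧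
  (∀ j, j ≠ 0 → IsSquareAffine (exchangeMap v ∘ shift₂ (-(v j)) ∘ exchangeMap v ∘ shift₂ j ∘
    exchangeMap v)) ∧
  IsSquareAffine (exchangeNeg ∘ exchangeMap v ∘ exchangeNeg ∘ exchangeMap v ∘ exchangeNeg ∘
    exchangeMap v)))

/-- The map on `ZMod 7` with the given values on the nonzero elements. -/
def ofValues (a b c d e f : ZMod 7) : ZMod 7 → ZMod 7 := (![0, a, b, c, d, e, f] : Fin 7 → ZMod 7)

-- The values are quantified one at a time, each with its distinctness conditions, so that the
-- exhaustive search is pruned early.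
set_option synthInstance.maxSize 5000 in
set_option synthInstance.maxHeartbeats 2000000 in
theorem admissible_values : ∀ a : ZMod 7, a ≠ 0 → ∀ b : ZMod 7, b ≠ 0 ∧ b ≠ a →
    ∀ c : ZMod 7, c ≠ 0 ∧ c ≠ a ∧ c ≠ b → ∀ d : ZMod 7, d ≠ 0 ∧ d ≠ a ∧ d ≠ b ∧ d ≠ c →
    ∀ e : ZMod 7, e ≠ 0 ∧ e ≠ a ∧ e ≠ b ∧ e ≠ c ∧ e ≠ d →
    ∀ f : ZMod 7, f ≠ 0 ∧ f ≠ a ∧ f ≠ b ∧ f ≠ c ∧ f ≠ d ∧ f ≠ e →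
    IsAdmissible (ofValues a b c d e f) →
    (a = 3 ∧ b = 6 ∧ c = 1 ∧ d = 5 ∧ e = 4 ∧ f = 2) ∨
    (a = 5 ∧ b = 3 ∧ c = 2 ∧ d = 6 ∧ e = 1 ∧ f = 4) := by
  decide +kernel
theorem coe_exchangeZero {τ : Perm (ZMod 7)} (hτ : τ 0 = 0) :
    ⇑(exchangeZero τ) = exchangeMap τ := by
  funext x
  rcases x with _ | _ | x
  · change swap (some none) (some (some (0 : ZMod 7))) none = none
    exact swap_apply_of_ne_of_ne (by simp) (by simp)
  · change swap (some none) (some (some (0 : ZMod 7))) (some none) = some (some 0)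
    exact swap_apply_left _ _
  · change swap (some none) (some (some 0)) (some (some (τ x))) = _
    rw [exchangeMap]
    split_ifs with h
    · rw [h, hτ, swap_apply_right]
    · refine swap_apply_of_ne_of_ne (by simp) ?_
      rw [← hτ]
      simpa using h

/-- The two solutions are conjugate under negation of `ZMod 7`, which replaces the generator ω of
the field of order 8 by its inverse. -/
theorem eq_starter_of_isAdmissible {τ : Perm (ZMod 7)} (hτ : τ 0 = 0) (h : IsAdmissible τ) :
    τ = starter ∨ τ = Equiv.neg _ * starter * Equiv.neg _ := by
  have hv : ⇑τ = ofValues (τ 1) (τ 2) (τ 3) (τ 4) (τ 5) (τ 6) := by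
    funext x
    fin_cases x
    · exact hτ
    all_goals rfl
  have hne : ∀ x y : ZMod 7, x ≠ y → τ x ≠ τ y := fun x y h => τ.injective.ne h
  have hne0 : ∀ x : ZMod 7, x ≠ 0 → τ x ≠ 0 := fun x h => hτ ▸ hne x 0 h
  have key := admissible_values (τ 1) (hne0 _ (by decide)) (τ 2)
    ⟨hne0 _ (by decide), hne _ _ (by decide)⟩ (τ 3)
    ⟨hne0 _ (by decide), hne _ _ (by decide), hne _ _ (by decide)⟩ (τ 4)
    ⟨hne0 _ (by decide), hne _ _ (by decide), hne _ _ (by decide), hne _ _ (by decide)⟩ (τ 5)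
    ⟨hne0 _ (by decide), hne _ _ (by decide), hne _ _ (by decide), hne _ _ (by decide),
      hne _ _ (by decide)⟩ (τ 6)
    ⟨hne0 _ (by decide), hne _ _ (by decide), hne _ _ (by decide), hne _ _ (by decide),
      hne _ _ (by decide), hne _ _ (by decide)⟩ (by rw [← hv]; exact h)
  have hext : ∀ σ : Perm (ZMod 7), σ 0 = 0 → τ 1 = σ 1 → τ 2 = σ 2 → τ 3 = σ 3 → τ 4 = σ 4 →
      τ 5 = σ 5 → τ 6 = σ 6 → τ = σ := by
    intro σ h0 h1 h2 h3 h4 h5 h6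
    ext1 x
    fin_cases x
    · exact hτ.trans h0.symm
    all_goals assumption
  rcases key with ⟨h1, h2, h3, h4, h5, h6⟩ | ⟨h1, h2, h3, h4, h5, h6⟩
  · left
    apply hext
    · decide
    all_goals simp only [h1, h2, h3, h4, h5, h6]; decide
  · right
    apply hext
    · decide
    all_goals simp only [h1, h2, h3, h4, h5, h6]; decide

section Nine

variable {H : Subgroup (Perm (Option (Option (ZMod 7))))}

theorem exchangeNeg_apply {p : ℕ} : exchangeNeg (p := p) none = some none ∧
    exchangeNeg (p := p) (some none) = none ∧
    ∀ x : ZMod p, exchangeNeg (some (some x)) = some (some (-x)) :=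
  ⟨rfl, rfl, fun _ => rfl⟩

theorem ne_zero_of_apply_eq {h : Perm (Option (Option (ZMod 7)))} {k b : ZMod 7}
    (hx : ∀ x, h (some (some x)) = some (some (k * x + b))) : k ≠ 0 := by
  rintro rfl
  exact absurd (h.injective ((hx 0).trans (by rw [hx 1, zero_mul, zero_mul]))) (by decide)

/-- The cube of a normalising element that exchanges the additional points has multiplier k³ = ±1.
The value 1 would make this cube the excluded transposition. -/
theorem exchangeNeg_mem (hH : MulAction.IsPreprimitive H (Option (Option (ZMod 7))))
    (hc : shift₂ (1 : ZMod 7) ∈ H)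
    (hswap : swap none (some none) ∉ H) : exchangeNeg ∈ H := by
  obtain ⟨s, hs, hs1, hs2, k, hk⟩ := exists_swapping (by norm_num) hH hc
  have hk0 : k ≠ 0 := ne_zero_of_apply_eq (b := 0) (by simpa using hk)
  have h3 : k * (k * k) = 1 ∨ k * (k * k) = -1 := by
    clear hk
    revert k
    decide
  have hs3 : ∀ x, (s * s * s) (some (some x)) = some (some (k * (k * k) * x)) := by
    intro x
    rw [Perm.mul_apply, Perm.mul_apply, hk, hk, hk]
    congr 2
    ring
  have hmem : s * s * s ∈ H := H.mul_mem (H.mul_mem hs hs) hs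
  rcases h3 with h3 | h3
  · refine absurd ?_ hswap
    convert hmem using 1
    ext1 x
    rcases x with _ | _ | x
    · simp [hs1, hs2]
    · simp [hs1, hs2]
    · rw [hs3, h3, one_mul, swap_apply_of_ne_of_ne (by simp) (by simp)]
  · convert hmem using 1
    ext1 x
    rcases x with _ | _ | x
    · rw [exchangeNeg_apply.1]; simp [hs1, hs2]
    · rw [exchangeNeg_apply.2.1]; simp [hs1, hs2]
    · rw [hs3, h3, exchangeNeg_apply.2.2, neg_one_mul]

/-- A nonsquare modulo 7 has cube −1, so the cube of such an element, after a translation, combines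
with `exchangeNeg` to the excluded transposition. -/
theorem multiplier_of_mem (hc : shift₂ (1 : ZMod 7) ∈ H) (hswap : swap none (some none) ∉ H)
    (hs : exchangeNeg ∈ H) {h : Perm (Option (Option (ZMod 7)))} (hh : h ∈ H) (h1 : h none = none)
    (h2 : h (some none) = some none) {k b : ZMod 7}
    (hx : ∀ x, h (some (some x)) = some (some (k * x + b))) : k = 1 ∨ k = 2 ∨ k = 4 := by
  by_contra hk
  have hk0 := ne_zero_of_apply_eq hx
  have h3 : k * (k * k) = -1 := by
    clear hx
    revert k
    decide
  obtain ⟨g, hg⟩ : ∃ g, g = shift₂ (-b) * h := ⟨_, rfl⟩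
  have hgH : g ∈ H := hg ▸ H.mul_mem (shift₂_mem hc _) hh
  have hgx : ∀ x, g (some (some x)) = some (some (k * x)) := by
    intro x
    rw [hg, Perm.mul_apply, hx, shift₂_some_some, add_neg_cancel_right]
  have hg1 : g none = none := by rw [hg, Perm.mul_apply, h1, shift₂_none]
  have hg2 : g (some none) = some none := by rw [hg, Perm.mul_apply, h2, shift₂_some_none]
  apply hswap
  have : swap none (some none) = exchangeNeg * (g * g * g) := by
    ext1 x
    simp only [Perm.mul_apply]
    rcases x with _ | _ | x
    · rw [hg1, hg1, hg1]; rfl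
    · rw [hg2, hg2, hg2]; rfl
    · rw [hgx, hgx, hgx, exchangeNeg_apply.2.2, swap_apply_of_ne_of_ne (by simp) (by simp)]
      congr 2
      linear_combination x * h3
  rw [this]
  exact H.mul_mem hs (H.mul_mem (H.mul_mem hgH hgH) hgH)

theorem sign_shift₂ (a : ZMod 7) : sign (shift₂ a) = 1 := by
  have h1 : shift₂ (1 : ZMod 7) ∈ alternatingGroup (Option (Option (ZMod 7))) := by
    rw [mem_alternatingGroup, (isCycle_shift₂ (by norm_num)).sign, support_shift₂ (by norm_num)]
    rfl
  exact mem_alternatingGroup.1 (shift₂_mem h1 a)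

/-- A square modulo 7 has cube 1, so `h` cubed is a translation and hence even. -/
theorem sign_eq_one_of_affine {h : Perm (Option (Option (ZMod 7)))} (h1 : h none = none)
    (h2 : h (some none) = some none) {k b : ZMod 7} (hk : k = 1 ∨ k = 2 ∨ k = 4)
    (hx : ∀ x, h (some (some x)) = some (some (k * x + b))) : sign h = 1 := by
  have h3 : k * (k * k) = 1 := by
    clear hx
    revert k
    decide
  have : h * h * h = shift₂ (k * (k * b) + k * b + b) := by
    ext1 x
    simp only [Perm.mul_apply]
    rcases x with _ | _ | x
    · rw [h1, h1, h1, shift₂_none]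
    · rw [h2, h2, h2, shift₂_some_none]
    · rw [hx, hx, hx, shift₂_some_some]
      congr 2
      linear_combination x * h3
  have h4 := congrArg sign this
  rw [sign_shift₂, Perm.sign_mul, Perm.sign_mul, Int.units_mul_self, one_mul] at h4
  exact h4

/-- A Frattini argument: the 7-cycle generates a Sylow subgroup of the normal subgroup of even
elements, so modulo even elements every element of H normalises the 7-cycle. Such normalising
elements are even by the preceding lemmas. -/
theorem sign_eq_one_of_mem (hc : shift₂ (1 : ZMod 7) ∈ H) (hswap : swap none (some none) ∉ H)
    (hs : exchangeNeg ∈ H) : ∀ x ∈ H, sign x = 1 := by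
  have : Fact (Nat.Prime 7) := ⟨by norm_num⟩
  have hp : Nat.Prime 7 := by norm_num
  intro x hx
  have hcA : shift₂ (1 : ZMod 7) ∈ H ⊓ alternatingGroup _ :=
    ⟨hc, mem_alternatingGroup.2 (sign_shift₂ 1)⟩
  have hxA : x * shift₂ (1 : ZMod 7) * x⁻¹ ∈ H ⊓ alternatingGroup _ := by
    refine ⟨H.mul_mem (H.mul_mem hx hc) (H.inv_mem hx), mem_alternatingGroup.2 ?_⟩
    rw [Perm.sign_mul, Perm.sign_mul, sign_shift₂, mul_one, sign_inv, Int.units_mul_self]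
  obtain ⟨y, hy, k, hk⟩ := exists_conj_eq_pow hcA hxA (orderOf_shift₂ hp)
    ((MulEquiv.orderOf_eq (MulAut.conj x) _).trans (orderOf_shift₂ hp)) (by
      intro h
      have h2 := card_dvd_factorial
        (K := H ⊓ alternatingGroup (Option (Option (ZMod 7)))) (s := Set.univ)
        (fun g _ a ha => absurd (Set.mem_univ a) ha)
      rw [Set.ncard_univ, Nat.card_eq_fintype_card (α := Option (Option (ZMod 7)))] at h2
      have h3 := h.trans h2
      revert h3
      decide)
  obtain ⟨n, hn⟩ : ∃ n, n = y * x := ⟨_, rfl⟩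
  have hnk : n * shift₂ 1 * n⁻¹ = shift₂ 1 ^ k := by rw [← hk, hn]; group
  have hnH : n ∈ H := hn ▸ H.mul_mem hy.1 hx
  obtain ⟨b, hb⟩ := affine_of_conj_eq_pow hp hnk
  have hfix := fun v => (support_eq_of_conj_eq_pow hp (orderOf_shift₂ hp) hnk).2 v
  simp only [shift₂_apply_eq_iff hp.two_le] at hfix
  have hsn : sign n = 1 := by
    have h1 := (hfix none).2 (Or.inl rfl)
    have h2 := (hfix (some none)).2 (Or.inr rfl)
    rcases h1 with h1 | h1
    · have h2 : n (some none) = some none := h2.resolve_left fun h => by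
        simpa using n.injective (h.trans h1.symm)
      exact sign_eq_one_of_affine h1 h2 (multiplier_of_mem hc hswap hs hnH h1 h2 hb) hb
    · have h2 : n (some none) = none := h2.resolve_right fun h => by
        simpa using n.injective (h.trans h1.symm)
      have h3 : (exchangeNeg (p := 7) * n) none = none := by rw [Perm.mul_apply, h1]; rfl
      have h4 : (exchangeNeg (p := 7) * n) (some none) = some none := by rw [Perm.mul_apply, h2]; rfl
      have h5 : ∀ x, (exchangeNeg (p := 7) * n) (some (some x)) = some (some ((-k) * x + -b)) := by
        intro x
        rw [Perm.mul_apply, hb, exchangeNeg_apply.2.2]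
        congr 2
        ring
      have h6 := sign_eq_one_of_affine h3 h4
        (multiplier_of_mem hc hswap hs (H.mul_mem hs hnH) h3 h4 h5) h5
      rwa [Perm.sign_mul, show sign (exchangeNeg (p := 7)) = 1 by decide, one_mul] at h6
  rw [hn, Perm.sign_mul, mem_alternatingGroup.1 hy.2, one_mul] at hsn
  exact hsn

/-- The elements of `H` fixing the two additional points. -/
theorem isSquareAffine_of_mem (hc : shift₂ (1 : ZMod 7) ∈ H) (hswap : swap none (some none) ∉ H)
    (hs : exchangeNeg ∈ H) (h4 : ∀ g ∈ H, g.support.card ≠ 4) (h2 : ∀ g ∈ H, g.support.card ≠ 2)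
    (h5 : ¬ 5 ∣ Nat.card H) :
    ∀ h ∈ H, h none = none → h (some none) = some none → IsSquareAffine h := by
  have : Fact (Nat.Prime 7) := ⟨by norm_num⟩
  have hp : Nat.Prime 7 := by norm_num
  obtain ⟨S, hS⟩ : ∃ S : Set (Option (Option (ZMod 7))), S = {none, some none}ᶜ := ⟨_, rfl⟩
  have hSc : S.ncard = 7 := by
    rw [hS, Set.ncard_compl, Nat.card_eq_fintype_card, Set.ncard_pair (by simp)]
    rfl
  have hmemS : ∀ g : Perm (Option (Option (ZMod 7))), g none = none → g (some none) = some none →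
      g ∈ movingOnly S := by
    intro g h1 h2 a ha
    have : a = none ∨ a = some none := by simpa [hS, or_iff_not_imp_left] using ha
    rcases this with rfl | rfl <;> assumption
  obtain ⟨K, hK⟩ : ∃ K, K = H ⊓ movingOnly S := ⟨_, rfl⟩
  have hKS : K ≤ movingOnly S := hK ▸ inf_le_right
  have hKH : K ≤ H := hK ▸ inf_le_left
  have hcK : shift₂ 1 ∈ K := hK ▸ ⟨hc, hmemS _ rfl rfl⟩
  -- An involution on seven points moves 2, 4 or 6 of them. The first two are excluded by
  -- hypothesis, and three transpositions form an odd permutation.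
  have hK2 : ¬ 2 ∣ Nat.card K := by
    intro h
    have : Fact (Nat.Prime 2) := ⟨Nat.prime_two⟩
    obtain ⟨⟨d, hdK⟩, hd⟩ := exists_prime_orderOf_dvd_card' 2 h
    replace hd : orderOf d = 2 := by simpa using hd
    obtain ⟨a, ha⟩ := support_card_of_prime_order Nat.prime_two hd
    have h1 : (d.support : Set _) ⊆ S := by
      intro x hx
      by_contra hxs
      exact mem_support.1 (Finset.mem_coe.1 hx) (hKS hdK x hxs)
    have h6 := Set.ncard_le_ncard h1 (Set.toFinite S)
    rw [Set.ncard_coe_finset, hSc] at h6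
    have h7 := sign_eq_one_of_mem hc hswap hs d (hKH hdK)
    obtain rfl | rfl | rfl : a = 0 ∨ a = 1 ∨ a = 2 := by omega
    · exact h2 d (hKH hdK) ha
    · exact h4 d (hKH hdK) ha
    · rw [sign_of_pow_two_eq_one (by rw [← hd, pow_orderOf_eq_one]), card_fixedPoints, sum_cycleType, ha] at h7
      revert h7
      decide
  have hK5 : ¬ 5 ∣ Nat.card K := fun h => h5 (h.trans (Subgroup.card_dvd_of_le hKH))
  have hfac := card_dvd_factorial hKS
  rw [hSc, show Nat.factorial 7 = 63 * (2 ^ 4 * 5) from rfl] at hfac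
  have h63 : Nat.card K ∣ 63 := by
    refine Nat.Coprime.dvd_of_dvd_mul_right ?_ hfac
    have h1 : Nat.Coprime (Nat.card K) 2 := ((Nat.prime_two.coprime_iff_not_dvd).2 hK2).symm
    have h2 : Nat.Coprime (Nat.card K) 5 := ((Nat.prime_five.coprime_iff_not_dvd).2 hK5).symm
    exact (h1.pow_right 4).mul_right h2
  obtain ⟨r, hr⟩ : 7 ∣ Nat.card K := by
    have := Subgroup.orderOf_dvd_natCard K hcK
    rwa [orderOf_shift₂ hp] at this
  have hr9 : r ∣ 9 := by
    rw [hr, show 63 = 7 * 9 from rfl] at h63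
    exact Nat.dvd_of_mul_dvd_mul_left (by norm_num) h63
  -- The order is 7r with r dividing 9, and 1 is the only divisor of 9 congruent to 1 modulo 7.
  have hnorm := exists_conj_eq_pow_of_card_eq hcK (orderOf_shift₂ hp) hr
    (fun h => absurd (h.trans hr9) (by norm_num)) (fun d hd h => by
      have hd9 := hd.trans hr9
      have : d ≤ 9 := Nat.le_of_dvd (by norm_num) hd9
      interval_cases d <;> omega)
  intro h hh h1 h2
  obtain ⟨k, hk⟩ := hnorm h (hK ▸ ⟨hh, hmemS h h1 h2⟩)
  obtain ⟨b, hb⟩ := affine_of_conj_eq_pow hp hk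
  exact ⟨k, multiplier_of_mem hc hswap hs hh h1 h2 hb, b, hb⟩

/-- 3-transitivity gives such a `t` up to order: `t * t` fixes 0 and both additional points, so it
is multiplication by a square modulo 7 and has trivial cube. Replacing `t` by its cube gives an
involution with the same action on the three points. -/
theorem exists_involution (hH : MulAction.IsPreprimitive H (Option (Option (ZMod 7))))
    (hc : shift₂ (1 : ZMod 7) ∈ H)
    (hK : ∀ h ∈ H, h none = none → h (some none) = some none → IsSquareAffine h) :
    ∃ t ∈ H, t none = none ∧ t (some none) = some (some 0) ∧ t (some (some 0)) = some none ∧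
      t * t = 1 := by
  obtain ⟨t, ht, ht1, ht2, ht3⟩ := exists_mem_to_base (by norm_num) hH hc
    (x := none) (y := some (some 0)) (z := some none) (by simp) (by simp) (by simp)
  obtain ⟨k, hk, b, hb⟩ := hK (t * t) (H.mul_mem ht ht) (by rw [Perm.mul_apply, ht1, ht1])
    (by rw [Perm.mul_apply, ht3, ht2])
  have hb0 : b = 0 := by
    have := hb 0
    rw [Perm.mul_apply, ht2, ht3] at this
    simpa using this.symm
  subst hb0
  have hk3 : k * (k * k) = 1 := by
    clear hb
    revert k
    decide
  refine ⟨t * t * t, H.mul_mem (H.mul_mem ht ht) ht, ?_, ?_, ?_, ?_⟩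
  · simp [ht1]
  · simp [ht2, ht3]
  · simp [ht2, ht3]
  · have : t * t * t * (t * t * t) = (t * t) * ((t * t) * (t * t)) := by group
    rw [this]
    ext1 x
    rcases x with _ | _ | x
    · simp [ht1]
    · simp [ht2, ht3]
    · rw [Perm.mul_apply (t * t), Perm.mul_apply (t * t), hb, hb, hb, Perm.one_apply]
      congr 2
      linear_combination x * hk3

/-- The words in `IsAdmissible` fix both additional points, so they are square-affine by hypothesis.
In the model these points are ∞ and 0, `shift₂ 1` is x ↦ ωx, `exchangeNeg` is inversion and the
involution is x ↦ x + 1. -/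
theorem exchangeZero_starter_mem (hH : MulAction.IsPreprimitive H (Option (Option (ZMod 7))))
    (hc : shift₂ (1 : ZMod 7) ∈ H) (hs : exchangeNeg ∈ H)
    (hK : ∀ h ∈ H, h none = none → h (some none) = some none → IsSquareAffine h) :
    exchangeZero starter ∈ H ∨ exchangeZero (Equiv.neg _ * starter * Equiv.neg _) ∈ H := by
  obtain ⟨t, ht, ht1, ht2, ht3, htt⟩ := exists_involution hH hc hK
  obtain ⟨τ, hτ, rfl⟩ := exists_exchangeZero_eq ht1 ht2 ht3
  have hcoe := coe_exchangeZero hτ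
  have htu : ∀ x, x ≠ 0 → exchangeZero τ (some (some x)) = some (some (τ x)) := by
    intro x hx
    rw [hcoe, exchangeMap, if_neg hx]
  have hadm : IsAdmissible τ := by
    refine ⟨fun x => ?_, fun j hj => ?_, ?_⟩
    · by_cases hx : x = 0
      · rw [hx, hτ, hτ]
      · have h1 := DFunLike.congr_fun htt (some (some x))
        rw [Perm.mul_apply, htu x hx, htu _ (by rw [← hτ]; exact τ.injective.ne hx)] at h1
        simpa using h1
    · have := hK (exchangeZero τ * shift₂ (-(τ j)) * exchangeZero τ * shift₂ j * exchangeZero τ)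
        (H.mul_mem (H.mul_mem (H.mul_mem (H.mul_mem ht (shift₂_mem hc _)) ht) (shift₂_mem hc _)) ht)
        (by simp [ht1]) (by simp [ht2, ht3, htu j hj])
      rw [← hcoe]
      exact this
    · have := hK (exchangeNeg * exchangeZero τ * exchangeNeg * exchangeZero τ * exchangeNeg *
          exchangeZero τ)
        (H.mul_mem (H.mul_mem (H.mul_mem (H.mul_mem (H.mul_mem hs ht) hs) ht) hs) ht)
        (by simp [ht1, ht2, ht3, exchangeNeg_apply]) (by simp [ht1, ht2, ht3, exchangeNeg_apply])
      rw [← hcoe]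
      exact this
  rcases eq_starter_of_isAdmissible hτ hadm with rfl | rfl
  · exact Or.inl ht
  · exact Or.inr ht

end Nine

/-- Fixing the two additional points and the point `0`. -/
def FixesBase (g : Perm (Option (Option (ZMod 7)))) : Prop :=
  g none = none ∧ g (some none) = some none ∧ g (some (some 0)) = some (some 0)

/-- Multiplication by `2`, fixing the two additional points. -/
def double : Perm (Option (Option (ZMod 7))) :=
  Equiv.optionCongr (Equiv.optionCongr ⟨fun x => 2 * x, fun x => 4 * x, by decide, by decide⟩)

theorem double_apply (x : ZMod 7) : double (some (some x)) = some (some (2 * x)) := rfl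

theorem FixesBase.eq_of_apply {g : Perm (Option (Option (ZMod 7)))} (hg : FixesBase g) {k : ZMod 7}
    (hk : k = 1 ∨ k = 2 ∨ k = 4) (hx : ∀ x, g (some (some x)) = some (some (k * x))) :
    g = 1 ∨ g = double ∨ g = double * double := by
  have key : ∀ h : Perm (Option (Option (ZMod 7))), h none = none → h (some none) = some none →
      (∀ x, h (some (some x)) = some (some (k * x))) → g = h := by
    intro h h1 h2 h3
    ext1 x
    rcases x with _ | _ | x
    · rw [hg.1, h1]
    · rw [hg.2.1, h2]
    · rw [hx, h3]
  rcases hk with rfl | rfl | rfl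
  · exact Or.inl (key 1 rfl rfl fun x => by rw [one_mul]; rfl)
  · exact Or.inr (Or.inl (key _ rfl rfl fun x => rfl))
  · refine Or.inr (Or.inr (key _ rfl rfl fun x => ?_))
    rw [Perm.mul_apply, double_apply, double_apply, ← mul_assoc]
    rfl

theorem FixesBase.exists_apply_eq {g : Perm (Option (Option (ZMod 7)))} (hg : FixesBase g)
    (x : ZMod 7) : ∃ y, g (some (some x)) = some (some y) := by
  rcases h : g (some (some x)) with _ | _ | y
  · simpa using g.injective (h.trans hg.1.symm)
  · simpa using g.injective (h.trans hg.2.1.symm)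
  · exact ⟨y, rfl⟩

/-- The three elements generate a 3-transitive group: the images of the three base points are
brought back one after the other. -/
theorem exists_mul_fixesBase {Y : Subgroup (Perm (Option (Option (ZMod 7))))}
    (hc : shift₂ 1 ∈ Y) (hs : exchangeNeg ∈ Y) (ht : exchangeZero starter ∈ Y)
    (g : Perm (Option (Option (ZMod 7)))) : ∃ y ∈ Y, FixesBase (y * g) := by
  obtain ⟨t, htt⟩ : ∃ t, t = exchangeZero starter := ⟨_, rfl⟩
  rw [← htt] at ht
  have htc : ⇑t = exchangeMap starter := htt ▸ coe_exchangeZero (by decide)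
  have ht1 : t none = none := by rw [htc]; rfl
  have ht2 : t (some (some 0)) = some none := by rw [htc, exchangeMap, if_pos rfl]
  have hshift : ∀ x : ZMod 7, shift₂ (-x) (some (some x)) = some (some 0) := fun x => by
    rw [shift₂_some_some, add_neg_cancel]
  obtain ⟨y₁, hy₁, h₁⟩ : ∃ y ∈ Y, (y * g) none = none := by
    rcases h : g none with _ | _ | x
    · exact ⟨1, Y.one_mem, h⟩
    · exact ⟨exchangeNeg, hs, by rw [Perm.mul_apply, h]; rfl⟩
    · refine ⟨exchangeNeg * (t * shift₂ (-x)),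
        Y.mul_mem hs (Y.mul_mem ht (shift₂_mem hc _)), ?_⟩
      simp only [Perm.mul_apply, h, hshift, ht2]
      rfl
  obtain ⟨y₂, hy₂, h₂, h₂'⟩ : ∃ y ∈ Y, (y * (y₁ * g)) none = none ∧
      (y * (y₁ * g)) (some none) = some none := by
    rcases h : (y₁ * g) (some none) with _ | _ | x
    · simpa using (y₁ * g).injective (h.trans h₁.symm)
    · exact ⟨1, Y.one_mem, h₁, h⟩
    · refine ⟨t * shift₂ (-x), Y.mul_mem ht (shift₂_mem hc _), ?_, ?_⟩
      · rw [Perm.mul_apply, h₁, Perm.mul_apply, shift₂_none, ht1]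
      · rw [Perm.mul_apply, h, Perm.mul_apply, hshift, ht2]
  rcases h : (y₂ * (y₁ * g)) (some (some 0)) with _ | _ | x
  · simpa using (y₂ * (y₁ * g)).injective (h.trans h₂.symm)
  · simpa using (y₂ * (y₁ * g)).injective (h.trans h₂'.symm)
  · refine ⟨shift₂ (-x) * y₂ * y₁, Y.mul_mem (Y.mul_mem (shift₂_mem hc _) hy₂) hy₁, ?_⟩
    rw [mul_assoc, mul_assoc]
    refine ⟨?_, ?_, ?_⟩
    · rw [Perm.mul_apply, h₂, shift₂_none]
    · rw [Perm.mul_apply, h₂', shift₂_some_none]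
    · rw [Perm.mul_apply, h, hshift]

/-! ### The field of order eight and its projective line -/

section FieldOfOrderEight

variable {K : Type*} [Field K]

/-- Modulo 2, a⁸ − a = a(a − 1)(a³ − a − 1)(a³ + a² + 1), and the inverse of a root of the last
factor is a root of the cubic before it. -/
theorem exists_pow_three_eq [CharP K 2] (hK : Nat.card K = 8) : ∃ ω : K, ω ^ 3 = ω + 1 := by
  have : Finite K := Nat.finite_of_card_ne_zero (by omega)
  have := Fintype.ofFinite K
  have h2 : (2 : K) = 0 := CharTwo.two_eq_zero
  obtain ⟨a, ha0, ha1⟩ : ∃ a : K, a ≠ 0 ∧ a ≠ 1 := by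
    classical
    have h : ({0, 1} : Finset K).card < (Finset.univ : Finset K).card := by
      rw [Finset.card_univ, ← Nat.card_eq_fintype_card, hK]
      exact Finset.card_le_two.trans_lt (by norm_num)
    obtain ⟨a, -, ha⟩ := Finset.exists_mem_notMem_of_card_lt_card h
    exact ⟨a, by simpa [not_or] using ha⟩
  have h8 : a ^ 8 = a := by
    have := FiniteField.pow_card a
    rwa [← Nat.card_eq_fintype_card, hK] at this
  have h : a * (a - 1) * ((a ^ 3 - (a + 1)) * (a ^ 3 + a ^ 2 + 1)) = 0 := by
    have : a * (a - 1) * ((a ^ 3 - (a + 1)) * (a ^ 3 + a ^ 2 + 1)) =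
      a ^ 8 - a - 2 * (a ^ 6 - a) := by ring
    rw [this, h2, h8]; ring
  rcases mul_eq_zero.1 h with h | h
  · rcases mul_eq_zero.1 h with h | h
    · exact absurd h ha0
    · exact absurd (sub_eq_zero.1 h) ha1
  rcases mul_eq_zero.1 h with h | h
  · exact ⟨a, sub_eq_zero.1 h⟩
  · refine ⟨a⁻¹, ?_⟩
    field_simp
    linear_combination h - (a ^ 2 + a ^ 3) * h2

/-- The powers of an element of order `7`, indexed by `ZMod 7`. -/
def zpowSeven (ω : K) (j : ZMod 7) : K := ω ^ j.val

variable {ω : K} (hω : ω ^ 3 = ω + 1)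

include hω

theorem ne_zero_of_pow_three : ω ≠ 0 := by
  rintro rfl
  simp at hω

theorem zpowSeven_ne_zero (i : ZMod 7) : zpowSeven ω i ≠ 0 :=
  pow_ne_zero _ (ne_zero_of_pow_three hω)

variable [CharP K 2]

theorem orderOf_of_pow_three : orderOf ω = 7 := by
  have : Fact (Nat.Prime 7) := ⟨by norm_num⟩
  have h2 : (2 : K) = 0 := CharTwo.two_eq_zero
  refine orderOf_eq_prime ?_ ?_
  · linear_combination (ω ^ 4 + ω ^ 2 + ω + 1) * hω + (ω ^ 2 + ω) * h2
  · rintro rfl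
    rw [one_pow, one_add_one_eq_two, h2] at hω
    exact one_ne_zero hω

theorem zpowSeven_natCast (n : ℕ) : zpowSeven ω n = ω ^ n := by
  rw [zpowSeven, ZMod.val_natCast, ← orderOf_of_pow_three hω, pow_mod_orderOf]

theorem zpowSeven_add (i j : ZMod 7) : zpowSeven ω (i + j) = zpowSeven ω i * zpowSeven ω j := by
  obtain ⟨i, rfl⟩ := ZMod.natCast_zmod_surjective i
  obtain ⟨j, rfl⟩ := ZMod.natCast_zmod_surjective j
  rw [← Nat.cast_add, zpowSeven_natCast hω, zpowSeven_natCast hω, zpowSeven_natCast hω, pow_add]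

theorem zpowSeven_mul (i : ℕ) (j : ZMod 7) : zpowSeven ω (i * j) = zpowSeven ω j ^ i := by
  obtain ⟨j, rfl⟩ := ZMod.natCast_zmod_surjective j
  rw [← Nat.cast_mul, zpowSeven_natCast hω, zpowSeven_natCast hω, mul_comm, pow_mul]

theorem zpowSeven_injective : Function.Injective (zpowSeven ω) := by
  intro i j h
  apply ZMod.val_injective
  have ho := orderOf_of_pow_three hω
  exact pow_injOn_Iio_orderOf (by rw [Set.mem_Iio, ho]; exact ZMod.val_lt i)
    (by rw [Set.mem_Iio, ho]; exact ZMod.val_lt j) h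

/-- `starter` is the table of Zech logarithms for ω. -/
theorem zpowSeven_add_one (i : ZMod 7) (hi : i ≠ 0) :
    zpowSeven ω i + 1 = zpowSeven ω (starter i) := by
  have h2 : (2 : K) = 0 := CharTwo.two_eq_zero
  have h : ∀ a b : ℕ, ω ^ a + 1 = ω ^ b → zpowSeven ω a + 1 = zpowSeven ω b := fun a b h => by
    rw [zpowSeven_natCast hω, zpowSeven_natCast hω, h]
  fin_cases i
  · exact absurd rfl hi
  · refine h 1 3 ?_
    linear_combination -hω
  · refine h 2 6 ?_
    linear_combination (- ω ^ 3 - ω - 1) * hω - ω * h2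
  · refine h 3 1 ?_
    linear_combination hω + h2
  · refine h 4 5 ?_
    linear_combination (ω - 1 - ω ^ 2) * hω
  · refine h 5 4 ?_
    linear_combination (1 + ω ^ 2 - ω) * hω + h2
  · refine h 6 2 ?_
    linear_combination (ω ^ 3 + ω + 1) * hω + (ω + 1) * h2

/-- The field of order `8` as zero together with the powers of a generator. -/
noncomputable def fieldLabel (hK : Nat.card K = 8) : Option (ZMod 7) ≃ K :=
  Equiv.ofBijective (fun x => x.elim 0 (zpowSeven ω)) (by
    have : Finite K := Nat.finite_of_card_ne_zero (by omega)
    rw [Nat.bijective_iff_injective_and_card]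
    refine ⟨?_, by rw [hK, Nat.card_eq_fintype_card, Fintype.card_option, ZMod.card]⟩
    intro x y h
    rcases x with _ | x <;> rcases y with _ | y
    · rfl
    · exact absurd h.symm (zpowSeven_ne_zero hω y)
    · exact absurd h (zpowSeven_ne_zero hω x)
    · exact congrArg some (zpowSeven_injective hω h))

/-- The projective line over the field of order `8`, labelled by the powers of a generator. -/
noncomputable def lineLabel (hK : Nat.card K = 8) :
    Option (Option (ZMod 7)) ≃ ℙ K (Fin 2 → K) :=
  (Equiv.optionCongr (fieldLabel hω hK)).trans (projLine K)

theorem mem_relabel_lineLabel (hK : Nat.card K = 8) {P : Subgroup (Perm (ℙ K (Fin 2 → K)))}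
    {g : Perm (Option (Option (ZMod 7)))} : g ∈ relabel P (lineLabel hω hK) ↔
      (Equiv.optionCongr (fieldLabel hω hK)).permCongr g ∈ relabel P (projLine K) := Iff.rfl

/-- Homogeneous coordinates in terms of the labels. -/
noncomputable def coords (ω : K) : Option (Option (ZMod 7)) → K × K
  | none => (1, 0)
  | some none => (0, 1)
  | some (some j) => (zpowSeven ω j, 1)

theorem homogeneous_fieldLabel (hK : Nat.card K = 8) (x : Option (Option (ZMod 7))) :
    homogeneous (Equiv.optionCongr (fieldLabel hω hK) x) 0 = (coords ω x).1 ∧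
    homogeneous (Equiv.optionCongr (fieldLabel hω hK) x) 1 = (coords ω x).2 := by
  rcases x with _ | _ | x <;> exact ⟨rfl, rfl⟩

theorem mem_relabel_PSL2_lineLabel (hK : Nat.card K = 8) {g : Perm (Option (Option (ZMod 7)))} :
    g ∈ relabel (PSL2 K) (lineLabel hω hK) ↔ ∃ a b c d : K, a * d - b * c = 1 ∧
      ∀ x, (a * (coords ω x).1 + b * (coords ω x).2) * (coords ω (g x)).2 =
        (c * (coords ω x).1 + d * (coords ω x).2) * (coords ω (g x)).1 := by
  rw [mem_relabel_lineLabel, mem_relabel_PSL2_iff]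
  refine exists_congr fun a => exists_congr fun b => exists_congr fun c => exists_congr fun d =>
    and_congr_right fun _ => ?_
  rw [← (Equiv.optionCongr (fieldLabel hω hK)).forall_congr_right]
  refine forall_congr' fun x => ?_
  rw [permCongr_apply, symm_apply_apply, (homogeneous_fieldLabel hω hK x).1,
    (homogeneous_fieldLabel hω hK x).2, (homogeneous_fieldLabel hω hK (g x)).1,
    (homogeneous_fieldLabel hω hK (g x)).2]

theorem exists_of_mem_relabel_PGammaL2_lineLabel (hK : Nat.card K = 8)
    {g : Perm (Option (Option (ZMod 7)))} (hg : g ∈ relabel (PGammaL2 K) (lineLabel hω hK)) :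
    ∃ (τ : K ≃+* K) (a b c d : K), (a ≠ 0 ∨ c ≠ 0) ∧
      ∀ x, (a * τ (coords ω x).1 + b * τ (coords ω x).2) * (coords ω (g x)).2 =
        (c * τ (coords ω x).1 + d * τ (coords ω x).2) * (coords ω (g x)).1 := by
  rw [mem_relabel_lineLabel] at hg
  obtain ⟨τ, a, b, c, d, hac, h⟩ := exists_of_mem_relabel_PGammaL2 hg
  refine ⟨τ, a, b, c, d, hac, fun x => ?_⟩
  have := h (Equiv.optionCongr (fieldLabel hω hK) x)
  rwa [permCongr_apply, symm_apply_apply, (homogeneous_fieldLabel hω hK x).1,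
    (homogeneous_fieldLabel hω hK x).2, (homogeneous_fieldLabel hω hK (g x)).1,
    (homogeneous_fieldLabel hω hK (g x)).2] at this

theorem generators_mem_relabel_PSL2 (hK : Nat.card K = 8) :
    shift₂ 1 ∈ relabel (PSL2 K) (lineLabel hω hK) ∧
    exchangeNeg ∈ relabel (PSL2 K) (lineLabel hω hK) ∧
    exchangeZero starter ∈ relabel (PSL2 K) (lineLabel hω hK) := by
  have h2 : (2 : K) = 0 := CharTwo.two_eq_zero
  have h7 : ω ^ 7 = 1 := by rw [← orderOf_of_pow_three hω, pow_orderOf_eq_one]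
  have h0 : zpowSeven ω 0 = 1 := pow_zero ω
  have h1 : zpowSeven ω 1 = ω := pow_one ω
  refine ⟨?_, ?_, ?_⟩ <;> rw [mem_relabel_PSL2_lineLabel hω hK]
  -- A diagonal matrix with ratio ω and determinant ω⁷ = 1.
  · refine ⟨ω ^ 4, 0, 0, ω ^ 3, by linear_combination h7, fun x => ?_⟩
    rcases x with _ | _ | x
    · simp [coords]
    · simp [coords]
    · simp only [coords, shift₂_some_some, zpowSeven_add hω, h1]
      ring
  · refine ⟨0, 1, 1, 0, by linear_combination -h2, fun x => ?_⟩
    rcases x with _ | _ | x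
    · simp [coords, exchangeNeg_apply]
    · simp [coords, exchangeNeg_apply]
    · have := zpowSeven_add hω x (-x)
      rw [add_neg_cancel, h0] at this
      simp only [coords, exchangeNeg_apply]
      linear_combination this
  · refine ⟨1, 1, 0, 1, by ring, fun x => ?_⟩
    rw [coe_exchangeZero (by decide)]
    rcases x with _ | _ | x
    · simp [coords, exchangeMap]
    · simp [coords, exchangeMap, h0]
    · by_cases hx : x = 0
      · subst hx
        simp only [coords, exchangeMap, if_true, h0]
        linear_combination h2
      · simp only [coords, exchangeMap, if_neg hx]
        linear_combination zpowSeven_add_one hω x hx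

/-- Fixing ∞, 0 and 1 forces the matrix to be scalar. -/
theorem eq_one_of_mem_relabel_PSL2 (hK : Nat.card K = 8) {g : Perm (Option (Option (ZMod 7)))}
    (hg : FixesBase g) (hgP : g ∈ relabel (PSL2 K) (lineLabel hω hK)) : g = 1 := by
  rw [mem_relabel_PSL2_lineLabel] at hgP
  obtain ⟨a, b, c, d, hdet, h⟩ := hgP
  have h0 : zpowSeven ω 0 = 1 := pow_zero ω
  have h1 := h none
  have h2 := h (some none)
  have h3 := h (some (some 0))
  rw [hg.1] at h1
  rw [hg.2.1] at h2
  rw [hg.2.2] at h3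
  simp only [coords, h0, mul_one, mul_zero, add_zero, zero_add] at h1 h2 h3
  subst h2
  rw [← h1, add_zero, zero_add] at h3
  subst h3
  have ha : a ≠ 0 := by
    rintro rfl
    simp at hdet
  ext1 x
  rcases x with _ | _ | x
  · exact hg.1
  · exact hg.2.1
  · obtain ⟨y, hy⟩ := hg.exists_apply_eq x
    have h4 := h (some (some x))
    rw [hy] at h4 ⊢
    simp only [coords, ← h1, mul_one, add_zero, zero_mul, zero_add] at h4
    rw [zpowSeven_injective hω (mul_left_cancel₀ ha h4)]
    rfl

/-- Doubling exponents of ω is the Frobenius automorphism. -/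
theorem double_mem_relabel_PGammaL2 (hK : Nat.card K = 8) :
    double ∈ relabel (PGammaL2 K) (lineLabel hω hK) := by
  have : Finite K := Nat.finite_of_card_ne_zero (by omega)
  rw [mem_relabel_lineLabel]
  convert optionCongr_mem_relabel_PGammaL2 (frobeniusEquiv K 2) using 1
  ext1 x
  obtain ⟨x, rfl⟩ := (Equiv.optionCongr (fieldLabel hω hK)).surjective x
  rw [permCongr_apply, symm_apply_apply]
  rcases x with _ | _ | x
  · rfl
  · change some (0 : K) = some (frobeniusEquiv K 2 0)
    rw [map_zero]
  · change some (zpowSeven ω (2 * x)) = some (frobeniusEquiv K 2 (zpowSeven ω x))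
    rw [frobeniusEquiv_apply, frobenius_def]
    exact congrArg some (zpowSeven_mul hω 2 x)

/-- Fixing ∞, 0 and 1 leaves a field automorphism ω ↦ ωᵏ. The equation of ω forces 3k = `starter k`,
which holds only for k = 1, 2, 4. -/
theorem eq_of_mem_relabel_PGammaL2 (hK : Nat.card K = 8) {g : Perm (Option (Option (ZMod 7)))}
    (hg : FixesBase g) (hgP : g ∈ relabel (PGammaL2 K) (lineLabel hω hK)) :
    g = 1 ∨ g = double ∨ g = double * double := by
  obtain ⟨τ, a, b, c, d, hac, h⟩ := exists_of_mem_relabel_PGammaL2_lineLabel hω hK hgP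
  have h0 : zpowSeven ω 0 = 1 := pow_zero ω
  have h1' : zpowSeven ω 1 = ω := pow_one ω
  have h1 := h none
  have h2 := h (some none)
  have h3 := h (some (some 0))
  rw [hg.1] at h1
  rw [hg.2.1] at h2
  rw [hg.2.2] at h3
  simp only [coords, h0, map_one, map_zero, mul_one, mul_zero, add_zero, zero_add] at h1 h2 h3
  subst h2
  rw [← h1, add_zero, zero_add] at h3
  subst h3
  have ha : a ≠ 0 := hac.resolve_right (not_not.2 h1.symm)
  have hτ : ∀ x y : ZMod 7, g (some (some x)) = some (some y) →
      τ (zpowSeven ω x) = zpowSeven ω y := by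
    intro x y hy
    have h4 := h (some (some x))
    rw [hy] at h4
    simp only [coords, ← h1, map_one, mul_one, add_zero, zero_mul, zero_add] at h4
    exact mul_left_cancel₀ ha h4
  obtain ⟨k, hk⟩ := hg.exists_apply_eq 1
  have hk0 : k ≠ 0 := by
    rintro rfl
    exact absurd (g.injective (hk.trans hg.2.2.symm)) (by decide)
  have hτk := hτ 1 k hk
  rw [h1'] at hτk
  have h5 : zpowSeven ω (3 * k) = zpowSeven ω (starter k) := by
    have := congrArg τ hω
    rw [map_pow, map_add, map_one, hτk] at this
    rw [← zpowSeven_add_one hω k hk0, ← this]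
    exact zpowSeven_mul hω 3 k
  have h6 : k = 1 ∨ k = 2 ∨ k = 4 := by
    have := zpowSeven_injective hω h5
    clear hk hτk h5
    revert k
    decide
  refine hg.eq_of_apply h6 fun x => ?_
  obtain ⟨y, hy⟩ := hg.exists_apply_eq x
  have h7 := hτ x y hy
  have h8 : zpowSeven ω x = ω ^ x.val := rfl
  rw [h8, map_pow, hτk, ← zpowSeven_mul hω, ZMod.natCast_zmod_val] at h7
  rw [hy, ← zpowSeven_injective hω h7, mul_comm]

/-- H contains generators of a 3-transitive subgroup of PSL(2,8), so it is determined by its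
elements fixing the base points. These are powers of `double`, which has order 3, so the two cases
are whether H contains `double`. -/
theorem isPermIsomorphic_of_starter_mem (hK : Nat.card K = 8)
    {H : Subgroup (Perm (Option (Option (ZMod 7))))} (hc : shift₂ 1 ∈ H) (hs : exchangeNeg ∈ H)
    (ht : exchangeZero starter ∈ H)
    (hsq : ∀ h ∈ H, h none = none → h (some none) = some none → IsSquareAffine h) :
    IsPermIsomorphic H (PSL2 K) ∨ IsPermIsomorphic H (PGammaL2 K) := by
  have hbase : ∀ h ∈ H, FixesBase h → h = 1 ∨ h = double ∨ h = double * double := by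
    intro h hh hb
    obtain ⟨k, hk, b, hx⟩ := hsq h hh hb.1 hb.2.1
    have hb0 : b = 0 := by
      have := hx 0
      rw [hb.2.2] at this
      simpa using this.symm
    subst hb0
    exact hb.eq_of_apply hk (by simpa using hx)
  obtain ⟨hcP, hsP, htP⟩ := generators_mem_relabel_PSL2 hω hK
  by_cases hd : double ∈ H
  · right
    have hle : relabel (PSL2 K) (lineLabel hω hK) ≤ relabel (PGammaL2 K) (lineLabel hω hK) :=
      Subgroup.comap_mono PSL2_le_PGammaL2
    have hdP := double_mem_relabel_PGammaL2 hω hK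
    have hpow : ∀ (L : Subgroup (Perm (Option (Option (ZMod 7))))), double ∈ L → ∀ g,
        (g = 1 ∨ g = double ∨ g = double * double) → g ∈ L := by
      rintro L hL g (rfl | rfl | rfl)
      exacts [L.one_mem, hL, L.mul_mem hL hL]
    have : H = relabel (PGammaL2 K) (lineLabel hω hK) :=
      eq_of_le_of_le (Y := H ⊓ relabel (PGammaL2 K) (lineLabel hω hK)) (B := FixesBase)
        inf_le_left inf_le_right
        (exists_mul_fixesBase ⟨hc, hle hcP⟩ ⟨hs, hle hsP⟩ ⟨ht, hle htP⟩)
        (fun h hh hb => hpow _ hdP h (hbase h hh hb))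
        (fun h hh hb => hpow _ hd h (eq_of_mem_relabel_PGammaL2 hω hK hb hh))
    rw [this]
    exact isPermIsomorphic_relabel _ _
  · left
    have hone : ∀ h ∈ H, FixesBase h → h = 1 := by
      intro h hh hb
      rcases hbase h hh hb with h1 | rfl | rfl
      · exact h1
      · exact absurd hh hd
      · refine absurd ?_ hd
        have h1 := H.mul_mem hh hh
        rwa [show double * double * (double * double) = double by decide] at h1
    have : H = relabel (PSL2 K) (lineLabel hω hK) :=
      eq_of_le_of_le (Y := H ⊓ relabel (PSL2 K) (lineLabel hω hK)) (B := FixesBase)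
        inf_le_left inf_le_right
        (exists_mul_fixesBase ⟨hc, hcP⟩ ⟨hs, hsP⟩ ⟨ht, htP⟩)
        (fun h hh hb => by rw [hone h hh hb]; exact Subgroup.one_mem _)
        (fun h hh hb => by rw [eq_one_of_mem_relabel_PSL2 hω hK hb hh]; exact H.one_mem)
    rw [this]
    exact isPermIsomorphic_relabel _ _

end FieldOfOrderEight

theorem classification_nine {H : Subgroup (Perm (Option (Option (ZMod 7))))}
    (hH : MulAction.IsPreprimitive H (Option (Option (ZMod 7)))) (hc : shift₂ (1 : ZMod 7) ∈ H)
    (h4 : IsSetHomogeneous H 4) (h5 : ¬ 5 ∣ Nat.card H) (h3 : ∀ g ∈ H, ¬ g.IsThreeCycle) :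
    IsPermIsomorphic H (PSL2 (GaloisField 2 3)) ∨
      IsPermIsomorphic H (PGammaL2 (GaloisField 2 3)) := by
  have hcard : Fintype.card (Option (Option (ZMod 7))) = 9 := rfl
  have h2 : IsSetHomogeneous H 2 := h4.of_le (by omega) (by rw [hcard]; omega)
  have hs4 : ∀ g ∈ H, g.support.card ≠ 4 := fun g hg h => by
    obtain ⟨g, hg, h⟩ := h4.exists_isThreeCycle (by omega) (by rw [hcard]; omega) hg h
    exact h3 g hg h
  have hs2 : ∀ g ∈ H, g.support.card ≠ 2 := fun g hg h => by
    obtain ⟨g, hg, h⟩ := h2.exists_isThreeCycle (by omega) (by rw [hcard]; omega) hg h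
    exact h3 g hg h
  have hswap : swap none (some none) ∉ H := fun h => hs2 _ h (card_support_swap (by simp))
  have hs := exchangeNeg_mem hH hc hswap
  have hsq := isSquareAffine_of_mem hc hswap hs hs4 hs2 h5
  have hK : Nat.card (GaloisField 2 3) = 8 := GaloisField.card 2 3 (by omega)
  obtain ⟨ω, hω⟩ := exists_pow_three_eq hK
  rcases exchangeZero_starter_mem hH hc hs hsq with ht | ht
  · exact isPermIsomorphic_of_starter_mem hω hK hc hs ht hsq
  -- Relabelling by negation reduces the second solution of the finite check to the first.
  · obtain ⟨ν, hν⟩ : ∃ ν : Perm (Option (Option (ZMod 7))),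
      ν = Equiv.optionCongr (Equiv.optionCongr (Equiv.neg _)) := ⟨_, rfl⟩
    have hmem : ∀ g g' : Perm (Option (Option (ZMod 7))), g' ∈ H → (∀ x, ν (g x) = g' (ν x)) →
        g ∈ relabel H ν := by
      intro g g' hg' h
      rw [mem_relabel]
      convert hg' using 1
      ext1 x
      rw [permCongr_apply, h, apply_symm_apply]
    have hν1 : ν.symm none = none := ν.symm_apply_eq.2 (by rw [hν]; rfl)
    have hν2 : ν.symm (some none) = some none := ν.symm_apply_eq.2 (by rw [hν]; rfl)
    have key := isPermIsomorphic_of_starter_mem hω hK (H := relabel H ν)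
      (hmem _ (shift₂ (-1)) (shift₂_mem hc _) (by rw [hν]; decide))
      (hmem _ exchangeNeg hs (by rw [hν]; decide))
      (hmem _ _ ht (by rw [hν]; decide)) (fun h hh h1 h2 => by
        obtain ⟨k, hk, b, hx⟩ := hsq (ν.permCongr h) hh (by rw [permCongr_apply, hν1, h1, hν]; rfl)
          (by rw [permCongr_apply, hν2, h2, hν]; rfl)
        refine ⟨k, hk, -b, fun x => ν.injective ?_⟩
        have h3 := hx (-x)
        have h4 : ν.symm (some (some (-x))) = some (some x) :=
          ν.symm_apply_eq.2 (by rw [hν]; rfl)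
        rw [permCongr_apply, h4] at h3
        rw [h3, hν]
        simp only [optionCongr_apply, Option.map_some, Equiv.neg_apply]
        congr 2
        ring)
    exact key.imp IsPermIsomorphic.of_relabel IsPermIsomorphic.of_relabel

theorem degree_nine {α : Type*} [Fintype α] [DecidableEq α] {H : Subgroup (Perm α)}
    (hα : Fintype.card α = 9) (hH : MulAction.IsPreprimitive H α) (h7 : 7 ∣ Nat.card H)
    (h4 : IsSetHomogeneous H 4) :
    alternatingGroup α ≤ H ∨ IsPermIsomorphic H (PSL2 (GaloisField 2 3)) ∨
      IsPermIsomorphic H (PGammaL2 (GaloisField 2 3)) := by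
  by_cases h5 : 5 ∣ Nat.card H
  · exact Or.inl (alternatingGroup_le_of_prime_dvd_card Nat.prime_five le_rfl hH h5 (by omega)
      (by omega))
  have hp : Nat.Prime 7 := by norm_num
  obtain ⟨c, hc, hcc, ho⟩ := exists_isCycle_of_dvd_card hp h7 (by omega)
  obtain ⟨e, he⟩ := exists_mem_relabel_of_isCycle hp hc hcc ho
    (τ := shift₂ (1 : ZMod 7)) (orderOf_shift₂ hp) (support_shift₂ hp) (by rw [hα]; rfl)
  have hprim' := isPreprimitive_relabel hH e
  by_cases h3 : ∃ g ∈ relabel H e, g.IsThreeCycle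
  · exact Or.inl (alternatingGroup_le_of_relabel
      (alternatingGroup_le_of_exists_isThreeCycle hprim' h3))
  · push Not at h3
    exact Or.inr ((classification_nine hprim' he (h4.relabel e) (by rwa [card_relabel]) h3).imp
      IsPermIsomorphic.of_relabel IsPermIsomorphic.of_relabel)

/-! ### Choice of the prime, and the conclusion -/

/-- The margin 4 leaves three fixed points for Jordan's theorem even after one point has been
removed. For m·k ≥ 16 the prime comes from the strengthened Bertrand postulate at half of m·k; below
that, only 4, 6, 8, 10 and 14 fail. -/
theorem exists_good_prime {m k : ℕ} (hm : 2 ≤ m) (hk : 2 ≤ k) :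
    (∃ p, p.Prime ∧ 5 ≤ p ∧ m < p ∧ k < p ∧ p + 4 ≤ m * k ∧ m * k < 2 * p) ∨
      (m = 2 ∧ (k = 2 ∨ k = 3 ∨ k = 4 ∨ k = 5 ∨ k = 7)) ∨
      (k = 2 ∧ (m = 3 ∨ m = 4 ∨ m = 5 ∨ m = 7)) := by
  by_cases h16 : 16 ≤ m * k
  · obtain ⟨p, hp, h1, h2⟩ := exists_prime_lt_and_add_four_le (m * k / 2) (by omega)
    have hm2 : m * 2 ≤ m * k := Nat.mul_le_mul_left _ hk
    have hk2 : 2 * k ≤ m * k := Nat.mul_le_mul_right _ hm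
    exact Or.inl ⟨p, hp, by omega, by omega, by omega, by omega, by omega⟩
  · have hm8 : m < 8 := by nlinarith
    have hk8 : k < 8 := by nlinarith
    interval_cases m <;> interval_cases k <;>
      first
      | omega
      | exact Or.inr (by decide)
      | exact Or.inl ⟨5, by norm_num, by omega, by omega, by omega, by omega, by omega⟩
      | exact Or.inl ⟨7, by norm_num, by omega, by omega, by omega, by omega, by omega⟩
      | exact Or.inl ⟨11, by norm_num, by omega, by omega, by omega, by omega, by omega⟩

/-- No point is lost here, so p ≤ n − 3 suffices and n = 8, 10, 14 are settled by p = 5, 7, 11. Only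
n = 4 and n = 6 need separate arguments. -/
theorem classification_of_isPairHomogeneous {Ω : Type*} [Fintype Ω] [DecidableEq Ω] {m k : ℕ}
    (hn : Fintype.card Ω = m * k) (hm : 2 ≤ m) (hk : 2 ≤ k) {G : Subgroup (Perm Ω)}
    (hG : IsBalancedHomogeneous G m k) (hP : IsPairHomogeneous G) :
    IsBalancedTransitive G m k ∨ (m = 2 ∧ k = 3 ∧ IsPermIsomorphic G (PSL2 (ZMod 5))) := by
  have hmk : 4 ≤ m * k := by nlinarith
  have hprim := hP.isPreprimitive (by omega)
  have halt : alternatingGroup Ω ≤ G → IsBalancedTransitive G m k :=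
    IsBalancedTransitive.of_alternatingGroup_le (by omega) hk
  have hprime : ∀ p, p.Prime → 5 ≤ p → m < p → k < p → p + 3 ≤ m * k → m * k < 2 * p →
      IsBalancedTransitive G m k := fun p hp h5 hmp hkp hle hlt =>
    halt (alternatingGroup_le_of_prime_dvd_card hp h5 hprim
      (prime_dvd_card hp hmp hkp hn (by omega) hG) (by omega) (by omega))
  rcases exists_good_prime hm hk with ⟨p, hp, h5, hmp, hkp, hle, hlt⟩ | ⟨rfl, h⟩ | ⟨rfl, h⟩
  · exact Or.inl (hprime p hp h5 hmp hkp (by omega) hlt)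
  · rcases h with rfl | rfl | rfl | rfl | rfl
    · left
      refine IsBalancedTransitive.of_isSetHomogeneous fun s t hs ht => ?_
      obtain ⟨x, y, hxy, rfl⟩ := Finset.card_eq_two.1 hs
      obtain ⟨u, v, huv, rfl⟩ := Finset.card_eq_two.1 ht
      obtain ⟨g, hg, h⟩ := hP x y u v hxy huv
      refine ⟨g, hg, ?_⟩
      rcases h with ⟨rfl, rfl⟩ | ⟨rfl, rfl⟩
      · simp
      · simp [Finset.pair_comm]
    · rcases degree_six hn hP (prime_dvd_card Nat.prime_five (by omega) (by omega) hn (by omega) hG)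
        with h | h
      · exact Or.inl (IsBalancedTransitive.of_isSetHomogeneous h)
      · exact Or.inr ⟨rfl, rfl, h⟩
    · exact Or.inl (hprime 5 (by norm_num) (by omega) (by omega) (by omega) (by omega) (by omega))
    · exact Or.inl (hprime 7 (by norm_num) (by omega) (by omega) (by omega) (by omega) (by omega))
    · exact Or.inl (hprime 11 (by norm_num) (by omega) (by omega) (by omega) (by omega) (by omega))
  · left
    rcases h with rfl | rfl | rfl | rfl
    · exact halt (alternatingGroup_le_of_exists_isThreeCycle hprim
        (exists_isThreeCycle_of_three_pairs hG hn))
    · exact hprime 5 (by norm_num) (by omega) (by omega) (by omega) (by omega) (by omega)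
    · exact hprime 7 (by norm_num) (by omega) (by omega) (by omega) (by omega) (by omega)
    · exact hprime 11 (by norm_num) (by omega) (by omega) (by omega) (by omega) (by omega)

theorem classification_of_fixed_point {Ω : Type*} [Fintype Ω] [DecidableEq Ω] {m k : ℕ}
    (hn : Fintype.card Ω = m * k) (hm : 2 ≤ m) (hk : 2 ≤ k) {G : Subgroup (Perm Ω)}
    (hG : IsBalancedHomogeneous G m k) {z : Ω} (hz : ∀ g ∈ G, g z = z)
    (hP : IsPairHomogeneous (restrictAway G z)) :
    (m = 2 ∧ k = 3 ∧ FixesAndActsAs G z (AGL1 (ZMod 5))) ∨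
    (m = 2 ∧ k = 5 ∧ (FixesAndActsAs G z (PSL2 (GaloisField 2 3)) ∨
      FixesAndActsAs G z (PGammaL2 (GaloisField 2 3)))) ∨
    (FixesAndActsAs G z (alternatingGroup {x : Ω // x ≠ z}) ∨
      FixesAndActsAs G z (⊤ : Subgroup (Perm {x : Ω // x ≠ z}))) := by
  have hmk : 4 ≤ m * k := by nlinarith
  have hcard : Fintype.card {x : Ω // x ≠ z} + 1 = m * k := by
    rw [← hn, Fintype.card_subtype_compl, Fintype.card_subtype_eq]
    omega
  have hprim := hP.isPreprimitive (by omega)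
  have halt : alternatingGroup {x : Ω // x ≠ z} ≤ restrictAway G z → _ := fun h =>
    Or.inr (a := (m = 2 ∧ k = 3 ∧ FixesAndActsAs G z (AGL1 (ZMod 5))))
      (Or.inr (a := (m = 2 ∧ k = 5 ∧ (FixesAndActsAs G z (PSL2 (GaloisField 2 3)) ∨
      FixesAndActsAs G z (PGammaL2 (GaloisField 2 3)))))
      (fixesAndActsAs_of_alternatingGroup_le hz h))
  have hdvd : ∀ p, p.Prime → m < p → k < p → p ≤ m * k → p ∣ Nat.card (restrictAway G z) :=
    fun p hp hmp hkp hle => by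
      rw [card_restrictAway hz]
      exact prime_dvd_card hp hmp hkp hn hle hG
  have hprime : ∀ p, p.Prime → 5 ≤ p → m < p → k < p → p + 4 ≤ m * k → m * k ≤ 2 * p → _ :=
    fun p hp h5 hmp hkp hle hlt =>
    halt (alternatingGroup_le_of_prime_dvd_card hp h5 hprim
      (hdvd p hp hmp hkp (by omega)) (by omega) (by omega))
  rcases exists_good_prime hm hk with ⟨p, hp, h5, hmp, hkp, hle, hlt⟩ | ⟨rfl, h⟩ | ⟨rfl, h⟩
  · exact hprime p hp h5 hmp hkp (by omega) hlt.le
  · rcases h with rfl | rfl | rfl | rfl | rfl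
    · refine halt (alternatingGroup_le_of_exists_isThreeCycle hprim ?_)
      obtain ⟨c, hc, hcc, ho⟩ := exists_isCycle_of_dvd_card Nat.prime_three
        (hdvd 3 Nat.prime_three (by omega) (by omega) (by omega)) (by omega)
      exact ⟨c, hc, isThreeCycle_of_isCycle hcc ho⟩
    · rcases degree_five (by omega) hP (hdvd 5 Nat.prime_five (by omega) (by omega) (by omega))
        with h | h
      · exact halt h
      · exact Or.inl ⟨rfl, rfl, FixesAndActsAs.of_restrictAway hz h⟩
    · exact halt (degree_seven (by omega) hprim
        (hdvd 5 Nat.prime_five (by omega) (by omega) (by omega))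
        (isSetHomogeneous_restrictAway hn hG hz))
    · rcases degree_nine (by omega) hprim (hdvd 7 (by norm_num) (by omega) (by omega) (by omega))
        (isSetHomogeneous_restrictAway hn hG hz) with h | h | h
      · exact halt h
      · exact Or.inr (Or.inl ⟨rfl, rfl, Or.inl (FixesAndActsAs.of_restrictAway hz h)⟩)
      · exact Or.inr (Or.inl ⟨rfl, rfl, Or.inr (FixesAndActsAs.of_restrictAway hz h)⟩)
    · exact halt (degree_thirteen (by omega) hprim (isSetHomogeneous_restrictAway hn hG hz))
  · rcases h with rfl | rfl | rfl | rfl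
    · exact halt (alternatingGroup_le_of_exists_isThreeCycle hprim
        (exists_isThreeCycle_restrictAway hz (exists_isThreeCycle_of_three_pairs hG hn)))
    · exact halt (alternatingGroup_le_of_exists_isThreeCycle hprim
        (exists_isThreeCycle_restrictAway hz (exists_isThreeCycle_of_four_pairs hG hn)))
    -- 5 is not larger than m, so `prime_dvd_card` does not apply, but there are 10!/(5!·2⁵) = 945 =
    -- 5·189 pairings.
    · refine halt (alternatingGroup_le_of_prime_dvd_card Nat.prime_five (by omega) hprim ?_
        (by omega) (by omega))
      obtain ⟨f, hf⟩ := exists_isBalanced hn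
      obtain ⟨T, -, hT⟩ := factorial_mul_card_stabilizer hG hf
      rw [hn] at hT
      norm_num [Nat.factorial] at hT
      rw [card_restrictAway hz]
      exact ⟨189 * Nat.card T, by omega⟩
    -- Likewise 14!/(7!·2⁷) = 135135 = 7·19305.
    · refine halt (alternatingGroup_le_of_prime_dvd_card (p := 7) (by norm_num) (by omega) hprim ?_
        (by omega) (by omega))
      obtain ⟨f, hf⟩ := exists_isBalanced hn
      obtain ⟨T, -, hT⟩ := factorial_mul_card_stabilizer hG hf
      rw [hn] at hT
      norm_num [Nat.factorial] at hT
      rw [card_restrictAway hz]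
      exact ⟨19305 * Nat.card T, by omega⟩

end PartitionHomogeneous

theorem theorem4p1 {Ω : Type*} [Fintype Ω] [DecidableEq Ω] (n : ℕ) (hn : Fintype.card Ω = n)
    (lam : List ℕ) (hlam : PartitionHomogeneous.IsPartitionOf n lam)
    (huniform : PartitionHomogeneous.IsUniform lam) (hne : lam ≠ List.replicate n 1)
    (G : Subgroup (Equiv.Perm Ω)) (hG : PartitionHomogeneous.IsPartitionHomogeneous G lam) :
    PartitionHomogeneous.IsPartitionTransitive G lam ∨
    (n = 6 ∧ lam = [3, 3] ∧
      (PartitionHomogeneous.IsPermIsomorphic G (PartitionHomogeneous.PSL2 (ZMod 5)) ∨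
        ∃ z : Ω, PartitionHomogeneous.FixesAndActsAs G z
          (PartitionHomogeneous.AGL1 (ZMod 5)))) ∨
    (n = 10 ∧ lam = [5, 5] ∧
      ∃ z : Ω,
        PartitionHomogeneous.FixesAndActsAs G z
            (PartitionHomogeneous.PSL2 (GaloisField 2 3)) ∨
          PartitionHomogeneous.FixesAndActsAs G z
            (PartitionHomogeneous.PGammaL2 (GaloisField 2 3))) ∨
    ∃ z : Ω,
      PartitionHomogeneous.FixesAndActsAs G z (alternatingGroup {x : Ω // x ≠ z}) ∨
        PartitionHomogeneous.FixesAndActsAs G z (⊤ : Subgroup (Equiv.Perm {x : Ω // x ≠ z})) := by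
  obtain ⟨k, m, hlk⟩ : ∃ k m, lam = List.replicate m k := by
    rcases lam with _ | ⟨a, l⟩
    · exact ⟨0, 0, rfl⟩
    · refine ⟨a, l.length + 1, List.eq_replicate_iff.2 ⟨rfl, fun b hb => ?_⟩⟩
      exact huniform b hb a List.mem_cons_self
  have hsum := hlam.sum_eq
  rw [hlk, List.sum_replicate, smul_eq_mul] at hsum
  have hlen : lam.length = m := by rw [hlk, List.length_replicate]
  have hall : ∀ a ∈ lam, a = k := fun a ha => List.eq_of_mem_replicate (hlk ▸ ha)
  -- For m = 0 the list is empty and n = 0, so it counts as (1, …, 1) and is excluded.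
  rcases Nat.eq_zero_or_pos m with rfl | hm0
  · exact absurd (by rw [hlk, ← hsum, Nat.zero_mul]; rfl) hne
  have hk0 : 0 < k := hlam.pos k (by rw [hlk]; exact List.mem_replicate.2 ⟨hm0.ne', rfl⟩)
  rcases Nat.lt_or_ge k 2 with hk1 | hk2
  · obtain rfl : k = 1 := by omega
    exact absurd (by rw [hlk, ← hsum, Nat.mul_one]) hne
  -- With a single part there is only one colouring, and the identity suffices.
  rcases Nat.lt_or_ge m 2 with hm1 | hm2
  · left
    refine PartitionHomogeneous.IsBalancedTransitive.isPartitionTransitive hall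
      fun f f' _ _ => ⟨1, G.one_mem, fun x => ?_⟩
    exact Fin.ext (by have := (f' x).2; have := (f x).2; simp only [Equiv.Perm.one_apply]; omega)
  have hB := hG.isBalancedHomogeneous hk0 hall
  have hT := PartitionHomogeneous.IsBalancedTransitive.isPartitionTransitive (G := G) hall
  rw [hlen] at hB hT
  have hcard : Fintype.card Ω = m * k := by rw [hn, hsum]
  rcases PartitionHomogeneous.pairHomogeneous_or_fixes hcard hm2 hk2 hB with hP | ⟨z, hz, -, hP⟩
  · rcases PartitionHomogeneous.classification_of_isPairHomogeneous hcard hm2 hk2 hB hP with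
      h | ⟨rfl, rfl, h⟩
    · exact Or.inl (hT h)
    · exact Or.inr (Or.inl ⟨hsum.symm, hlk, Or.inl h⟩)
  · rcases PartitionHomogeneous.classification_of_fixed_point hcard hm2 hk2 hB hz
      (PartitionHomogeneous.isPairHomogeneous_restrictAway hz hP) with
      ⟨rfl, rfl, h⟩ | ⟨rfl, rfl, h⟩ | h
    · exact Or.inr (Or.inl ⟨hsum.symm, hlk, Or.inr ⟨z, h⟩⟩)
    · exact Or.inr (Or.inr (Or.inl ⟨hsum.symm, hlk, z, h⟩))
    · exact Or.inr (Or.inr (Or.inr ⟨z, h⟩))
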